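/- All graphs are finite and simple; $\alpha(G)$ is the independence number, $N(v)$ the neighbourhood of $v$. A tripartition $(A,B,R)$ of $V(G)$ is non-trivial if $A,B\neq\emptyset$ and $|R|<\min(|A|,|B|)$. For $g,d:\mathbb N\to\mathbb N$ and $k\in\mathbb N$, a non-trivial tripartition $(A,B,R)$ of $V(G)$ with $|R|\le g(k)$ is called, at parameter $k$, a witness of - $(g,d)$-almost bicompleteness if $|B\setminus N(v)|\le d(k)$ for all $v\in A$ and $|A\setminus N(v)|\le d(k)$ for all $v\in B$; - $(g,d)$-almost disconnectedness if $|N(v)\cap B|\le d(k)$ for all $v\in A$ and $|N(v)\cap A|\le d(k)$ for all $v\in B$; - one-sided $(g,d)$-almost disconnectedness if $|B|>k\,d(k)$ and $|N(v)\cap B|\le d(k)$ for all $v\in A$; - $(g,d)$-weak connectedness if $|A|,|B|>d(k)^{d(k)}k^{2d(k)-1}+1$ and the bipartite graph between $A$ and $B$ is $K_{d(k),d(k)}$-free. Fix one of the last three notions and call it "sparse". Let $g_1,d_1,g_2,d_2$ be computable functions. A class $\mathcal C$ of graphs is a class of co-graphs with parameterized noise (for this notion and these functions) if it is closed under induced subgraphs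 and if, for every $G\in\mathcal C$ with at least two vertices and every $k\ge\alpha(G)$, $V(G)$ has a tripartition that is, at parameter $k$, a witness of $(g_1,d_1)$-almost bicompleteness or a sparse witness for $(g_2,d_2)$. Theorem. Let $\mathcal C$ be a class of co-graphs with parameterized noise, and suppose that, possibly with the help of an oracle, such tripartitions can be found in FPT time: some algorithm, given $G\in\mathcal C$ with $|V(G)|\ge 2$ and $k\ge\alpha(G)$, outputs one of these witnesses in time at most $h(k)|V(G)|^{\gamma}$, for some computable $h$ and some constant $\gamma$. Then (with the same oracle, if any) Maximum Independent Set parameterized by the solution size is FPT on $\mathcal C$: there are an algorithm, a computable function $f$ and a constant $c$ such that for all $G\in\mathcal C$ and all $k\in\mathbb N$ the algorithm decides in time at most $f(k)(|V(G)|+1)^{c}$ whether $G$ has an independent set of size $k$. This holds for each of the three sparse notions. Time is the number of elementary steps of a first-order functional programming language with recursion over binary trees (atom test, pairing, projections, composition, branching, function calls), in which a query to the oracle costs the charge set by the oracle plus one; graphs are given by adjacency matrices and $k$ in unary. -/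

import Mathlib

namespace NoisyCographs

/-! ### A first-order functional language over binary trees, with a step count -/

/-- Data values: finite binary trees, that is, S-expressions over the single atom `nil`. -/
inductive Data : Type
  | nil : Data
  | cons : Data → Data → Data

/-- Programs. Every program maps one tree to one tree. -/
inductive Prog : Type
  /-- return the input -/
  | id : Prog
  /-- return `nil` -/
  | nil : Prog
  /-- left component of the input -/
  | hd : Prog
  /-- right component of the input -/
  | tl : Prog
  /-- build a pair from the results of two programs on the same input -/
  | cons : Prog → Prog → Prog
  /-- `comp p q` runs `q`, then `p` on the result -/
  | comp : Prog → Prog → Prog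
  /-- `cond c p q` runs `c`; it continues with `q` if the result is `nil`, with `p` otherwise -/
  | cond : Prog → Prog → Prog → Prog
  /-- recursive call: run the body of the innermost enclosing function on the input -/
  | self : Prog
  /-- `fn p` calls the function with body `p`; inside `p`, `self` refers to `p` -/
  | fn : Prog → Prog
  /-- query the oracle on the input -/
  | oracle : Prog

/-- An oracle: its answers, and the time charged for each query. -/
structure Oracle where
  answer : Data → Data
  cost : Data → ℕ

/-- The oracle that carries no information; programs with this oracle are ordinary programs. -/
def Oracle.trivial : Oracle := ⟨fun _ => Data.nil, fun _ => 0⟩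

/-- `Eval O F p x y t`: inside the function with body `F`, and with oracle `O`, the program `p`
on input `x` halts with result `y` after exactly `t` elementary steps. Every syntactic construct
that is executed costs one step, and a query costs one step more than the charge of the oracle. -/
inductive Eval (O : Oracle) : Prog → Prog → Data → Data → ℕ → Prop
  | id (F : Prog) (x : Data) : Eval O F Prog.id x x 1
  | nil (F : Prog) (x : Data) : Eval O F Prog.nil x Data.nil 1
  | hd_nil (F : Prog) : Eval O F Prog.hd Data.nil Data.nil 1
  | hd_cons (F : Prog) (a b : Data) : Eval O F Prog.hd (Data.cons a b) a 1
  | tl_nil (F : Prog) : Eval O F Prog.tl Data.nil Data.nil 1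
  | tl_cons (F : Prog) (a b : Data) : Eval O F Prog.tl (Data.cons a b) b 1
  | cons (F p q : Prog) (x y z : Data) (s t : ℕ) :
      Eval O F p x y s → Eval O F q x z t →
        Eval O F (Prog.cons p q) x (Data.cons y z) (s + t + 1)
  | comp (F p q : Prog) (x y z : Data) (s t : ℕ) :
      Eval O F q x y s → Eval O F p y z t → Eval O F (Prog.comp p q) x z (s + t + 1)
  | cond_true (F c p q : Prog) (x a b y : Data) (s t : ℕ) :
      Eval O F c x (Data.cons a b) s → Eval O F p x y t →
        Eval O F (Prog.cond c p q) x y (s + t + 1)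
  | cond_false (F c p q : Prog) (x y : Data) (s t : ℕ) :
      Eval O F c x Data.nil s → Eval O F q x y t →
        Eval O F (Prog.cond c p q) x y (s + t + 1)
  | self (F : Prog) (x y : Data) (t : ℕ) :
      Eval O F F x y t → Eval O F Prog.self x y (t + 1)
  | fn (F p : Prog) (x y : Data) (t : ℕ) :
      Eval O p p x y t → Eval O F (Prog.fn p) x y (t + 1)
  | oracle (F : Prog) (x : Data) : Eval O F Prog.oracle x (O.answer x) (O.cost x + 1)

/-- The program `p` with oracle `O` on input `x` halts with output `y` after `t` steps
(at top level, `self` refers to the whole program). -/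
def Runs (O : Oracle) (p : Prog) (x y : Data) (t : ℕ) : Prop := Eval O p p x y t

/-! ### Encodings -/

/-- Unary numerals. -/
def Data.ofNat : ℕ → Data
  | 0 => Data.nil
  | n + 1 => Data.cons Data.nil (Data.ofNat n)

def Data.ofList : List Data → Data
  | [] => Data.nil
  | a :: l => Data.cons a (Data.ofList l)

open Classical in
/-- A truth value: `nil` for false, `cons nil nil` for true. -/
noncomputable def Data.ofProp (P : Prop) : Data :=
  if P then Data.cons Data.nil Data.nil else Data.nil

/-- A graph on `{0, …, n - 1}` is given by its adjacency matrix, as the list of its rows. -/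
noncomputable def encodeGraph {n : ℕ} (G : SimpleGraph (Fin n)) : Data :=
  Data.ofList (List.ofFn fun i : Fin n =>
    Data.ofList (List.ofFn fun j : Fin n => Data.ofProp (G.Adj i j)))

/-- The instance `(G, k)`. -/
noncomputable def encodeInstance {n : ℕ} (G : SimpleGraph (Fin n)) (k : ℕ) : Data :=
  Data.cons (encodeGraph G) (Data.ofNat k)

/-! ### Tripartitions and their properties -/

/-- An ordered partition of the vertex set into three (possibly empty) parts. -/
structure Tripartition (V : Type) [Fintype V] [DecidableEq V] where
  A : Finset V
  B : Finset V
  R : Finset V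
  disjoint_AB : Disjoint A B
  disjoint_AR : Disjoint A R
  disjoint_BR : Disjoint B R
  cover : A ∪ B ∪ R = Finset.univ

namespace Tripartition

/-- A tripartition is written as the list of the labels of the vertices: `0` for vertices of `A`,
`1` for vertices of `B`, `2` for vertices of `R`. -/
def encode {n : ℕ} (T : Tripartition (Fin n)) : Data :=
  Data.ofList (List.ofFn fun v : Fin n =>
    Data.ofNat (if v ∈ T.A then 0 else if v ∈ T.B then 1 else 2))

variable {V : Type} [Fintype V] [DecidableEq V]

def Nontrivial (T : Tripartition V) : Prop :=
  T.A.Nonempty ∧ T.B.Nonempty ∧ T.R.card < min T.A.card T.B.card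

open Classical in
/-- Witness of `(g, d)`-almost bicompleteness, for the values `g = g(k)`, `d = d(k)`. -/
def AlmostBicomplete (G : SimpleGraph V) (T : Tripartition V) (g d : ℕ) : Prop :=
  T.Nontrivial ∧ T.R.card ≤ g ∧
    (∀ v ∈ T.A, (T.B.filter fun w => ¬ G.Adj v w).card ≤ d) ∧
    (∀ v ∈ T.B, (T.A.filter fun w => ¬ G.Adj v w).card ≤ d)

open Classical in
/-- Witness of `(g, d)`-almost disconnectedness, for the values `g = g(k)`, `d = d(k)`. -/
def AlmostDisconnected (G : SimpleGraph V) (T : Tripartition V) (g d : ℕ) : Prop :=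
  T.Nontrivial ∧ T.R.card ≤ g ∧
    (∀ v ∈ T.A, (T.B.filter fun w => G.Adj v w).card ≤ d) ∧
    (∀ v ∈ T.B, (T.A.filter fun w => G.Adj v w).card ≤ d)

open Classical in
/-- Witness of one-sided `(g, d)`-almost disconnectedness, for the parameter `k` and the values
`g = g(k)`, `d = d(k)`. -/
def OneSidedAlmostDisconnected (G : SimpleGraph V) (T : Tripartition V) (k g d : ℕ) : Prop :=
  T.Nontrivial ∧ T.R.card ≤ g ∧ k * d < T.B.card ∧
    (∀ v ∈ T.A, (T.B.filter fun w => G.Adj v w).card ≤ d)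

/-- Witness of `(g, d)`-weak connectedness, for the parameter `k` and the values `g = g(k)`,
`d = d(k)`. The last clause says that the bipartite graph between `A` and `B` is `K_{d,d}`-free;
it excludes `d = 0`, so that the exponent `2 * d - 1` is not truncated. -/
def WeaklyConnected (G : SimpleGraph V) (T : Tripartition V) (k g d : ℕ) : Prop :=
  T.Nontrivial ∧ T.R.card ≤ g ∧
    d ^ d * k ^ (2 * d - 1) + 1 < T.A.card ∧ d ^ d * k ^ (2 * d - 1) + 1 < T.B.card ∧
    ¬ ∃ X Y : Finset V, X ⊆ T.A ∧ Y ⊆ T.B ∧ X.card = d ∧ Y.card = d ∧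
      ∀ x ∈ X, ∀ y ∈ Y, G.Adj x y

end Tripartition

/-- The three notions of a sparse separation. -/
inductive Sparsity : Type
  | almostDisconnected : Sparsity
  | oneSidedAlmostDisconnected : Sparsity
  | weaklyConnected : Sparsity

/-- `T` is a witness of sparse separation of `G`, in the sense of the given notion. -/
def IsSparseWitness {n : ℕ} (S : Sparsity) (G : SimpleGraph (Fin n)) (T : Tripartition (Fin n))
    (k g d : ℕ) : Prop :=
  match S with
  | Sparsity.almostDisconnected => T.AlmostDisconnected G g d
  | Sparsity.oneSidedAlmostDisconnected => T.OneSidedAlmostDisconnected G k g d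
  | Sparsity.weaklyConnected => T.WeaklyConnected G k g d

/-! ### Classes of graphs -/

/-- A class of finite graphs, given by its members on the vertex sets `{0, …, n - 1}`. -/
abbrev GraphClass : Type := (n : ℕ) → Set (SimpleGraph (Fin n))

/-- Closed under induced subgraphs (in particular, under isomorphism). -/
def GraphClass.Hereditary (C : GraphClass) : Prop :=
  ∀ (m n : ℕ) (H : SimpleGraph (Fin m)) (G : SimpleGraph (Fin n)),
    G ∈ C n → H.IsIndContained G → H ∈ C m

/-- The noise functions of a class: `g₁`, `d₁` for almost bicomplete tripartitions, and
`g₂`, `d₂` for the sparse ones. -/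
structure Noise where
  g₁ : ℕ → ℕ
  d₁ : ℕ → ℕ
  g₂ : ℕ → ℕ
  d₂ : ℕ → ℕ
  computable_g₁ : Computable g₁
  computable_d₁ : Computable d₁
  computable_g₂ : Computable g₂
  computable_d₂ : Computable d₂

/-- `T` is one of the tripartitions of `G` that the noise allows at the parameter `k`. -/
def IsWitness {n : ℕ} (S : Sparsity) (N : Noise) (G : SimpleGraph (Fin n)) (k : ℕ)
    (T : Tripartition (Fin n)) : Prop :=
  T.AlmostBicomplete G (N.g₁ k) (N.d₁ k) ∨ IsSparseWitness S G T k (N.g₂ k) (N.d₂ k)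

/-- Co-graphs with parameterized noise: a hereditary class in which every graph is almost
bicomplete or separated in the sense of `S`. Graphs with fewer than two vertices have no
non-trivial tripartition at all, and nothing is required of them. -/
def IsNoisyCographClass (S : Sparsity) (N : Noise) (C : GraphClass) : Prop :=
  C.Hereditary ∧ ∀ (n : ℕ) (G : SimpleGraph (Fin n)) (k : ℕ),
    2 ≤ n → G ∈ C n → G.indepNum ≤ k → ∃ T : Tripartition (Fin n), IsWitness S N G k T

/-! ### Fixed-parameter tractability -/

/-- With oracle `O`, the tripartitions of the graphs in `C` can be found in FPT time: some program
returns, for all `G ∈ C` with at least two vertices and all `k ≥ α(G)`, an allowed tripartition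
of `G` within `h(k) |V(G)|^γ` steps. Nothing is required on other inputs. -/
def FindsTripartitionsFPT (O : Oracle) (S : Sparsity) (N : Noise) (C : GraphClass) : Prop :=
  ∃ (q : Prog) (h : ℕ → ℕ) (γ : ℕ), Computable h ∧
    ∀ (n : ℕ) (G : SimpleGraph (Fin n)) (k : ℕ), 2 ≤ n → G ∈ C n → G.indepNum ≤ k →
      ∃ T : Tripartition (Fin n), IsWitness S N G k T ∧
        ∃ t : ℕ, t ≤ h k * n ^ γ ∧ Runs O q (encodeInstance G k) T.encode t

/-- With oracle `O`, Maximum Independent Set is FPT on `C`: some program decides, for all `G ∈ C`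
and all `k`, whether `G` has an independent set of size `k`, within `f(k) (|V(G)| + 1)^c` steps. -/
def MISIsFPT (O : Oracle) (C : GraphClass) : Prop :=
  ∃ (p : Prog) (f : ℕ → ℕ) (c : ℕ), Computable f ∧
    ∀ (n : ℕ) (G : SimpleGraph (Fin n)) (k : ℕ), G ∈ C n →
      ∃ t : ℕ, t ≤ f k * (n + 1) ^ c ∧
        Runs O p (encodeInstance G k)
          (Data.ofProp (∃ I : Finset (Fin n), G.IsNIndepSet k I)) t

end NoisyCographs

/-!
The algorithm solves the problem recursively on vertex sets `X` with `α(X) ≤ k`, along a witness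
`(A, B, R)` for the graph induced on `X`.

If `(A, B, R)` is almost bicomplete, an independent set that contains `v ∈ A` and `w ∈ B` lies in
the union of `R` with the non-neighbours of `v` in `B` and those of `w` in `A`. These are at most
`2 d + g` vertices, so such sets are found exhaustively. All others lie in `A ∪ R` or `B ∪ R`, and
recursion into both sides costs only quadratically many calls because `R` is smaller than `A` and
`B`.

If it is sparse, then for `i + j = t` one asks recursively for an independent `i`-set in `A` and
an independent `j`-set in `B` that avoid all sets found before. If two of the sets found have no
edge between them, their union is a solution. Otherwise any two are joined by an edge, and
sparsity bounds the number of pairs. When one side has nothing new to offer, every solution meets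
the bounded pool of vertices found so far and of `R`, and the algorithm branches on the vertex in
which it does so. The nesting depth of sparse pairs is bounded: from a long chain of nested sparse
pairs one picks an independent set of size `k + 1`.

A witness may only be requested where `α(X) ≤ k`. Adding the vertices one at a time, and stopping
at the first solution, never leaves this range.
-/

namespace NoisyCographs

/-! ### Evaluation with a bounded number of steps -/

/-- Evaluation within at most `b` steps. Bounds compose without exact bookkeeping of steps. -/
def EvalWithin (O : Oracle) (F p : Prog) (x y : Data) (b : ℕ) : Prop :=
  ∃ t ≤ b, Eval O F p x y t

namespace EvalWithin

variable {O : Oracle} {F p q c : Prog} {x y z a b : Data} {s t : ℕ}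

theorem mono (h : EvalWithin O F p x y s) (hst : s ≤ t) : EvalWithin O F p x y t :=
  let ⟨r, hr, h⟩ := h
  ⟨r, hr.trans hst, h⟩

theorem id : EvalWithin O F Prog.id x x 1 := ⟨1, le_rfl, Eval.id F x⟩

theorem nil : EvalWithin O F Prog.nil x Data.nil 1 := ⟨1, le_rfl, Eval.nil F x⟩

theorem hd : EvalWithin O F Prog.hd (Data.cons a b) a 1 := ⟨1, le_rfl, Eval.hd_cons F a b⟩

theorem tl : EvalWithin O F Prog.tl (Data.cons a b) b 1 := ⟨1, le_rfl, Eval.tl_cons F a b⟩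

theorem tl_nil : EvalWithin O F Prog.tl Data.nil Data.nil 1 := ⟨1, le_rfl, Eval.tl_nil F⟩

theorem cons (hp : EvalWithin O F p x y s) (hq : EvalWithin O F q x z t) :
    EvalWithin O F (Prog.cons p q) x (Data.cons y z) (s + t + 1) :=
  let ⟨s', hs, hp⟩ := hp
  let ⟨t', ht, hq⟩ := hq
  ⟨s' + t' + 1, by omega, Eval.cons F p q x y z s' t' hp hq⟩

theorem comp (hq : EvalWithin O F q x y s) (hp : EvalWithin O F p y z t) :
    EvalWithin O F (Prog.comp p q) x z (s + t + 1) :=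
  let ⟨s', hs, hq⟩ := hq
  let ⟨t', ht, hp⟩ := hp
  ⟨s' + t' + 1, by omega, Eval.comp F p q x y z s' t' hq hp⟩

theorem cond_true (hc : EvalWithin O F c x (Data.cons a b) s) (hp : EvalWithin O F p x y t) :
    EvalWithin O F (Prog.cond c p q) x y (s + t + 1) :=
  let ⟨s', hs, hc⟩ := hc
  let ⟨t', ht, hp⟩ := hp
  ⟨s' + t' + 1, by omega, Eval.cond_true F c p q x a b y s' t' hc hp⟩

theorem cond_false (hc : EvalWithin O F c x Data.nil s) (hq : EvalWithin O F q x y t) :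
    EvalWithin O F (Prog.cond c p q) x y (s + t + 1) :=
  let ⟨s', hs, hc⟩ := hc
  let ⟨t', ht, hq⟩ := hq
  ⟨s' + t' + 1, by omega, Eval.cond_false F c p q x y s' t' hc hq⟩

theorem self (h : EvalWithin O F F x y t) : EvalWithin O F Prog.self x y (t + 1) :=
  let ⟨t', ht, h⟩ := h
  ⟨t' + 1, by omega, Eval.self F x y t' h⟩

theorem fn (h : EvalWithin O p p x y t) : EvalWithin O F (Prog.fn p) x y (t + 1) :=
  let ⟨t', ht, h⟩ := h
  ⟨t' + 1, by omega, Eval.fn F p x y t' h⟩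

end EvalWithin

theorem exists_prog_eval_const (d : Data) :
    ∃ (p : Prog) (t : ℕ), ∀ O F x, EvalWithin O F p x d t := by
  induction d with
  | nil => exact ⟨Prog.nil, 1, fun O F x => EvalWithin.nil⟩
  | cons a b iha ihb =>
    obtain ⟨p, s, hp⟩ := iha
    obtain ⟨q, t, hq⟩ := ihb
    exact ⟨Prog.cons p q, s + t + 1, fun O F x => (hp O F x).cons (hq O F x)⟩

/-! ### Types represented by trees -/

/-- The number of pairs in a tree. -/
def Data.size : Data → ℕ
  | Data.nil => 0
  | Data.cons a b => a.size + b.size + 1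

/-- Types whose values are represented by trees. Injectivity of the representation is not
required: programs are specified by the functions that they compute. -/
class TreeEncoding (α : Type) where
  toData : α → Data

open TreeEncoding

/-- The size of the tree that represents a value. -/
def codeSize {α : Type} [TreeEncoding α] (x : α) : ℕ := (toData x).size

instance : TreeEncoding Bool := ⟨fun b => if b then Data.cons Data.nil Data.nil else Data.nil⟩

instance : TreeEncoding ℕ := ⟨Data.ofNat⟩

instance : TreeEncoding Unit := ⟨fun _ => Data.nil⟩

section TreeEncoding

variable {α β : Type} [TreeEncoding α] [TreeEncoding β]

instance : TreeEncoding (α × β) := ⟨fun x => Data.cons (toData x.1) (toData x.2)⟩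

instance : TreeEncoding (α ⊕ β) :=
  ⟨Sum.elim (fun a => Data.cons (toData false) (toData a))
    fun b => Data.cons (toData true) (toData b)⟩

instance : TreeEncoding (List α) := ⟨fun l => Data.ofList (l.map toData)⟩

instance : TreeEncoding (Option α) :=
  ⟨fun o => o.elim Data.nil fun a => Data.cons Data.nil (toData a)⟩

theorem toData_true : toData true = Data.cons Data.nil Data.nil := rfl

theorem toData_false : toData false = Data.nil := rfl

theorem toData_cons (a : α) (l : List α) : toData (a :: l) = Data.cons (toData a) (toData l) := rfl

theorem toData_replicate_unit (n : ℕ) : toData (List.replicate n ()) = toData n := by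
  induction n with
  | zero => rfl
  | succ n ih => rw [List.replicate_succ, toData_cons, ih]; rfl

theorem codeSize_bool_le (b : Bool) : codeSize b ≤ 1 := by cases b <;> decide

theorem codeSize_nat (n : ℕ) : codeSize n = n := by
  induction n with
  | zero => rfl
  | succ n ih =>
    have : codeSize (n + 1) = 0 + codeSize n + 1 := rfl
    omega

theorem codeSize_pair (a : α) (b : β) : codeSize (a, b) = codeSize a + codeSize b + 1 := rfl

theorem codeSize_some (a : α) : codeSize (some a) = 0 + codeSize a + 1 := rfl

theorem codeSize_nil : codeSize ([] : List α) = 0 := rfl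

theorem codeSize_cons (a : α) (l : List α) :
    codeSize (a :: l) = codeSize a + codeSize l + 1 := rfl

theorem codeSize_lt_of_mem {a : α} {l : List α} (h : a ∈ l) : codeSize a < codeSize l := by
  induction l with
  | nil => simp at h
  | cons b l ih =>
    rw [codeSize_cons]
    rcases List.mem_cons.1 h with rfl | h
    · omega
    · have := ih h; omega

theorem length_le_codeSize (l : List α) : l.length ≤ codeSize l := by
  induction l with
  | nil => exact Nat.zero_le _
  | cons b l ih => rw [codeSize_cons, List.length_cons]; omega

theorem codeSize_list_le {l : List α} {m : ℕ} (h : ∀ a ∈ l, codeSize a ≤ m) :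
    codeSize l ≤ l.length * (m + 1) := by
  induction l with
  | nil => simp [codeSize_nil]
  | cons b l ih =>
    have hl := ih fun a ha => h a (List.mem_cons_of_mem b ha)
    have hb := h b List.mem_cons_self
    rw [codeSize_cons, List.length_cons]
    linarith

theorem codeSize_append (l m : List α) : codeSize (l ++ m) = codeSize l + codeSize m := by
  induction l with
  | nil => simp [codeSize_nil]
  | cons b l ih => rw [List.cons_append, codeSize_cons, codeSize_cons, ih]; omega

theorem codeSize_le_of_sublist {l m : List α} (h : l.Sublist m) : codeSize l ≤ codeSize m := by
  induction h with
  | slnil => rfl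
  | cons a _ ih => rw [codeSize_cons]; omega
  | cons_cons a _ ih => rw [codeSize_cons, codeSize_cons]; omega

end TreeEncoding

/-! ### Polynomially bounded quantities -/

/-- Bounded by a polynomial in the size of the argument. The polynomial is a power of `size + 2`,
which makes the notion closed under sums and products. -/
def PolyBounded {α : Type} [TreeEncoding α] (T : α → ℕ) : Prop :=
  ∃ c, ∀ x, T x ≤ (codeSize x + 2) ^ c

namespace PolyBounded

variable {α β : Type} [TreeEncoding α] [TreeEncoding β] {T U : α → ℕ}

theorem mono (hU : PolyBounded U) (h : ∀ x, T x ≤ U x) : PolyBounded T :=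
  let ⟨c, hc⟩ := hU
  ⟨c, fun x => (h x).trans (hc x)⟩

theorem codeSize : PolyBounded fun x : α => codeSize x := ⟨1, fun x => by simp⟩

theorem const (n : ℕ) : PolyBounded fun _ : α => n :=
  ⟨n, fun _ => Nat.lt_two_pow_self.le.trans (Nat.pow_le_pow_left (Nat.le_add_left _ _) _)⟩

theorem mul (hT : PolyBounded T) (hU : PolyBounded U) : PolyBounded fun x => T x * U x := by
  obtain ⟨c, hc⟩ := hT
  obtain ⟨d, hd⟩ := hU
  exact ⟨c + d, fun x => by rw [pow_add]; exact Nat.mul_le_mul (hc x) (hd x)⟩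

theorem add (hT : PolyBounded T) (hU : PolyBounded U) : PolyBounded fun x => T x + U x := by
  obtain ⟨c, hc⟩ := hT
  obtain ⟨d, hd⟩ := hU
  refine ⟨max c d + 1, fun x => ?_⟩
  set s := NoisyCographs.codeSize x + 2
  have hTx : T x ≤ s ^ max c d :=
    (hc x).trans (Nat.pow_le_pow_right (by omega) (le_max_left c d))
  have hUx : U x ≤ s ^ max c d :=
    (hd x).trans (Nat.pow_le_pow_right (by omega) (le_max_right c d))
  calc T x + U x ≤ s ^ max c d * 2 := by omega
    _ ≤ s ^ (max c d + 1) := by rw [pow_succ]; exact Nat.mul_le_mul_left _ (by omega)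

theorem pow (hT : PolyBounded T) (n : ℕ) : PolyBounded fun x => T x ^ n := by
  induction n with
  | zero => simpa using const 1
  | succ n ih => simpa [pow_succ] using ih.mul hT

theorem comp {T : β → ℕ} {f : α → β} (hT : PolyBounded T)
    (hf : PolyBounded fun x => NoisyCographs.codeSize (f x)) : PolyBounded fun x => T (f x) := by
  obtain ⟨c, hc⟩ := hT
  exact ((hf.add (const 2)).pow c).mono fun x => hc _

end PolyBounded

/-! ### Functions computed in polynomial time -/

section PolyTime

variable {α β γ δ σ : Type} [TreeEncoding α] [TreeEncoding β] [TreeEncoding γ] [TreeEncoding δ]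
  [TreeEncoding σ]

/-- `p` computes `f` within time `T`, whatever the oracle and the enclosing function are. -/
def Computes (p : Prog) (f : α → β) (T : α → ℕ) : Prop :=
  ∀ O F x, EvalWithin O F p (toData x) (toData (f x)) (T x)

/-- `f` is computed by a program in polynomial time and has values of polynomial size. The second
condition does not follow from the first, because a program can build a tree whose size is
exponential in the number of steps by sharing subtrees. -/
@[fun_prop]
def PolyTime (f : α → β) : Prop :=
  (∃ p T, PolyBounded T ∧ Computes p f T) ∧ PolyBounded fun x => codeSize (f x)

namespace PolyTime

theorem congr_toData {f : α → β} {f' : γ → δ} (hf : PolyTime f') (i : α → γ)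
    (hi : ∀ x, toData (i x) = toData x) (hff' : ∀ x, toData (f' (i x)) = toData (f x)) :
    PolyTime f := by
  obtain ⟨⟨p, T, ⟨c, hc⟩, hp⟩, ⟨d, hd⟩⟩ := hf
  have size_i : ∀ x, codeSize (i x) = codeSize x := fun x => congrArg Data.size (hi x)
  have size_f : ∀ x, codeSize (f' (i x)) = codeSize (f x) := fun x => congrArg Data.size (hff' x)
  exact ⟨⟨p, fun x => T (i x), ⟨c, fun x => size_i x ▸ hc (i x)⟩,
    fun O F x => hi x ▸ hff' x ▸ hp O F (i x)⟩,
    d, fun x => by simpa only [size_i, size_f] using hd (i x)⟩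

@[fun_prop]
theorem id : PolyTime fun x : α => x :=
  ⟨⟨Prog.id, fun _ => 1, PolyBounded.const 1, fun _ _ _ => EvalWithin.id⟩, PolyBounded.codeSize⟩

@[fun_prop]
theorem comp {f : β → γ} {g : α → β} (hf : PolyTime f) (hg : PolyTime g) :
    PolyTime fun x => f (g x) := by
  obtain ⟨⟨p, T, hT, hp⟩, hfs⟩ := hf
  obtain ⟨⟨q, U, hU, hq⟩, hgs⟩ := hg
  exact ⟨⟨Prog.comp p q, fun x => U x + T (g x) + 1,
    (hU.add (hT.comp hgs)).add (PolyBounded.const 1),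
    fun O F x => (hq O F x).comp (hp O F (g x))⟩, hfs.comp hgs⟩

@[fun_prop]
theorem pair {f : α → β} {g : α → γ} (hf : PolyTime f) (hg : PolyTime g) :
    PolyTime fun x => (f x, g x) := by
  obtain ⟨⟨p, T, hT, hp⟩, hfs⟩ := hf
  obtain ⟨⟨q, U, hU, hq⟩, hgs⟩ := hg
  exact ⟨⟨Prog.cons p q, fun x => T x + U x + 1, (hT.add hU).add (PolyBounded.const 1),
    fun O F x => (hp O F x).cons (hq O F x)⟩, (hfs.add hgs).add (PolyBounded.const 1)⟩

@[fun_prop]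
theorem fst : PolyTime fun x : α × β => x.1 :=
  ⟨⟨Prog.hd, fun _ => 1, PolyBounded.const 1, fun _ _ _ => EvalWithin.hd⟩,
    PolyBounded.codeSize.mono fun (a, b) => by rw [codeSize_pair]; dsimp only; omega⟩

@[fun_prop]
theorem snd : PolyTime fun x : α × β => x.2 :=
  ⟨⟨Prog.tl, fun _ => 1, PolyBounded.const 1, fun _ _ _ => EvalWithin.tl⟩,
    PolyBounded.codeSize.mono fun (a, b) => by rw [codeSize_pair]; dsimp only; omega⟩

@[fun_prop]
theorem const (b : β) : PolyTime fun _ : α => b := by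
  obtain ⟨p, t, hp⟩ := exists_prog_eval_const (toData b)
  exact ⟨⟨p, fun _ => t, PolyBounded.const t, fun O F _ => hp O F _⟩, PolyBounded.const _⟩

theorem inl {f : α → β} (hf : PolyTime f) : PolyTime fun x => (Sum.inl (f x) : β ⊕ γ) :=
  ((const false).pair hf).congr_toData (fun x => x) (fun _ => rfl) fun _ => rfl

theorem inr {f : α → γ} (hf : PolyTime f) : PolyTime fun x => (Sum.inr (f x) : β ⊕ γ) :=
  ((const true).pair hf).congr_toData (fun x => x) (fun _ => rfl) fun _ => rfl

theorem ite_eq_nil {l : α → List β} {f g : α → γ} (hl : PolyTime l) (hf : PolyTime f)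
    (hg : PolyTime g) : PolyTime fun x => if l x = [] then f x else g x := by
  obtain ⟨⟨r, R, hR, hr⟩, -⟩ := hl
  obtain ⟨⟨p, T, hT, hp⟩, hfs⟩ := hf
  obtain ⟨⟨q, U, hU, hq⟩, hgs⟩ := hg
  refine ⟨⟨Prog.cond r q p, fun x => R x + (T x + U x) + 1,
    (hR.add (hT.add hU)).add (PolyBounded.const 1), fun O F x => ?_⟩,
    (hfs.add hgs).mono fun x => by dsimp only; split_ifs <;> omega⟩
  have h := hr O F x
  cases hlx : l x with
  | nil =>
    rw [hlx] at h
    exact (EvalWithin.cond_false h (by simpa [hlx] using hp O F x)).mono (by dsimp only; omega)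
  | cons b l' =>
    rw [hlx] at h
    exact (EvalWithin.cond_true h (by simpa [hlx] using hq O F x)).mono (by dsimp only; omega)

@[fun_prop]
theorem ite {c : α → Bool} {f g : α → γ} (hc : PolyTime c) (hf : PolyTime f) (hg : PolyTime g) :
    PolyTime fun x => if c x = true then f x else g x := by
  have hc' : PolyTime fun x => (if c x then [()] else [] : List Unit) :=
    hc.congr_toData (fun x => x) (fun _ => rfl) fun x => by cases c x <;> rfl
  convert hc'.ite_eq_nil hg hf using 2 with x
  cases c x <;> simp

@[fun_prop]
theorem list_cons {f : α → β} {g : α → List β} (hf : PolyTime f) (hg : PolyTime g) :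
    PolyTime fun x => f x :: g x :=
  (hf.pair hg).congr_toData (fun x => x) (fun _ => rfl) fun _ => rfl

@[fun_prop]
theorem some {f : α → β} (hf : PolyTime f) : PolyTime fun x => Option.some (f x) :=
  ((const ()).pair hf).congr_toData (fun x => x) (fun _ => rfl) fun _ => rfl

@[fun_prop]
theorem tail {f : α → List β} (hf : PolyTime f) : PolyTime fun x => (f x).tail := by
  have htail : PolyTime fun l : List β => l.tail := by
    refine ⟨⟨Prog.tl, fun _ => 1, PolyBounded.const 1, fun O F l => ?_⟩,
      PolyBounded.codeSize.mono fun l => codeSize_le_of_sublist l.tail_sublist⟩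
    cases l with
    | nil => exact EvalWithin.tl_nil
    | cons b l => exact EvalWithin.tl
  exact htail.comp hf

@[fun_prop]
theorem head? {l : α → List β} (hl : PolyTime l) : PolyTime fun a => (l a).head? := by
  have hhead : PolyTime fun l : List β => l.head? := by
    refine ⟨⟨Prog.cond Prog.id (Prog.cons Prog.nil Prog.hd) Prog.nil, fun _ => 5,
      PolyBounded.const 5, fun O F l => ?_⟩, PolyBounded.codeSize.mono fun l => ?_⟩
    · cases l with
      | nil => exact (EvalWithin.cond_false EvalWithin.id EvalWithin.nil).mono (by norm_num)
      | cons b l => exact EvalWithin.cond_true EvalWithin.id (EvalWithin.nil.cons EvalWithin.hd)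
    · cases l with
      | nil => exact Nat.zero_le _
      | cons b l => simp only [List.head?_cons, codeSize_cons, codeSize_some]; omega
  exact hhead.comp hl

@[fun_prop]
theorem option_toList {o : α → Option β} (ho : PolyTime o) : PolyTime fun x => (o x).toList := by
  have htoList : PolyTime fun o : Option β => o.toList := by
    refine ⟨⟨Prog.cond Prog.id (Prog.cons Prog.tl Prog.nil) Prog.nil, fun _ => 5,
      PolyBounded.const 5, fun O F o => ?_⟩, PolyBounded.codeSize.mono fun o => ?_⟩
    · cases o with
      | none => exact (EvalWithin.cond_false EvalWithin.id EvalWithin.nil).mono (by norm_num)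
      | some b => exact EvalWithin.cond_true EvalWithin.id (EvalWithin.tl.cons EvalWithin.nil)
    · cases o with
      | none => exact Nat.zero_le _
      | some b =>
        simp only [Option.toList_some, codeSize_cons, codeSize_some, codeSize_nil]; omega
  exact htoList.comp ho

@[fun_prop]
theorem isSome {o : α → Option β} (ho : PolyTime o) : PolyTime fun a => (o a).isSome := by
  have h : PolyTime fun a => if (o a).toList = [] then false else true :=
    ho.option_toList.ite_eq_nil (const _) (const _)
  convert h using 2 with a
  cases o a <;> rfl

@[fun_prop]
theorem option_getD {o : α → Option β} {g : α → β} (ho : PolyTime o) (hg : PolyTime g) :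
    PolyTime fun x => (o x).getD (g x) := by
  obtain ⟨⟨p, T, hT, hp⟩, hos⟩ := ho
  obtain ⟨⟨q, U, hU, hq⟩, hgs⟩ := hg
  refine ⟨⟨Prog.cond p (Prog.comp Prog.tl p) q, fun x => 2 * T x + U x + 3,
    (((PolyBounded.const 2).mul hT).add hU).add (PolyBounded.const 3), fun O F x => ?_⟩,
    (hos.add hgs).mono fun x => ?_⟩
  · have h := hp O F x
    cases hox : o x with
    | none =>
      rw [hox] at h
      exact (EvalWithin.cond_false h (by simpa [hox] using hq O F x)).mono (by dsimp only; omega)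
    | some b =>
      rw [hox] at h
      simp only [hox, Option.getD_some]
      exact (EvalWithin.cond_true h (h.comp EvalWithin.tl)).mono (by omega)
  · cases hox : o x with
    | none => simp [hox]
    | some b => rw [codeSize_some]; simp only [hox, Option.getD_some]; omega

@[fun_prop]
theorem headD {l : α → List β} {g : α → β} (hl : PolyTime l) (hg : PolyTime g) :
    PolyTime fun x => (l x).headD (g x) := by
  simpa only [List.headD_eq_head?_getD] using hl.head?.option_getD hg

/-! ### Recursion over lists -/

/-- The body of a function that maps `(a, l)` to `l.foldr (g a) (h a)`, where `pg` computes `g` and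
`ph` computes `h`. -/
def foldrBody (pg ph : Prog) : Prog :=
  Prog.cond Prog.tl
    (Prog.comp pg (Prog.cons Prog.hd (Prog.cons (Prog.comp Prog.hd Prog.tl)
      (Prog.comp Prog.self (Prog.cons Prog.hd (Prog.comp Prog.tl Prog.tl))))))
    (Prog.comp ph Prog.hd)

theorem evalWithin_foldrBody {pg ph : Prog} {g : α → β → σ → σ} {h : α → σ}
    {Tg : α × β × σ → ℕ} {Th : α → ℕ} (hpg : Computes pg (fun x => g x.1 x.2.1 x.2.2) Tg)
    (hph : Computes ph h Th) (O : Oracle) (a : α) (m : ℕ) (l : List β)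
    (hm : ∀ b l', (b :: l') <:+ l → Tg (a, b, l'.foldr (g a) (h a)) ≤ m) :
    EvalWithin O (foldrBody pg ph) (foldrBody pg ph) (toData (a, l)) (toData (l.foldr (g a) (h a)))
      (l.length * (m + 20) + Th a + 4) := by
  induction l with
  | nil =>
    exact (EvalWithin.cond_false EvalWithin.tl (EvalWithin.hd.comp (hph O _ a))).mono
      (by simp only [List.length_nil]; omega)
  | cons b l ih =>
    have hrec := ih fun b' l' h' => hm b' l' (h'.trans (List.suffix_cons b l))
    have hstep := (hpg O (foldrBody pg ph) (a, b, l.foldr (g a) (h a))).mono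
      (hm b l (List.suffix_refl _))
    refine (EvalWithin.cond_true EvalWithin.tl (EvalWithin.comp (EvalWithin.hd.cons
      ((EvalWithin.tl.comp EvalWithin.hd).cons
        ((EvalWithin.hd.cons (EvalWithin.tl.comp EvalWithin.tl)).comp hrec.self))) hstep)).mono ?_
    rw [List.length_cons, Nat.succ_mul]
    omega

theorem foldr {l : α → List β} {h : α → σ} {g : α → β → σ → σ} {B : α → ℕ}
    (hl : PolyTime l) (hh : PolyTime h) (hg : PolyTime fun x : α × β × σ => g x.1 x.2.1 x.2.2)
    (hB : PolyBounded B) (hlB : ∀ a l', l' <:+ l a → codeSize (l'.foldr (g a) (h a)) ≤ B a) :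
    PolyTime fun a => (l a).foldr (g a) (h a) := by
  obtain ⟨⟨pl, Tl, hTl, hpl⟩, hls⟩ := hl
  obtain ⟨⟨ph, Th, hTh, hph⟩, -⟩ := hh
  obtain ⟨⟨pg, Tg, ⟨c, hTg⟩, hpg⟩, -⟩ := hg
  set m : α → ℕ := fun a => (codeSize a + codeSize (l a) + B a + 4) ^ c
  have hm : ∀ a b l', (b :: l') <:+ l a → Tg (a, b, l'.foldr (g a) (h a)) ≤ m a := by
    intro a b l' hsuf
    have hacc := hlB a l' ((List.suffix_cons b l').trans hsuf)
    have hb := codeSize_lt_of_mem (hsuf.subset List.mem_cons_self)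
    refine (hTg _).trans (Nat.pow_le_pow_left ?_ c)
    rw [codeSize_pair, codeSize_pair]
    omega
  have hm_poly : PolyBounded m :=
    (((PolyBounded.codeSize.add hls).add hB).add (PolyBounded.const 4)).pow c
  refine ⟨⟨Prog.comp (Prog.fn (foldrBody pg ph)) (Prog.cons Prog.id pl),
    fun a => Tl a + (codeSize (l a) * (m a + 20) + Th a) + 10,
    (hTl.add ((hls.mul (hm_poly.add (PolyBounded.const 20))).add hTh)).add (PolyBounded.const 10),
    fun O F a => ?_⟩, hB.mono fun a => hlB a _ (List.suffix_refl _)⟩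
  refine ((EvalWithin.id.cons (hpl O F a)).comp
    (evalWithin_foldrBody hpg hph O a (m a) (l a) (hm a)).fn).mono ?_
  have := Nat.mul_le_mul_right (m a + 20) (length_le_codeSize (l a))
  dsimp only
  omega

/-! ### List functions in polynomial time -/

@[fun_prop]
theorem append {f g : α → List β} (hf : PolyTime f) (hg : PolyTime g) :
    PolyTime fun x => f x ++ g x := by
  have h : PolyTime fun a => (f a).foldr ((fun (_ : α) b s => b :: s) a) (g a) := by
    refine foldr hf hg (by fun_prop) (hf.2.add hg.2) fun a l' hl' => ?_
    rw [List.foldr_cons_eq_append, List.map_id', codeSize_append]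
    have := codeSize_le_of_sublist hl'.sublist
    omega
  simpa using h

@[fun_prop]
theorem map {l : α → List β} {f : α → β → γ} (hl : PolyTime l)
    (hf : PolyTime fun x : α × β => f x.1 x.2) : PolyTime fun a => (l a).map (f a) := by
  obtain ⟨c, hc⟩ := hf.2
  have h : PolyTime fun a => (l a).foldr (fun b s => f a b :: s) [] := by
    refine foldr (g := fun a b s => f a b :: s)
      (B := fun a => codeSize (l a) * ((codeSize a + codeSize (l a) + 3) ^ c + 1)) hl (const _)
      (list_cons (comp hf (pair fst (comp fst snd))) (comp snd snd))
      (hl.2.mul ((((PolyBounded.codeSize.add hl.2).add (PolyBounded.const 3)).pow c).add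
        (PolyBounded.const 1))) fun a l' hl' => ?_
    rw [← List.map_eq_foldr]
    refine (codeSize_list_le (m := (codeSize a + codeSize (l a) + 3) ^ c) fun y hy => ?_).trans
      (Nat.mul_le_mul_right _ ?_)
    · obtain ⟨b, hb, rfl⟩ := List.mem_map.1 hy
      have hbl := codeSize_lt_of_mem (hl'.subset hb)
      refine (hc (a, b)).trans (Nat.pow_le_pow_left ?_ _)
      rw [codeSize_pair]
      omega
    · rw [List.length_map]
      exact (length_le_codeSize l').trans (codeSize_le_of_sublist hl'.sublist)
  simpa only [← List.map_eq_foldr] using h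

@[fun_prop]
theorem filter {l : α → List β} {p : α → β → Bool} (hl : PolyTime l)
    (hp : PolyTime fun x : α × β => p x.1 x.2) : PolyTime fun a => (l a).filter (p a) := by
  have filter_eq : ∀ (a : α) (l' : List β), l'.filter (p a) =
      l'.foldr (fun b s => if p a b = true then b :: s else s) [] := fun a l' => by
    simp only [List.filter_eq_foldr, cond_eq_ite]
  have h : PolyTime fun a => (l a).foldr (fun b s => if p a b = true then b :: s else s) [] := by
    refine foldr (g := fun a b s => if p a b = true then b :: s else s)
      hl (const _) ?_ hl.2 fun a l' hl' => ?_
    · exact ite (comp hp (pair fst (comp fst snd))) (by fun_prop) (by fun_prop)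
    · rw [← filter_eq]
      exact codeSize_le_of_sublist (List.filter_sublist.trans hl'.sublist)
  simpa only [← filter_eq] using h

@[fun_prop]
theorem flatten {l : α → List (List β)} (hl : PolyTime l) : PolyTime fun a => (l a).flatten := by
  have flatten_eq : ∀ L : List (List β), L.flatten = L.foldr (fun b s => b ++ s) [] := by
    intro L
    induction L with
    | nil => rfl
    | cons b L ih => rw [List.flatten_cons, List.foldr_cons, ih]
  have codeSize_flatten_le : ∀ L : List (List β), codeSize L.flatten ≤ codeSize L := by
    intro L
    induction L with
    | nil => exact le_rfl
    | cons b L ih => rw [List.flatten_cons, codeSize_append, codeSize_cons]; omega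
  have h : PolyTime fun a => (l a).foldr (fun b s => b ++ s) [] := by
    refine foldr (g := fun _ b s => b ++ s) hl (const _) (by fun_prop) hl.2 fun a l' hl' => ?_
    rw [← flatten_eq]
    exact (codeSize_flatten_le l').trans (codeSize_le_of_sublist hl'.sublist)
  simpa only [← flatten_eq] using h

@[fun_prop]
theorem flatMap {l : α → List β} {f : α → β → List γ} (hl : PolyTime l)
    (hf : PolyTime fun x : α × β => f x.1 x.2) : PolyTime fun a => (l a).flatMap (f a) := by
  simpa only [List.flatMap_def] using (hl.map hf).flatten

@[fun_prop]
theorem length {l : α → List β} (hl : PolyTime l) : PolyTime fun a => (l a).length :=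
  (hl.map (const ())).congr_toData (fun a => a) (fun _ => rfl) fun _ => by
    rw [List.map_const', toData_replicate_unit]

theorem replicate_unit {f : α → ℕ} (hf : PolyTime f) :
    PolyTime fun a => List.replicate (f a) () :=
  hf.congr_toData (fun a => a) (fun _ => rfl) fun _ => (toData_replicate_unit _).symm

@[fun_prop]
theorem drop {l : α → List β} {f : α → ℕ} (hl : PolyTime l) (hf : PolyTime f) :
    PolyTime fun a => (l a).drop (f a) := by
  have h : PolyTime fun a => (List.replicate (f a) ()).foldr (fun _ s => s.tail) (l a) := by
    refine foldr (g := fun _ _ s => s.tail) hf.replicate_unit hl (by fun_prop) hl.2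
      fun a l' _ => ?_
    rw [List.foldr_const, List.tail_iterate]
    exact codeSize_le_of_sublist (List.drop_sublist _ _)
  simpa only [List.foldr_const, List.tail_iterate, List.length_replicate] using h

@[fun_prop]
theorem getD {l : α → List β} {f : α → ℕ} {g : α → β} (hl : PolyTime l) (hf : PolyTime f)
    (hg : PolyTime g) : PolyTime fun a => (l a).getD (f a) (g a) := by
  simpa only [List.headD_eq_head?_getD, List.head?_drop, ← List.getD_eq_getElem?_getD]
    using (hl.drop hf).headD hg

/-! ### Arithmetic and decisions in polynomial time -/

@[fun_prop]
theorem succ {f : α → ℕ} (hf : PolyTime f) : PolyTime fun x => f x + 1 :=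
  ((const ()).pair hf).congr_toData (fun x => x) (fun _ => rfl) fun _ => rfl

@[fun_prop]
theorem add {f g : α → ℕ} (hf : PolyTime f) (hg : PolyTime g) : PolyTime fun a => f a + g a := by
  simpa only [List.length_append, List.length_replicate] using
    (hf.replicate_unit.append hg.replicate_unit).length

@[fun_prop]
theorem sub {f g : α → ℕ} (hf : PolyTime f) (hg : PolyTime g) : PolyTime fun a => f a - g a := by
  simpa only [List.length_drop, List.length_replicate] using
    (hf.replicate_unit.drop hg).length

@[fun_prop]
theorem range {f : α → ℕ} (hf : PolyTime f) : PolyTime fun a => List.range (f a) := by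
  have range_eq : ∀ n, (List.replicate n ()).foldr (fun _ s => s ++ [s.length]) [] =
      List.range n := by
    intro n
    induction n with
    | zero => rfl
    | succ n ih =>
      rw [List.replicate_succ, List.foldr_cons, ih, List.length_range, List.range_succ]
  have h : PolyTime fun a => (List.replicate (f a) ()).foldr (fun _ s => s ++ [s.length]) [] := by
    refine foldr (g := fun _ _ s => s ++ [s.length]) (B := fun a => f a * (f a + 1))
      hf.replicate_unit (const _) (by fun_prop) ?_ fun a l' hl' => ?_
    · simpa only [codeSize_nat] using hf.2.mul (hf.2.add (PolyBounded.const 1))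
    · have hlen : l'.length ≤ f a := by simpa using hl'.length_le
      have hrep : l' = List.replicate l'.length () := List.eq_replicate_of_mem fun _ _ => rfl
      rw [hrep, range_eq]
      refine (codeSize_list_le (m := f a) fun i hi => ?_).trans ?_
      · rw [codeSize_nat]; exact (List.mem_range.1 hi).le.trans hlen
      · rw [List.length_range]; exact Nat.mul_le_mul_right _ hlen
  simpa only [range_eq] using h

section Decide

variable {p q : α → Prop} [DecidablePred p] [DecidablePred q]

@[fun_prop]
theorem ite_prop {f g : α → β} (hp : PolyTime fun a => decide (p a)) (hf : PolyTime f)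
    (hg : PolyTime g) : PolyTime fun a => if p a then f a else g a := by
  simpa only [decide_eq_true_eq] using hp.ite hf hg

@[fun_prop]
theorem decide_eq_true {b : α → Bool} (hb : PolyTime b) :
    PolyTime fun a => decide (b a = true) := by
  simpa only [Bool.decide_eq_true] using hb

@[fun_prop]
theorem decide_not (hp : PolyTime fun a => decide (p a)) : PolyTime fun a => decide (¬ p a) := by
  have h := hp.ite (const false) (const true)
  convert h using 2 with a
  by_cases ha : p a <;> simp [ha]

@[fun_prop]
theorem decide_and (hp : PolyTime fun a => decide (p a)) (hq : PolyTime fun a => decide (q a)) :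
    PolyTime fun a => decide (p a ∧ q a) := by
  convert hp.ite hq (const false) using 2 with a
  by_cases ha : p a <;> simp [ha]

@[fun_prop]
theorem decide_or (hp : PolyTime fun a => decide (p a)) (hq : PolyTime fun a => decide (q a)) :
    PolyTime fun a => decide (p a ∨ q a) := by
  convert hp.ite (const true) hq using 2 with a
  by_cases ha : p a <;> simp [ha]

@[fun_prop]
theorem decide_lt {f g : α → ℕ} (hf : PolyTime f) (hg : PolyTime g) :
    PolyTime fun a => decide (f a < g a) := by
  have h : PolyTime fun a => if List.replicate (g a - f a) () = [] then false else true :=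
    (hg.sub hf).replicate_unit.ite_eq_nil (const _) (const _)
  convert h using 2 with a
  rcases lt_or_ge (f a) (g a) with hlt | hle
  · simp [Nat.sub_eq_zero_iff_le, hlt]
  · simp [hle]

@[fun_prop]
theorem decide_eq {f g : α → ℕ} (hf : PolyTime f) (hg : PolyTime g) :
    PolyTime fun a => decide (f a = g a) := by
  have h : PolyTime fun a => decide (¬ f a < g a ∧ ¬ g a < f a) := by fun_prop
  simpa only [← not_or, ← ne_iff_lt_or_gt, ne_eq, not_not] using h

@[fun_prop]
theorem decide_forall_mem {l : α → List β} {r : α → β → Prop} [∀ a b, Decidable (r a b)]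
    (hl : PolyTime l) (hr : PolyTime fun x : α × β => decide (r x.1 x.2)) :
    PolyTime fun a => decide (∀ b ∈ l a, r a b) := by
  have h : PolyTime fun a =>
      if ((l a).filter fun b => decide (¬ r a b)) = [] then true else false :=
    (hl.filter hr.decide_not).ite_eq_nil (const _) (const _)
  convert h using 2 with a
  by_cases hb : ∀ b ∈ l a, r a b
  · rw [if_pos (by simpa using hb), _root_.decide_eq_true hb]
  · rw [if_neg (by simpa using hb), _root_.decide_eq_false hb]

@[fun_prop]
theorem decide_mem {f : α → ℕ} {l : α → List ℕ} (hf : PolyTime f) (hl : PolyTime l) :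
    PolyTime fun a => decide (f a ∈ l a) := by
  have h : PolyTime fun a => decide (¬ ∀ b ∈ l a, ¬ b = f a) := by fun_prop
  convert h using 3 with a
  simp

end Decide

@[fun_prop]
theorem idxOf {f : α → ℕ} {l : α → List ℕ} (hf : PolyTime f) (hl : PolyTime l) :
    PolyTime fun a => (l a).idxOf (f a) := by
  have idxOf_eq : ∀ (x : ℕ) (l' : List ℕ), l'.foldr (fun y s => if y = x then 0 else s + 1) 0 =
      l'.idxOf x := by
    intro x l'
    induction l' with
    | nil => rfl
    | cons y l' ih =>
      rw [List.foldr_cons, ih]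
      split_ifs with h
      · rw [List.idxOf_cons_eq _ h]
      · rw [List.idxOf_cons_ne _ h]
  have h : PolyTime fun a => (l a).foldr (fun y s => if y = f a then 0 else s + 1) 0 := by
    refine foldr (g := fun a y s => if y = f a then 0 else s + 1)
      hl (const _) (ite_prop (by fun_prop) (by fun_prop) (by fun_prop)) hl.2 fun a l' hl' => ?_
    rw [idxOf_eq, codeSize_nat]
    exact List.idxOf_le_length.trans ((length_le_codeSize l').trans
      (codeSize_le_of_sublist hl'.sublist))
  simpa only [idxOf_eq] using h

end PolyTime

end PolyTime

/-! ### The elementary functions of the algorithm -/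

/-- The entry of an adjacency matrix, given as the list of its rows; `false` out of range. -/
def entry (M : List (List Bool)) (u v : ℕ) : Bool := (M.getD u []).getD v false

/-- The vertices of `l` that are not adjacent to `u`; `u` is one of them if it occurs in `l`. -/
def nonneighbors (M : List (List Bool)) (u : ℕ) (l : List ℕ) : List ℕ :=
  l.filter fun w => ¬ entry M u w

/-- The vertices of `l` that can extend an independent set containing `u`. -/
def awayFrom (M : List (List Bool)) (u : ℕ) (l : List ℕ) : List ℕ :=
  l.filter fun w => ¬ entry M u w ∧ ¬ w = u

/-- The vertices of `l` that lie in none of the sets in `P`. -/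
def avoiding (l : List ℕ) (P : List (List ℕ)) : List ℕ := l.filter fun u => ¬ u ∈ P.flatten

/-- There is no edge between `p` and `q`. -/
abbrev NoEdgeBetween (M : List (List Bool)) (p q : List ℕ) : Prop :=
  ∀ u ∈ p, ∀ v ∈ q, ¬ entry M u v

/-- Sublists of `Z`, at most `n` of them (for `n ≠ 0`), and all of them if there are at most `n`.
Capping the enumeration at every step keeps it in polynomial time. -/
def cappedSublists (Z : List ℕ) (n : ℕ) : List (List ℕ) :=
  Z.foldr (fun z L => (L ++ L.map fun s => z :: s).rtake n) [[]]

/-- The three parts of a tripartition of a list of vertices. -/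
structure Parts where
  A : List ℕ
  B : List ℕ
  R : List ℕ

/-- The vertices of `X` with label `a`, where `L` lists the labels of the vertices of `X`. -/
def labelClass (X L : List ℕ) (a : ℕ) : List ℕ := X.filter fun x => L.getD (X.idxOf x) 3 = a

namespace Parts

/-- The tripartition of `X` given by a list of labels, as in `Tripartition.encode`. -/
def ofLabels (X L : List ℕ) : Parts := ⟨labelClass X L 0, labelClass X L 1, labelClass X L 2⟩

/-- The vertices that an independent set containing `v ∈ A` and `w ∈ B` may have. -/
def crossRegion (T : Parts) (M : List (List Bool)) (v w : ℕ) : List ℕ :=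
  nonneighbors M w T.A ++ nonneighbors M v T.B ++ T.R

/-- The vertices that remain available once `u` has been chosen. -/
def awayFrom (T : Parts) (M : List (List Bool)) (u : ℕ) : Parts :=
  ⟨NoisyCographs.awayFrom M u T.A, NoisyCographs.awayFrom M u T.B, NoisyCographs.awayFrom M u T.R⟩

end Parts

/-- A state of the search in a sparse tripartition: `S` is the partial solution, the three parts
hold the vertices that are still available, `i` vertices are to be found in `A` and `j` in `B`,
and `P` and `Q` are the independent sets of sizes `i` and `j` found in `A` and in `B` so far. -/
structure SearchState extends Parts where
  S : List ℕ
  i : ℕ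
  j : ℕ
  P : List (List ℕ)
  Q : List (List ℕ)

/-- The states with partial solution `S` and `r` vertices to be found, before any query. -/
def initialStates (T : Parts) (S : List ℕ) (r : ℕ) : List SearchState :=
  (List.range (r + 1)).map fun i => ⟨T, S, i, r - i, [], []⟩

/-- The sets `S ∪ p ∪ q` with `p ∈ P`, `q ∈ Q` and no edge between `p` and `q`. -/
def joinedSets (M : List (List Bool)) (S : List ℕ) (P Q : List (List ℕ)) : List (List ℕ) :=
  P.flatMap fun p => (Q.filter fun q => NoEdgeBetween M p q).map fun q => S ++ p ++ q

namespace SearchState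

/-- The states in which one of the vertices of `P ∪ Q ∪ R` has been chosen. -/
def children (M : List (List Bool)) (s : SearchState) : List SearchState :=
  (s.P.flatten ++ s.Q.flatten ++ s.R).flatMap fun u =>
    initialStates (s.toParts.awayFrom M u) (u :: s.S) (s.i + s.j - 1)

/-- Record the independent sets `p` and `q`. -/
def extend (s : SearchState) (p q : List ℕ) : SearchState :=
  ⟨s.toParts, s.S, s.i, s.j, p :: s.P, q :: s.Q⟩

/-- The solution, if any, that the answers to the two queries of a state give at once. -/
def immediateAnswer (M : List (List Bool)) (s : SearchState) (rA rB : Option (List ℕ)) :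
    Option (List ℕ) :=
  (joinedSets M s.S (rA.toList ++ s.P) (rB.toList ++ s.Q)).head?

/-- The states to be explored after the answers to the two queries of a state. -/
def next (M : List (List Bool)) (s : SearchState) (rA rB : Option (List ℕ)) : List SearchState :=
  if rA.isSome ∧ rB.isSome then [s.extend (rA.getD []) (rB.getD [])] else s.children M

end SearchState

/-- An adjacency matrix and a parameter, encoded as in `encodeInstance`. -/
abbrev Instance : Type := List (List Bool) × ℕ

/-- The problem of finding an independent set of size `target` in a set of vertices. -/
structure Problem where
  inst : Instance
  vertices : List ℕ
  target : ℕ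

namespace Problem

/-- The same problem in a smaller set of vertices. -/
def restrict (p : Problem) (X : List ℕ) : Problem := ⟨p.inst, X, p.target⟩

/-- The problems that are solved without a tripartition. -/
abbrev IsTrivial (p : Problem) : Prop := p.target = 0 ∨ p.vertices.length < 2

/-- The answer to a trivial problem. -/
def trivialAnswer (p : Problem) : Option (List ℕ) :=
  if p.target = 0 then some []
  else if p.target = p.vertices.length then some p.vertices else none

/-- The induced subgraph for which a tripartition is requested. -/
def inducedInstance (p : Problem) : Instance :=
  (p.vertices.map fun u => p.vertices.map fun v => entry p.inst.1 u v, p.inst.2)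

/-- The tripartition of the vertices given by a list of labels. -/
def parts (p : Problem) (L : List ℕ) : Parts := Parts.ofLabels p.vertices L

/-- Every independent set that meets both `A` and `B` lies in a set with few subsets. -/
abbrev HasSmallCrossRegions (p : Problem) (L : List ℕ) : Prop :=
  ∀ v ∈ (p.parts L).A, ∀ w ∈ (p.parts L).B,
    (cappedSublists ((p.parts L).crossRegion p.inst.1 v w) p.vertices.length).length <
      p.vertices.length

/-- Exhaustive search for an independent set that meets both `A` and `B`. -/
def crossAnswer (p : Problem) (L : List ℕ) : Option (List ℕ) :=
  ((p.parts L).A.flatMap fun v => (p.parts L).B.flatMap fun w =>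
    (cappedSublists ((p.parts L).crossRegion p.inst.1 v w) p.vertices.length).filter fun I =>
      I.length = p.target ∧ NoEdgeBetween p.inst.1 I I).head?

end Problem

/-- The query of a search state for a set in `A` that avoids the sets found so far. -/
def SearchState.queryA (inst : Instance) (s : SearchState) : Problem :=
  ⟨inst, avoiding s.A s.P, s.i⟩

/-- The query of a search state for a set in `B` that avoids the sets found so far. -/
def SearchState.queryB (inst : Instance) (s : SearchState) : Problem :=
  ⟨inst, avoiding s.B s.Q, s.j⟩

/-! ### Polynomial time algorithms for the elementary functions -/

instance : TreeEncoding Parts := ⟨fun T => toData (T.A, T.B, T.R)⟩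

instance : TreeEncoding SearchState := ⟨fun s => toData (s.toParts, s.S, s.i, s.j, s.P, s.Q)⟩

instance : TreeEncoding Problem := ⟨fun p => toData (p.inst, p.vertices, p.target)⟩

namespace PolyTime

variable {α : Type} [TreeEncoding α]

section Structures

variable {T : α → Parts} {s : α → SearchState} {p : α → Problem}

theorem partsProd (hT : PolyTime T) : PolyTime fun x => ((T x).A, (T x).B, (T x).R) :=
  hT.congr_toData (fun x => x) (fun _ => rfl) fun _ => rfl

@[fun_prop] theorem partsA (hT : PolyTime T) : PolyTime fun x => (T x).A := fst.comp hT.partsProd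

@[fun_prop] theorem partsB (hT : PolyTime T) : PolyTime fun x => (T x).B :=
  fst.comp (snd.comp hT.partsProd)

@[fun_prop] theorem partsR (hT : PolyTime T) : PolyTime fun x => (T x).R :=
  snd.comp (snd.comp hT.partsProd)

@[fun_prop]
theorem partsMk {A B R : α → List ℕ} (hA : PolyTime A) (hB : PolyTime B) (hR : PolyTime R) :
    PolyTime fun x => Parts.mk (A x) (B x) (R x) :=
  (hA.pair (hB.pair hR)).congr_toData (fun x => x) (fun _ => rfl) fun _ => rfl

theorem stateProd (hs : PolyTime s) :
    PolyTime fun x => ((s x).toParts, (s x).S, (s x).i, (s x).j, (s x).P, (s x).Q) :=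
  hs.congr_toData (fun x => x) (fun _ => rfl) fun _ => rfl

@[fun_prop] theorem stateParts (hs : PolyTime s) : PolyTime fun x => (s x).toParts :=
  fst.comp hs.stateProd

@[fun_prop] theorem stateS (hs : PolyTime s) : PolyTime fun x => (s x).S :=
  fst.comp (snd.comp hs.stateProd)

@[fun_prop] theorem statei (hs : PolyTime s) : PolyTime fun x => (s x).i :=
  fst.comp (snd.comp (snd.comp hs.stateProd))

@[fun_prop] theorem statej (hs : PolyTime s) : PolyTime fun x => (s x).j :=
  fst.comp (snd.comp (snd.comp (snd.comp hs.stateProd)))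

@[fun_prop] theorem stateP (hs : PolyTime s) : PolyTime fun x => (s x).P :=
  fst.comp (snd.comp (snd.comp (snd.comp (snd.comp hs.stateProd))))

@[fun_prop] theorem stateQ (hs : PolyTime s) : PolyTime fun x => (s x).Q :=
  snd.comp (snd.comp (snd.comp (snd.comp (snd.comp hs.stateProd))))

@[fun_prop]
theorem stateMk {S : α → List ℕ} {i j : α → ℕ} {P Q : α → List (List ℕ)} (hT : PolyTime T)
    (hS : PolyTime S) (hi : PolyTime i) (hj : PolyTime j) (hP : PolyTime P) (hQ : PolyTime Q) :
    PolyTime fun x => SearchState.mk (T x) (S x) (i x) (j x) (P x) (Q x) :=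
  (hT.pair (hS.pair (hi.pair (hj.pair (hP.pair hQ))))).congr_toData (fun x => x)
    (fun _ => rfl) fun _ => rfl

theorem problemProd (hp : PolyTime p) :
    PolyTime fun x => ((p x).inst, (p x).vertices, (p x).target) :=
  hp.congr_toData (fun x => x) (fun _ => rfl) fun _ => rfl

@[fun_prop] theorem problemInst (hp : PolyTime p) : PolyTime fun x => (p x).inst :=
  fst.comp hp.problemProd

@[fun_prop] theorem problemVertices (hp : PolyTime p) : PolyTime fun x => (p x).vertices :=
  fst.comp (snd.comp hp.problemProd)

@[fun_prop] theorem problemTarget (hp : PolyTime p) : PolyTime fun x => (p x).target :=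
  snd.comp (snd.comp hp.problemProd)

@[fun_prop]
theorem problemMk {e : α → Instance} {X : α → List ℕ} {t : α → ℕ} (he : PolyTime e)
    (hX : PolyTime X) (ht : PolyTime t) : PolyTime fun x => Problem.mk (e x) (X x) (t x) :=
  (he.pair (hX.pair ht)).congr_toData (fun x => x) (fun _ => rfl) fun _ => rfl

end Structures

section Functions

variable {M : α → List (List Bool)} {u v : α → ℕ} {l : α → List ℕ} {P Q : α → List (List ℕ)}
  {T : α → Parts} {s : α → SearchState} {p : α → Problem} {rA rB : α → Option (List ℕ)}

@[fun_prop]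
theorem entry (hM : PolyTime M) (hu : PolyTime u) (hv : PolyTime v) :
    PolyTime fun a => entry (M a) (u a) (v a) := by unfold NoisyCographs.entry; fun_prop

@[fun_prop]
theorem nonneighbors (hM : PolyTime M) (hu : PolyTime u) (hl : PolyTime l) :
    PolyTime fun a => nonneighbors (M a) (u a) (l a) := by
  unfold NoisyCographs.nonneighbors; fun_prop

@[fun_prop]
theorem awayFrom (hM : PolyTime M) (hu : PolyTime u) (hl : PolyTime l) :
    PolyTime fun a => awayFrom (M a) (u a) (l a) := by unfold NoisyCographs.awayFrom; fun_prop

@[fun_prop]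
theorem avoiding (hl : PolyTime l) (hP : PolyTime P) : PolyTime fun a => avoiding (l a) (P a) := by
  unfold NoisyCographs.avoiding; fun_prop

@[fun_prop]
theorem labelClass {X : α → List ℕ} (hX : PolyTime X) (hl : PolyTime l) (hu : PolyTime u) :
    PolyTime fun a => labelClass (X a) (l a) (u a) := by
  unfold NoisyCographs.labelClass; fun_prop

@[fun_prop]
theorem crossRegion (hT : PolyTime T) (hM : PolyTime M) (hu : PolyTime u) (hv : PolyTime v) :
    PolyTime fun a => (T a).crossRegion (M a) (u a) (v a) := by
  unfold Parts.crossRegion; fun_prop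

@[fun_prop]
theorem parts (hp : PolyTime p) (hl : PolyTime l) : PolyTime fun a => (p a).parts (l a) := by
  unfold Problem.parts Parts.ofLabels; fun_prop

@[fun_prop]
theorem initialStates (hT : PolyTime T) (hl : PolyTime l) (hu : PolyTime u) :
    PolyTime fun a => initialStates (T a) (l a) (u a) := by
  unfold NoisyCographs.initialStates; fun_prop

@[fun_prop]
theorem joinedSets (hM : PolyTime M) (hl : PolyTime l) (hP : PolyTime P) (hQ : PolyTime Q) :
    PolyTime fun a => joinedSets (M a) (l a) (P a) (Q a) := by
  unfold NoisyCographs.joinedSets; fun_prop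

@[fun_prop]
theorem immediateAnswer (hM : PolyTime M) (hs : PolyTime s) (hA : PolyTime rA)
    (hB : PolyTime rB) : PolyTime fun a => (s a).immediateAnswer (M a) (rA a) (rB a) := by
  unfold SearchState.immediateAnswer; fun_prop

@[fun_prop]
theorem next (hM : PolyTime M) (hs : PolyTime s) (hA : PolyTime rA) (hB : PolyTime rB) :
    PolyTime fun a => (s a).next (M a) (rA a) (rB a) := by
  unfold SearchState.next SearchState.extend SearchState.children Parts.awayFrom; fun_prop

end Functions

end PolyTime

theorem cappedSublists_cons (z : ℕ) (Z : List ℕ) (n : ℕ) : cappedSublists (z :: Z) n =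
    (cappedSublists Z n ++ (cappedSublists Z n).map fun s => z :: s).rtake n := rfl

theorem length_cappedSublists_le (Z : List ℕ) (n : ℕ) : (cappedSublists Z n).length ≤ n + 1 := by
  cases Z with
  | nil => simp [cappedSublists]
  | cons z Z => rw [cappedSublists_cons, List.rtake, List.length_drop]; omega

theorem sublist_of_mem_cappedSublists {Z s : List ℕ} {n : ℕ} (h : s ∈ cappedSublists Z n) :
    s.Sublist Z := by
  induction Z generalizing s with
  | nil => rw [List.mem_singleton.1 h]
  | cons z Z ih =>
    rcases List.mem_append.1 (List.mem_of_mem_drop h) with h | h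
    · exact (ih h).cons z
    · obtain ⟨s', hs', rfl⟩ := List.mem_map.1 h
      exact (ih hs').cons_cons z

@[fun_prop]
theorem PolyTime.cappedSublists {α : Type} [TreeEncoding α] {Z : α → List ℕ} {n : α → ℕ}
    (hZ : PolyTime Z) (hn : PolyTime n) : PolyTime fun a => cappedSublists (Z a) (n a) := by
  refine foldr (g := fun a z L => (L ++ L.map fun s => z :: s).rtake (n a))
    (h := fun _ => ([[]] : List (List ℕ)))
    (B := fun a => (codeSize (n a) + 1) * (codeSize (Z a) + 1)) hZ (const _)
    (by unfold List.rtake; fun_prop)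
    ((hn.2.add (PolyBounded.const 1)).mul (hZ.2.add (PolyBounded.const 1))) fun a l' hl' => ?_
  refine (codeSize_list_le (m := codeSize (Z a)) fun s hs => ?_).trans
    (Nat.mul_le_mul_right _ ?_)
  · exact codeSize_le_of_sublist
      ((sublist_of_mem_cappedSublists (n := n a) hs).trans hl'.sublist)
  · rw [codeSize_nat]
    exact length_cappedSublists_le l' (n a)

/-! ### The program -/

/-- The arguments of the recursive function: either a problem, or an instance with a list of search
states, one of which is to be completed to a solution. -/
abbrev Call : Type := Problem ⊕ (Instance × List SearchState)

/-- A search state together with the answers to its two queries. -/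
abbrev AnsweredState : Type := (Instance × SearchState) × Option (List ℕ) × Option (List ℕ)

section Steps

theorem polyTime_isTrivial : PolyTime fun p : Problem => decide p.IsTrivial := by fun_prop

theorem polyTime_trivialAnswer : PolyTime Problem.trivialAnswer := by
  unfold Problem.trivialAnswer; fun_prop

theorem polyTime_inducedInstance : PolyTime Problem.inducedInstance := by
  unfold Problem.inducedInstance; fun_prop

theorem polyTime_hasSmallCrossRegions :
    PolyTime fun y : Problem × List ℕ => decide (y.1.HasSmallCrossRegions y.2) := by fun_prop

theorem polyTime_crossAnswer : PolyTime fun y : Problem × List ℕ => y.1.crossAnswer y.2 := by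
  unfold Problem.crossAnswer; fun_prop

theorem polyTime_callA : PolyTime fun y : Problem × List ℕ =>
    (Sum.inl (y.1.restrict ((y.1.parts y.2).A ++ (y.1.parts y.2).R)) : Call) := by
  unfold Problem.restrict; exact PolyTime.inl (by fun_prop)

theorem polyTime_callB : PolyTime fun y : Problem × List ℕ =>
    (Sum.inl (y.1.restrict ((y.1.parts y.2).B ++ (y.1.parts y.2).R)) : Call) := by
  unfold Problem.restrict; exact PolyTime.inl (by fun_prop)

theorem polyTime_callSearch : PolyTime fun y : Problem × List ℕ =>
    (Sum.inr (y.1.inst, initialStates (y.1.parts y.2) [] y.1.target) : Call) :=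
  PolyTime.inr (by fun_prop)

theorem polyTime_callQueryA :
    PolyTime fun y : Instance × SearchState => (Sum.inl (y.2.queryA y.1) : Call) := by
  unfold SearchState.queryA; exact PolyTime.inl (by fun_prop)

theorem polyTime_callQueryB :
    PolyTime fun y : Instance × SearchState => (Sum.inl (y.2.queryB y.1) : Call) := by
  unfold SearchState.queryB; exact PolyTime.inl (by fun_prop)

theorem polyTime_immediateAnswer :
    PolyTime fun y : AnsweredState => y.1.2.immediateAnswer y.1.1.1 y.2.1 y.2.2 := by fun_prop

theorem polyTime_callNext : PolyTime fun y : AnsweredState =>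
    (Sum.inr (y.1.1, y.1.2.next y.1.1.1 y.2.1 y.2.2) : Call) :=
  PolyTime.inr (by fun_prop)

end Steps

section ChosenProgram

variable {α β : Type} [TreeEncoding α] [TreeEncoding β] {f : α → β}

/-- A program that computes a polynomial time function. -/
noncomputable def PolyTime.prog (hf : PolyTime f) : Prog := hf.1.choose

theorem PolyTime.exists_exponent (hf : PolyTime f) : ∃ c, ∀ O F x,
    EvalWithin O F hf.prog (toData x) (toData (f x)) ((codeSize x + 2) ^ c) := by
  obtain ⟨T, ⟨c, hT⟩, hp⟩ := hf.1.choose_spec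
  exact ⟨c, fun O F x => (hp O F x).mono (hT x)⟩

/-- The exponent of a polynomial that bounds the running time of the program `PolyTime.prog`. -/
noncomputable def PolyTime.exponent (hf : PolyTime f) : ℕ := hf.exists_exponent.choose

theorem PolyTime.evalWithin_prog (hf : PolyTime f) {c : ℕ} (hc : hf.exponent ≤ c) (O : Oracle)
    (F : Prog) (x : α) :
    EvalWithin O F hf.prog (toData x) (toData (f x)) ((codeSize x + 2) ^ c) :=
  (hf.exists_exponent.choose_spec O F x).mono (Nat.pow_le_pow_right (Nat.succ_pos _) hc)

end ChosenProgram

/-- Run `p`; if it fails (that is, returns `nil`), run `q`. -/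
def Prog.orElse (p q : Prog) : Prog :=
  Prog.comp (Prog.cond Prog.hd Prog.hd (Prog.comp q Prog.tl)) (Prog.cons p Prog.id)

theorem EvalWithin.orElse {O : Oracle} {F p q : Prog} {x : Data} {s t : ℕ}
    {r r' : Option (List ℕ)} (hp : EvalWithin O F p x (toData r) s)
    (hq : r = none → EvalWithin O F q x (toData r') t) :
    EvalWithin O F (Prog.orElse p q) x (toData (r.or r')) (s + t + 10) := by
  cases r with
  | none =>
    exact ((hp.cons EvalWithin.id).comp
      (EvalWithin.cond_false EvalWithin.hd (EvalWithin.tl.comp (hq rfl)))).mono (by omega)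
  | some l =>
    exact ((hp.cons EvalWithin.id).comp
      (EvalWithin.cond_true EvalWithin.hd EvalWithin.hd)).mono (by omega)

/-- From a problem and the labels of a tripartition, solve the problem. -/
noncomputable def tripartitionBody : Prog :=
  Prog.cond polyTime_hasSmallCrossRegions.prog
    (Prog.orElse (Prog.comp Prog.self polyTime_callA.prog)
      (Prog.orElse (Prog.comp Prog.self polyTime_callB.prog) polyTime_crossAnswer.prog))
    (Prog.comp Prog.self polyTime_callSearch.prog)

/-- Solve a problem, where `q` is a program that finds tripartitions. -/
noncomputable def problemBody (q : Prog) : Prog :=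
  Prog.cond polyTime_isTrivial.prog polyTime_trivialAnswer.prog
    (Prog.comp tripartitionBody
      (Prog.cons Prog.id (Prog.comp (Prog.fn q) polyTime_inducedInstance.prog)))

/-- From an instance and a nonempty list of search states, compute the answers to the two queries of
the first state. -/
noncomputable def queriesBody : Prog :=
  Prog.comp (Prog.cons Prog.id
      (Prog.cons (Prog.comp Prog.self polyTime_callQueryA.prog)
        (Prog.comp Prog.self polyTime_callQueryB.prog)))
    (Prog.cons Prog.hd (Prog.comp Prog.hd Prog.tl))

/-- From an instance and a nonempty list of search states, the call without the first state. -/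
def restBody : Prog :=
  Prog.cons (Prog.cons Prog.nil Prog.nil) (Prog.cons Prog.hd (Prog.comp Prog.tl Prog.tl))

/-- Complete one of the search states of a list to a solution. -/
noncomputable def searchBody : Prog :=
  Prog.cond Prog.tl
    (Prog.comp
      (Prog.orElse (Prog.comp polyTime_immediateAnswer.prog Prog.hd)
        (Prog.orElse (Prog.comp Prog.self (Prog.comp polyTime_callNext.prog Prog.hd))
          (Prog.comp Prog.self (Prog.comp restBody Prog.tl))))
      (Prog.cons queriesBody Prog.id))
    Prog.nil

/-- The body of the recursive function. -/
noncomputable def solverBody (q : Prog) : Prog :=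
  Prog.cond Prog.hd (Prog.comp searchBody Prog.tl) (Prog.comp (problemBody q) Prog.tl)

/-- An exponent that is large enough for all polynomial time steps of the program. -/
noncomputable def stepExponent : ℕ :=
  polyTime_isTrivial.exponent + polyTime_trivialAnswer.exponent +
  polyTime_inducedInstance.exponent + polyTime_hasSmallCrossRegions.exponent +
  polyTime_crossAnswer.exponent + polyTime_callA.exponent + polyTime_callB.exponent +
  polyTime_callSearch.exponent + polyTime_callQueryA.exponent + polyTime_callQueryB.exponent +
  polyTime_immediateAnswer.exponent + polyTime_callNext.exponent

/-- A bound on the time between two recursive calls of the program, for data of size `s`. -/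
noncomputable def overhead (s : ℕ) : ℕ := (s + 2) ^ (stepExponent + 8)

theorem mul_pow_stepExponent_le_overhead (s : ℕ) :
    256 * (s + 2) ^ stepExponent ≤ overhead s := by
  rw [overhead, pow_add, mul_comm]
  exact Nat.mul_le_mul_left _ (Nat.pow_le_pow_left (Nat.le_add_left 2 s) 8)

theorem overhead_mono : Monotone overhead := fun _ _ h =>
  Nat.pow_le_pow_left (Nat.add_le_add_right h 2) _

/-- The recursive function with oracle `O` and subprogram `q` maps `x` to `r` in time at most
`t`. -/
def Solves (O : Oracle) (q : Prog) (x : Call) (r : Option (List ℕ)) (t : ℕ) : Prop :=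
  EvalWithin O (solverBody q) (solverBody q) (toData x) (toData r) t

namespace Solves

variable {O : Oracle} {q : Prog} {p : Problem} {L : List ℕ} {e : Instance} {s : SearchState}
  {rest : List SearchState} {r rA rB rN rR : Option (List ℕ)} {t tq tA tB tN tR : ℕ}

theorem mono {x : Call} {t' : ℕ} (h : Solves O q x r t) (htt' : t ≤ t') : Solves O q x r t' :=
  EvalWithin.mono h htt'

theorem of_problemBody
    (h : EvalWithin O (solverBody q) (problemBody q) (toData p) (toData r) t) :
    Solves O q (Sum.inl p) r (t + 4) :=
  (EvalWithin.cond_false EvalWithin.hd (EvalWithin.tl.comp h)).mono (by omega)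

theorem of_searchBody
    (h : EvalWithin O (solverBody q) searchBody (toData (e, rest)) (toData r) t) :
    Solves O q (Sum.inr (e, rest)) r (t + 4) :=
  (EvalWithin.cond_true EvalWithin.hd (EvalWithin.tl.comp h)).mono (by omega)

theorem of_isTrivial (h : p.IsTrivial) :
    Solves O q (Sum.inl p) p.trivialAnswer (overhead (codeSize p)) := by
  have htriv := polyTime_isTrivial.evalWithin_prog (c := stepExponent)
    (by unfold stepExponent; omega) O (solverBody q) p
  have hans := polyTime_trivialAnswer.evalWithin_prog (c := stepExponent)
    (by unfold stepExponent; omega) O (solverBody q) p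
  rw [decide_eq_true h] at htriv
  refine (of_problemBody (EvalWithin.cond_true htriv hans)).mono ?_
  have := mul_pow_stepExponent_le_overhead (codeSize p)
  have := Nat.one_le_pow stepExponent (codeSize p + 2) (by omega)
  omega

theorem of_tripartitionBody (h : ¬ p.IsTrivial)
    (hq : EvalWithin O q q (toData p.inducedInstance) (toData L) tq)
    (hL : EvalWithin O (solverBody q) tripartitionBody (toData (p, L)) (toData r) t) :
    Solves O q (Sum.inl p) r (tq + t + 2 * (codeSize (p, L) + 2) ^ stepExponent + 10) := by
  have htriv := polyTime_isTrivial.evalWithin_prog (c := stepExponent)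
    (by unfold stepExponent; omega) O (solverBody q) p
  have hind := polyTime_inducedInstance.evalWithin_prog (c := stepExponent)
    (by unfold stepExponent; omega) O (solverBody q) p
  rw [decide_eq_false h] at htriv
  refine (of_problemBody (EvalWithin.cond_false htriv
    ((EvalWithin.id.cons (hind.comp hq.fn)).comp hL))).mono ?_
  have : (codeSize p + 2) ^ stepExponent ≤ (codeSize (p, L) + 2) ^ stepExponent :=
    Nat.pow_le_pow_left (by rw [codeSize_pair]; omega) _
  omega

theorem of_hasSmallCrossRegions (h : ¬ p.IsTrivial)
    (hq : EvalWithin O q q (toData p.inducedInstance) (toData L) tq)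
    (hL : p.HasSmallCrossRegions L)
    (hA : Solves O q (Sum.inl (p.restrict ((p.parts L).A ++ (p.parts L).R))) rA tA)
    (hB : Solves O q (Sum.inl (p.restrict ((p.parts L).B ++ (p.parts L).R))) rB tB) :
    Solves O q (Sum.inl p) (rA.or (rB.or (p.crossAnswer L)))
      (tq + tA + tB + overhead (codeSize (p, L))) := by
  have hsmall := polyTime_hasSmallCrossRegions.evalWithin_prog (c := stepExponent)
    (by unfold stepExponent; omega) O (solverBody q) (p, L)
  have hcallA := polyTime_callA.evalWithin_prog (c := stepExponent)
    (by unfold stepExponent; omega) O (solverBody q) (p, L)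
  have hcallB := polyTime_callB.evalWithin_prog (c := stepExponent)
    (by unfold stepExponent; omega) O (solverBody q) (p, L)
  have hcross := polyTime_crossAnswer.evalWithin_prog (c := stepExponent)
    (by unfold stepExponent; omega) O (solverBody q) (p, L)
  rw [decide_eq_true hL] at hsmall
  refine (of_tripartitionBody h hq (EvalWithin.cond_true hsmall
    ((hcallA.comp hA.self).orElse fun _ => (hcallB.comp hB.self).orElse fun _ => hcross))).mono ?_
  have := mul_pow_stepExponent_le_overhead (codeSize (p, L))
  have := Nat.one_le_pow stepExponent (codeSize (p, L) + 2) (by omega)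
  omega

theorem of_search (h : ¬ p.IsTrivial)
    (hq : EvalWithin O q q (toData p.inducedInstance) (toData L) tq)
    (hL : ¬ p.HasSmallCrossRegions L)
    (hr : Solves O q (Sum.inr (p.inst, initialStates (p.parts L) [] p.target)) r t) :
    Solves O q (Sum.inl p) r (tq + t + overhead (codeSize (p, L))) := by
  have hsmall := polyTime_hasSmallCrossRegions.evalWithin_prog (c := stepExponent)
    (by unfold stepExponent; omega) O (solverBody q) (p, L)
  have hcall := polyTime_callSearch.evalWithin_prog (c := stepExponent)
    (by unfold stepExponent; omega) O (solverBody q) (p, L)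
  rw [decide_eq_false hL] at hsmall
  refine (of_tripartitionBody h hq (EvalWithin.cond_false hsmall (hcall.comp hr.self))).mono ?_
  have := mul_pow_stepExponent_le_overhead (codeSize (p, L))
  have := Nat.one_le_pow stepExponent (codeSize (p, L) + 2) (by omega)
  omega

theorem search_nil : Solves O q (Sum.inr (e, [])) none 20 :=
  (of_searchBody (EvalWithin.cond_false EvalWithin.tl EvalWithin.nil)).mono (by norm_num)

theorem evalWithin_queriesBody (hA : Solves O q (Sum.inl (s.queryA e)) rA tA)
    (hB : Solves O q (Sum.inl (s.queryB e)) rB tB) :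
    EvalWithin O (solverBody q) queriesBody (toData (e, s :: rest)) (toData ((e, s), rA, rB))
      (tA + tB + 2 * (codeSize (e, s) + 2) ^ stepExponent + 20) := by
  have hcallA := polyTime_callQueryA.evalWithin_prog (c := stepExponent)
    (by unfold stepExponent; omega) O (solverBody q) (e, s)
  have hcallB := polyTime_callQueryB.evalWithin_prog (c := stepExponent)
    (by unfold stepExponent; omega) O (solverBody q) (e, s)
  exact ((EvalWithin.hd.cons (EvalWithin.tl.comp EvalWithin.hd)).comp
    (EvalWithin.id.cons ((hcallA.comp hA.self).cons (hcallB.comp hB.self)))).mono (by omega)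

theorem search_cons (hA : Solves O q (Sum.inl (s.queryA e)) rA tA)
    (hB : Solves O q (Sum.inl (s.queryB e)) rB tB)
    (hN : s.immediateAnswer e.1 rA rB = none →
      Solves O q (Sum.inr (e, s.next e.1 rA rB)) rN tN)
    (hR : rN = none → Solves O q (Sum.inr (e, rest)) rR tR) :
    Solves O q (Sum.inr (e, s :: rest)) ((s.immediateAnswer e.1 rA rB).or (rN.or rR))
      (tA + tB + tN + tR + overhead (codeSize ((e, s), rA, rB))) := by
  have himm := polyTime_immediateAnswer.evalWithin_prog (c := stepExponent)
    (by unfold stepExponent; omega) O (solverBody q) ((e, s), rA, rB)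
  have hcall := polyTime_callNext.evalWithin_prog (c := stepExponent)
    (by unfold stepExponent; omega) O (solverBody q) ((e, s), rA, rB)
  have hrest : EvalWithin O (solverBody q) restBody (toData (e, s :: rest))
      (toData (Sum.inr (e, rest) : Call)) 9 :=
    (EvalWithin.nil.cons EvalWithin.nil).cons
      (EvalWithin.hd.cons (EvalWithin.tl.comp EvalWithin.tl))
  refine (of_searchBody (EvalWithin.cond_true EvalWithin.tl
    (((evalWithin_queriesBody hA hB).cons EvalWithin.id).comp
      ((EvalWithin.hd.comp himm).orElse fun h =>
        ((EvalWithin.hd.comp hcall).comp (hN h).self).orElse fun h' =>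
          (EvalWithin.tl.comp hrest).comp (hR h').self)))).mono ?_
  have := mul_pow_stepExponent_le_overhead (codeSize ((e, s), rA, rB))
  have := Nat.one_le_pow stepExponent (codeSize ((e, s), rA, rB) + 2) (by omega)
  have : (codeSize (e, s) + 2) ^ stepExponent ≤ (codeSize ((e, s), rA, rB) + 2) ^ stepExponent :=
    Nat.pow_le_pow_left (by rw [codeSize_pair (e, s)]; omega) _
  omega

end Solves

/-! ### Sparse pairs of vertex sets -/

section Biclique

open Finset

variable {V : Type} {Γ : SimpleGraph V} {d : ℕ} {A B : Finset V}

/-- The bipartite graph between `A` and `B` contains no `K_{d,d}`. -/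
def BicliqueFree (Γ : SimpleGraph V) (d : ℕ) (A B : Finset V) : Prop :=
  ¬ ∃ X Y : Finset V, X ⊆ A ∧ Y ⊆ B ∧ #X = d ∧ #Y = d ∧ ∀ x ∈ X, ∀ y ∈ Y, Γ.Adj x y

theorem BicliqueFree.ne_zero (h : BicliqueFree Γ d A B) : d ≠ 0 := by
  rintro rfl
  exact h ⟨∅, ∅, by simp, by simp, by simp, by simp, by simp⟩

theorem BicliqueFree.symm (h : BicliqueFree Γ d A B) : BicliqueFree Γ d B A := by
  rintro ⟨X, Y, hX, hY, hXd, hYd, hadj⟩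
  exact h ⟨Y, X, hY, hX, hYd, hXd, fun x hx y hy => (hadj y hy x hx).symm⟩

theorem BicliqueFree.mono {d' : ℕ} {A' B' : Finset V} (h : BicliqueFree Γ d A B) (hd : d ≤ d')
    (hA : A' ⊆ A) (hB : B' ⊆ B) : BicliqueFree Γ d' A' B' := by
  rintro ⟨X, Y, hX, hY, hXd, hYd, hadj⟩
  obtain ⟨X', hX', hXd'⟩ := exists_subset_card_eq (hd.trans hXd.ge)
  obtain ⟨Y', hY', hYd'⟩ := exists_subset_card_eq (hd.trans hYd.ge)
  exact h ⟨X', Y', hX'.trans (hX.trans hA), hY'.trans (hY.trans hB), hXd', hYd',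
    fun x hx y hy => hadj x (hX' hx) y (hY' hy)⟩

theorem bicliqueFree_succ_of_forall_card_le [DecidableRel Γ.Adj]
    (h : ∀ v ∈ A, #(B.filter (Γ.Adj v)) ≤ d) : BicliqueFree Γ (d + 1) A B := by
  rintro ⟨X, Y, hX, hY, hXd, hYd, hadj⟩
  obtain ⟨x, hx⟩ : X.Nonempty := card_pos.1 (by omega)
  have hYx : Y ⊆ B.filter (Γ.Adj x) := fun y hy => mem_filter.2 ⟨hY hy, hadj x hx y hy⟩
  have := (card_le_card hYx).trans (h x (hX hx))
  omega

/-- Kővári–Sós–Turán counting: assign to each such vertex a `d`-set of neighbours; fewer than `d`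
vertices share the same one. -/
theorem BicliqueFree.card_filter_le_card_neighbors [DecidableRel Γ.Adj]
    (h : BicliqueFree Γ d A B) :
    #(B.filter fun w => d ≤ #(A.filter (Γ.Adj w))) ≤ d * 2 ^ #A := by
  classical
  have hchoice : ∀ w, d ≤ #(A.filter (Γ.Adj w)) → ∃ X ⊆ A.filter (Γ.Adj w), #X = d :=
    fun w hw => exists_subset_card_eq hw
  choose! f hf hfd using hchoice
  by_contra! hlt
  obtain ⟨X, -, hX⟩ := exists_lt_card_fiber_of_mul_lt_card_of_maps_to
    (s := B.filter fun w => d ≤ #(A.filter (Γ.Adj w))) (t := A.powerset) (f := f) (n := d)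
    (fun w hw => mem_powerset.2 ((hf w (mem_filter.1 hw).2).trans (filter_subset _ _)))
    (by rwa [card_powerset, mul_comm])
  obtain ⟨Y, hY, hYd⟩ := exists_subset_card_eq hX.le
  have hYX : ∀ y ∈ Y, (y ∈ B ∧ d ≤ #(A.filter (Γ.Adj y))) ∧ f y = X := fun y hy => by
    simpa only [mem_filter] using hY hy
  have hXnbr : ∀ y ∈ Y, X ⊆ A.filter (Γ.Adj y) := fun y hy =>
    (hYX y hy).2 ▸ hf y (hYX y hy).1.2
  obtain ⟨y, hy⟩ : Y.Nonempty := card_pos.1 (hYd ▸ h.ne_zero.bot_lt)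
  exact h ⟨X, Y, (hXnbr y hy).trans (filter_subset _ _), fun y hy => (hYX y hy).1.1,
    (hYX y hy).2 ▸ hfd y (hYX y hy).1.2, hYd,
    fun x hx z hz => ((mem_filter.1 (hXnbr z hz hx)).2).symm⟩

theorem exists_mem_le_card_neighbors_biUnion [DecidableRel Γ.Adj] [DecidableEq V] {ι : Type}
    [Fintype ι] {k : ℕ} {P : ι → Finset V} {Q : Finset V}
    (hP : Pairwise fun i j => Disjoint (P i) (P j)) (hQ : Q.Nonempty) (hQk : #Q ≤ k)
    (hadj : ∀ i, ∃ u ∈ P i, ∃ v ∈ Q, Γ.Adj u v) (hd : d * k ≤ Fintype.card ι) :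
    ∃ y ∈ Q, d ≤ #((univ.biUnion P).filter (Γ.Adj y)) := by
  choose u hu v hv huv using hadj
  obtain ⟨y, hy, hyd⟩ := exists_le_card_fiber_of_mul_le_card_of_maps_to
    (s := (univ : Finset ι)) (t := Q) (f := v) (n := d) (fun i _ => hv i) hQ
    (by rw [card_univ, mul_comm]; exact (Nat.mul_le_mul_left _ hQk).trans hd)
  refine ⟨y, hy, hyd.trans (card_le_card_of_injOn u (fun i hi => ?_) fun i _ i' _ hii => ?_)⟩
  · obtain rfl : v i = y := (mem_filter.1 hi).2
    exact mem_filter.2 ⟨mem_biUnion.2 ⟨i, mem_univ _, hu i⟩, (huv i).symm⟩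
  · by_contra hne
    exact disjoint_left.1 (hP hne) (hu i) (hii ▸ hu i')

theorem BicliqueFree.card_le_of_pairwise_joined {ι κ : Type} [Fintype ι] [Fintype κ] {k : ℕ}
    (h : BicliqueFree Γ d A B) (hk : 1 ≤ k) {P : ι → Finset V} {Q : κ → Finset V}
    (hPA : ∀ i, P i ⊆ A) (hQB : ∀ j, Q j ⊆ B) (hPk : ∀ i, #(P i) ≤ k) (hQk : ∀ j, #(Q j) ≤ k)
    (hP : Pairwise fun i j => Disjoint (P i) (P j)) (hQ : Pairwise fun i j => Disjoint (Q i) (Q j))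
    (hadj : ∀ i j, ∃ u ∈ P i, ∃ v ∈ Q j, Γ.Adj u v) (hι : Fintype.card ι = d * k) :
    Fintype.card κ ≤ d * 2 ^ (d * k * k) := by
  classical
  obtain ⟨i₀⟩ : Nonempty ι :=
    Fintype.card_pos_iff.1 (hι ▸ Nat.mul_pos h.ne_zero.bot_lt hk)
  have hQne : ∀ j, (Q j).Nonempty := fun j =>
    let ⟨_, _, v, hv, _⟩ := hadj i₀ j
    ⟨v, hv⟩
  choose y hyQ hyd using fun j =>
    exists_mem_le_card_neighbors_biUnion hP (hQne j) (hQk j) (fun i => hadj i j) hι.ge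
  have hinj : Function.Injective y := fun j j' hjj => by
    by_contra hne
    exact disjoint_left.1 (hQ hne) (hyQ j) (hjj ▸ hyQ j')
  have hcard : #(univ.biUnion P) ≤ d * k * k := by
    refine (card_biUnion_le_card_mul _ _ k fun i _ => hPk i).trans ?_
    rw [card_univ, hι]
  calc Fintype.card κ
      ≤ #(B.filter fun w => d ≤ #((univ.biUnion P).filter (Γ.Adj w))) := by
        rw [← card_univ]
        exact card_le_card_of_injOn y
          (fun j _ => mem_filter.2 ⟨hQB j (hyQ j), hyd j⟩) hinj.injOn
    _ ≤ d * 2 ^ #(univ.biUnion P) :=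
        (h.mono le_rfl (biUnion_subset.2 fun i _ => hPA i) Subset.rfl).card_filter_le_card_neighbors
    _ ≤ d * 2 ^ (d * k * k) := Nat.mul_le_mul_left _ (Nat.pow_le_pow_right two_pos hcard)

end Biclique

section SparseChain

open Finset

variable {V : Type} {Γ : SimpleGraph V} [DecidableRel Γ.Adj] {k e l : ℕ} {X : Finset V}

/-- Below `X` there is a descending chain of `l` sparse separations: from each set of the chain one
splits off a set `Z` to which all but `e` vertices of the next set `Y` are weakly attached. The
degree bound `c` may vary along the chain, provided `Z` stays larger than `k * c`. -/
def SparseChain (Γ : SimpleGraph V) [DecidableRel Γ.Adj] (k e : ℕ) : ℕ → Finset V → Prop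
  | 0, _ => True
  | l + 1, X => ∃ (Z E Y : Finset V) (c : ℕ), Z ⊆ X ∧ Y ⊆ X ∧ Disjoint Z Y ∧ k * c < #Z ∧
      #E ≤ e ∧ (∀ x ∈ Y, x ∉ E → #(Z.filter (Γ.Adj x)) ≤ c) ∧ SparseChain Γ k e l Y

theorem SparseChain.mono {X' : Finset V} (h : SparseChain Γ k e l X) (hX : X ⊆ X') :
    SparseChain Γ k e l X' := by
  cases l with
  | zero => trivial
  | succ l =>
    obtain ⟨Z, E, Y, c, hZ, hY, h'⟩ := h
    exact ⟨Z, E, Y, c, hZ.trans hX, hY.trans hX, h'⟩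

theorem sparseChain_succ_of_card_neighbors_le {Y : Finset V} {u : V} (hu : u ∈ X) (hY : Y ⊆ X)
    (huY : u ∉ Y) (he : #(Y.filter (Γ.Adj u)) ≤ e) (h : SparseChain Γ k e l Y) :
    SparseChain Γ k e (l + 1) X := by
  refine ⟨{u}, Y.filter (Γ.Adj u), Y, 0, singleton_subset_iff.2 hu, hY,
    disjoint_singleton_left.2 huY, by simp, he, fun x hx hxE => ?_, h⟩
  rw [nonpos_iff_eq_zero, card_eq_zero, filter_eq_empty_iff]
  intro z hz hxz
  obtain rfl := mem_singleton.1 hz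
  exact hxE (mem_filter.2 ⟨hx, hxz.symm⟩)

theorem sparseChain_succ_of_bicliqueFree {d : ℕ} {Y Z : Finset V} (hZ : Z ⊆ X) (hY : Y ⊆ X)
    (hZY : Disjoint Z Y) (hk : 1 ≤ k) (hc : k * d ≤ #Z) (hf : BicliqueFree Γ d Z Y)
    (h : SparseChain Γ k (d * 2 ^ (k * d)) l Y) :
    SparseChain Γ k (d * 2 ^ (k * d)) (l + 1) X := by
  obtain ⟨Z', hZ', hZc⟩ := exists_subset_card_eq hc
  refine ⟨Z', Y.filter fun w => d ≤ #(Z'.filter (Γ.Adj w)), Y, d - 1, hZ'.trans hZ, hY,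
    hZY.mono_left hZ', ?_, ?_, fun x hx hxE => ?_, h⟩
  · rw [hZc]
    exact Nat.mul_lt_mul_of_pos_left (Nat.sub_lt hf.ne_zero.bot_lt one_pos) hk
  · rw [← hZc]
    exact (hf.mono le_rfl hZ' Subset.rfl).card_filter_le_card_neighbors
  · by_contra! hlt
    exact hxE (mem_filter.2 ⟨hx, by omega⟩)

theorem exists_isNIndepSet_insert [DecidableEq V] {I Z : Finset V} {c j : ℕ}
    (hI : Γ.IsNIndepSet j I) (hZI : Disjoint Z I) (hdeg : ∀ x ∈ I, #(Z.filter (Γ.Adj x)) ≤ c)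
    (hc : j * c < #Z) :
    ∃ z ∈ Z, Γ.IsNIndepSet (j + 1) (insert z I) := by
  have hfew : #(I.biUnion fun x => Z.filter (Γ.Adj x)) < #Z :=
    (card_biUnion_le_card_mul I _ c hdeg).trans_lt (hI.card_eq ▸ hc)
  obtain ⟨z, hz, hzI⟩ := exists_mem_notMem_of_card_lt_card hfew
  have hnadj : ∀ x ∈ I, ¬ Γ.Adj x z := fun x hx hxz =>
    hzI (mem_biUnion.2 ⟨x, hx, mem_filter.2 ⟨hz, hxz⟩⟩)
  refine ⟨z, hz, ?_, by rw [card_insert_of_notMem (disjoint_left.1 hZI hz), hI.card_eq]⟩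
  rw [coe_insert, SimpleGraph.IsIndepSet, Set.pairwise_insert]
  exact ⟨hI.isIndepSet, fun x hx _ => ⟨fun h => hnadj x hx h.symm, hnadj x hx⟩⟩

/-- The set `W` of forbidden vertices makes the induction work. A step whose `Z` avoids `W`
contributes a new vertex of `Z` and forbids `E`; any other step passes to `Y`, which misses a vertex
of `W`. -/
theorem SparseChain.exists_isNIndepSet {W : Finset V} {j : ℕ} (h : SparseChain Γ k e l X)
    (hl : j * (e + 1) + #W ≤ l) (hj : j ≤ k + 1) :
    ∃ I ⊆ X, Disjoint I W ∧ Γ.IsNIndepSet j I := by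
  classical
  have hempty (X W : Finset V) : ∃ I ⊆ X, Disjoint I W ∧ Γ.IsNIndepSet 0 I :=
    ⟨∅, empty_subset _, disjoint_empty_left _, by simp [SimpleGraph.isNIndepSet_iff]⟩
  induction l generalizing X W j with
  | zero =>
    obtain rfl : j = 0 := by nlinarith
    exact hempty X W
  | succ l ih =>
    rcases j with _ | j
    · exact hempty X W
    obtain ⟨Z, E, Y, c, hZ, hY, hZY, hc, hE, hdeg, hch⟩ := h
    by_cases hZW : Disjoint Z W
    · have hWE : #(W ∪ E) ≤ #W + e := (card_union_le _ _).trans (by omega)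
      obtain ⟨I, hIY, hIW, hI⟩ := ih (W := W ∪ E) (j := j) hch
        (by rw [Nat.add_mul] at hl; omega) (by omega)
      rw [disjoint_union_right] at hIW
      obtain ⟨z, hz, hzI⟩ := exists_isNIndepSet_insert hI (hZY.mono_right hIY)
        (fun x hx => hdeg x (hIY hx) (disjoint_left.1 hIW.2 hx))
        ((Nat.mul_le_mul_right c (Nat.le_of_succ_le_succ hj)).trans_lt hc)
      exact ⟨insert z I, insert_subset (hZ hz) (hIY.trans hY),
        disjoint_insert_left.2 ⟨disjoint_left.1 hZW hz, hIW.1⟩, hzI⟩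
    · obtain ⟨w, hwZ, hwW⟩ := not_disjoint_iff.1 hZW
      have hlt : #(W ∩ Y) < #W :=
        card_lt_card ((ssubset_iff_of_subset inter_subset_left).2
          ⟨w, hwW, fun hw => disjoint_left.1 hZY hwZ (mem_inter.1 hw).2⟩)
      obtain ⟨I, hIY, hIW, hI⟩ := ih (W := W ∩ Y) hch (by omega) hj
      exact ⟨I, hIY.trans hY, disjoint_left.2 fun x hx hxW =>
        disjoint_left.1 hIW hx (mem_inter.2 ⟨hxW, hIY hx⟩), hI⟩

end SparseChain

section Separated

open Finset

variable {V : Type} {Γ : SimpleGraph V} [DecidableRel Γ.Adj] {k d l : ℕ} {A B X Y : Finset V}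
  {S : Sparsity}

/-- The pair `A`, `B` is sparse in the sense of `S`: what the sparse witnesses say about `A` and
`B`, for sets of vertices of an arbitrary graph. -/
def IsSparsePair (Γ : SimpleGraph V) [DecidableRel Γ.Adj] (k d : ℕ) (A B : Finset V) :
    Sparsity → Prop
  | Sparsity.almostDisconnected => (∀ v ∈ A, #(B.filter (Γ.Adj v)) ≤ d) ∧
      ∀ v ∈ B, #(A.filter (Γ.Adj v)) ≤ d
  | Sparsity.oneSidedAlmostDisconnected => k * d < #B ∧ ∀ v ∈ A, #(B.filter (Γ.Adj v)) ≤ d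
  | Sparsity.weaklyConnected => d ^ d * k ^ (2 * d - 1) + 1 < #A ∧
      d ^ d * k ^ (2 * d - 1) + 1 < #B ∧ BicliqueFree Γ d A B

theorem IsSparsePair.bicliqueFree (h : IsSparsePair Γ k d A B S) :
    BicliqueFree Γ (d + 1) A B := by
  cases S with
  | almostDisconnected => exact bicliqueFree_succ_of_forall_card_le h.1
  | oneSidedAlmostDisconnected => exact bicliqueFree_succ_of_forall_card_le h.2
  | weaklyConnected => exact h.2.2.mono (Nat.le_succ d) Subset.rfl Subset.rfl

theorem mul_le_pow_mul_pow_two_mul_sub_one (hd : d ≠ 0) : k * d ≤ d ^ d * k ^ (2 * d - 1) := by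
  rw [mul_comm]
  exact Nat.mul_le_mul (Nat.le_self_pow hd d) (Nat.le_self_pow (by omega) k)

theorem sparseChain_succ_of_forall_card_neighbors_le (hA : A.Nonempty) (hAB : Disjoint A B)
    (hAX : A ⊆ X) (hBX : B ⊆ X) (hY : Y ⊆ B) (hd : ∀ v ∈ A, #(B.filter (Γ.Adj v)) ≤ d)
    (h : SparseChain Γ k (d * 2 ^ (k * d)) l Y) :
    SparseChain Γ k (d * 2 ^ (k * d)) (l + 1) X := by
  obtain ⟨u, hu⟩ := hA
  exact sparseChain_succ_of_card_neighbors_le (hAX hu) (hY.trans hBX)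
    (fun huY => disjoint_left.1 hAB hu (hY huY))
    ((card_le_card (filter_subset_filter _ hY)).trans
      ((hd u hu).trans (Nat.le_mul_of_pos_right _ (by positivity)))) h

theorem IsSparsePair.sparseChain_succ (h : IsSparsePair Γ k d A B S) (hk : 1 ≤ k)
    (hA : A.Nonempty) (hB : B.Nonempty) (hAB : Disjoint A B) (hAX : A ⊆ X) (hBX : B ⊆ X)
    (hY : Y ⊆ A ∨ Y ⊆ B) (hch : SparseChain Γ k (d * 2 ^ (k * d)) l Y) :
    SparseChain Γ k (d * 2 ^ (k * d)) (l + 1) X := by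
  cases S with
  | almostDisconnected =>
    rcases hY with hY | hY
    · exact sparseChain_succ_of_forall_card_neighbors_le hB hAB.symm hBX hAX hY h.2 hch
    · exact sparseChain_succ_of_forall_card_neighbors_le hA hAB hAX hBX hY h.1 hch
  | oneSidedAlmostDisconnected =>
    rcases hY with hY | hY
    · exact ⟨B, ∅, Y, d, hBX, hY.trans hAX, hAB.symm.mono_right hY, h.1, by simp,
        fun x hx _ => h.2 x (hY hx), hch⟩
    · exact sparseChain_succ_of_forall_card_neighbors_le hA hAB hAX hBX hY h.2 hch
  | weaklyConnected =>
    obtain ⟨hAcard, hBcard, hfree⟩ := h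
    have hkd := mul_le_pow_mul_pow_two_mul_sub_one (k := k) hfree.ne_zero
    rcases hY with hY | hY
    · exact sparseChain_succ_of_bicliqueFree hBX (hY.trans hAX) (hAB.symm.mono_right hY) hk
        (by omega) (hfree.symm.mono le_rfl Subset.rfl hY) hch
    · exact sparseChain_succ_of_bicliqueFree hAX (hY.trans hBX) (hAB.mono_right hY) hk
        (by omega) (hfree.mono le_rfl Subset.rfl hY) hch

end Separated

/-! ### Correctness of the search -/

section IndepLists

variable {Γ : SimpleGraph ℕ} {X Y I J : List ℕ} {s t u : ℕ}

/-- `I` lists, without repetition, an independent set of size `t` in `X`. -/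
structure IsIndepList (Γ : SimpleGraph ℕ) (X : List ℕ) (t : ℕ) (I : List ℕ) : Prop where
  nodup : I.Nodup
  length_eq : I.length = t
  subset : I ⊆ X
  not_adj : ∀ u ∈ I, ∀ v ∈ I, ¬ Γ.Adj u v

/-- Every vertex of `I` can be combined with every vertex of `J` in an independent set. -/
def Apart (Γ : SimpleGraph ℕ) (I J : List ℕ) : Prop :=
  ∀ u ∈ I, ∀ v ∈ J, v ≠ u ∧ ¬ Γ.Adj u v

theorem Apart.symm (h : Apart Γ I J) : Apart Γ J I :=
  fun u hu v hv => ⟨(h v hv u hu).1.symm, fun huv => (h v hv u hu).2 huv.symm⟩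

theorem Apart.mono_right (h : Apart Γ I J) {J' : List ℕ} (hJ : J' ⊆ J) : Apart Γ I J' :=
  fun u hu v hv => h u hu v (hJ hv)

theorem Apart.append_left {I' : List ℕ} (h : Apart Γ I J) (h' : Apart Γ I' J) :
    Apart Γ (I ++ I') J :=
  fun u hu => (List.mem_append.1 hu).elim (h u) (h' u)

namespace IsIndepList

theorem nil : IsIndepList Γ X 0 [] := ⟨by simp, by simp, by simp, by simp⟩

theorem singleton (hu : u ∈ X) : IsIndepList Γ X 1 [u] :=
  ⟨by simp, by simp, by simpa using hu, by simp⟩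

theorem mono (h : IsIndepList Γ X t I) (hXY : X ⊆ Y) : IsIndepList Γ Y t I :=
  ⟨h.nodup, h.length_eq, List.Subset.trans h.subset hXY, h.not_adj⟩

theorem of_sublist (h : IsIndepList Γ X t I) (hJ : J.Sublist I) (hJY : J ⊆ Y) :
    IsIndepList Γ Y J.length J :=
  ⟨hJ.nodup h.nodup, rfl, hJY, fun u hu v hv => h.not_adj u (hJ.subset hu) v (hJ.subset hv)⟩

theorem append (hI : IsIndepList Γ X s I) (hJ : IsIndepList Γ X t J) (hIJ : Apart Γ I J) :
    IsIndepList Γ X (s + t) (I ++ J) where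
  nodup := List.nodup_append'.2 ⟨hI.nodup, hJ.nodup, fun u hu hu' => (hIJ u hu u hu').1 rfl⟩
  length_eq := by rw [List.length_append, hI.length_eq, hJ.length_eq]
  subset := List.append_subset.2 ⟨hI.subset, hJ.subset⟩
  not_adj u hu v hv := by
    rcases List.mem_append.1 hu with hu | hu <;> rcases List.mem_append.1 hv with hv | hv
    · exact hI.not_adj u hu v hv
    · exact (hIJ u hu v hv).2
    · exact (hIJ.symm u hu v hv).2
    · exact hJ.not_adj u hu v hv

end IsIndepList

/-- `r` is a correct answer to the problem of finding an independent set of size `t` in `X`. -/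
structure IsAnswer (Γ : SimpleGraph ℕ) (X : List ℕ) (t : ℕ) (r : Option (List ℕ)) : Prop where
  sound : ∀ I, r = some I → IsIndepList Γ X t I
  complete : r = none → ∀ I, ¬ IsIndepList Γ X t I

theorem IsAnswer.pos_of_none (h : IsAnswer Γ X t none) : 0 < t := by
  rcases Nat.eq_zero_or_pos t with rfl | ht
  · exact absurd .nil (h.complete rfl _)
  · exact ht

end IndepLists

section Membership

/-- `M` is an adjacency matrix of `Γ`; vertices out of range are isolated. -/
def IsAdjMatrix (M : List (List Bool)) (Γ : SimpleGraph ℕ) : Prop :=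
  ∀ u v, entry M u v = true ↔ Γ.Adj u v

variable {M : List (List Bool)} {Γ : SimpleGraph ℕ} {u w r : ℕ} {l S I : List ℕ}
  {P Q : List (List ℕ)} {T : Parts} {s : SearchState}

theorem mem_nonneighbors (hM : IsAdjMatrix M Γ) :
    w ∈ nonneighbors M u l ↔ w ∈ l ∧ ¬ Γ.Adj u w := by
  rw [nonneighbors, List.mem_filter, ← hM u w, decide_eq_true_eq]

theorem mem_awayFrom (hM : IsAdjMatrix M Γ) :
    w ∈ awayFrom M u l ↔ w ∈ l ∧ ¬ Γ.Adj u w ∧ w ≠ u := by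
  rw [awayFrom, List.mem_filter, ← hM u w, decide_eq_true_eq]

theorem mem_avoiding : u ∈ avoiding l P ↔ u ∈ l ∧ u ∉ P.flatten := by
  rw [avoiding, List.mem_filter, decide_eq_true_eq]

theorem noEdgeBetween_iff (hM : IsAdjMatrix M Γ) {p q : List ℕ} :
    NoEdgeBetween M p q ↔ ∀ u ∈ p, ∀ v ∈ q, ¬ Γ.Adj u v := by
  simp only [NoEdgeBetween, hM _ _]

theorem mem_joinedSets (hM : IsAdjMatrix M Γ) : I ∈ joinedSets M S P Q ↔
    ∃ p ∈ P, ∃ q ∈ Q, (∀ u ∈ p, ∀ v ∈ q, ¬ Γ.Adj u v) ∧ S ++ p ++ q = I := by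
  simp only [joinedSets, List.mem_flatMap, List.mem_map, List.mem_filter, decide_eq_true_eq,
    noEdgeBetween_iff hM, and_assoc]

theorem mem_initialStates :
    s ∈ initialStates T S r ↔ ∃ i ≤ r, s = ⟨T, S, i, r - i, [], []⟩ := by
  simp only [initialStates, List.mem_map, List.mem_range, Nat.lt_succ_iff, eq_comm (a := s)]

theorem length_initialStates : (initialStates T S r).length = r + 1 := by
  rw [initialStates, List.length_map, List.length_range]

end Membership

namespace Parts

/-- All vertices of a tripartition. -/
def vertices (T : Parts) : List ℕ := T.A ++ T.B ++ T.R

/-- `T'` arises from `T` by deleting vertices. -/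
structure Refines (T' T : Parts) : Prop where
  A : T'.A.Sublist T.A
  B : T'.B.Sublist T.B
  R : T'.R.Sublist T.R

variable {T T' T'' : Parts} {M : List (List Bool)} {Γ : SimpleGraph ℕ} {u v : ℕ}

theorem mem_vertices : v ∈ T.vertices ↔ v ∈ T.A ∨ v ∈ T.B ∨ v ∈ T.R := by
  simp only [vertices, List.mem_append, or_assoc]

theorem A_subset_vertices : T.A ⊆ T.vertices := fun _ hv => mem_vertices.2 (Or.inl hv)

theorem B_subset_vertices : T.B ⊆ T.vertices := fun _ hv => mem_vertices.2 (Or.inr (Or.inl hv))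

theorem R_subset_vertices : T.R ⊆ T.vertices := fun _ hv => mem_vertices.2 (Or.inr (Or.inr hv))

theorem Refines.refl (T : Parts) : T.Refines T := ⟨.refl _, .refl _, .refl _⟩

theorem Refines.trans (h : T''.Refines T') (h' : T'.Refines T) : T''.Refines T :=
  ⟨h.A.trans h'.A, h.B.trans h'.B, h.R.trans h'.R⟩

theorem Refines.subset (h : T'.Refines T) : T'.vertices ⊆ T.vertices := fun _ hv =>
  mem_vertices.2 ((mem_vertices.1 hv).imp (h.A.subset ·) (Or.imp (h.B.subset ·) (h.R.subset ·)))

theorem awayFrom_refines : (T.awayFrom M u).Refines T :=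
  ⟨List.filter_sublist, List.filter_sublist, List.filter_sublist⟩

theorem mem_vertices_awayFrom (hM : IsAdjMatrix M Γ) :
    v ∈ (T.awayFrom M u).vertices ↔ v ∈ T.vertices ∧ ¬ Γ.Adj u v ∧ v ≠ u := by
  simp only [mem_vertices, awayFrom, mem_awayFrom hM, or_and_right]

end Parts

section JoinedFamilies

variable {Γ : SimpleGraph ℕ} {A B A' B' : List ℕ} {i j : ℕ} {P Q : List (List ℕ)}

/-- `P` and `Q` consist of equally many disjoint independent `i`-sets in `A` and `j`-sets in `B`,
with an edge between any set of `P` and any set of `Q`. -/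
structure AreJoinedFamilies (Γ : SimpleGraph ℕ) (A B : List ℕ) (i j : ℕ) (P Q : List (List ℕ)) :
    Prop where
  left : ∀ p ∈ P, IsIndepList Γ A i p
  right : ∀ q ∈ Q, IsIndepList Γ B j q
  disjoint_left : P.Pairwise List.Disjoint
  disjoint_right : Q.Pairwise List.Disjoint
  length_eq : P.length = Q.length
  edge : ∀ p ∈ P, ∀ q ∈ Q, ∃ u ∈ p, ∃ v ∈ q, Γ.Adj u v

/-- Joined families of sets of size at most `k` in `A` and `B` have at most `m` members. -/
def JoinedFamilyBound (Γ : SimpleGraph ℕ) (A B : List ℕ) (k m : ℕ) : Prop :=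
  ∀ (i j : ℕ) (P Q : List (List ℕ)), i ≤ k → j ≤ k → AreJoinedFamilies Γ A B i j P Q → P.length ≤ m

theorem AreJoinedFamilies.nil : AreJoinedFamilies Γ A B i j [] [] :=
  ⟨by simp, by simp, .nil, .nil, rfl, by simp⟩

theorem AreJoinedFamilies.mono (h : AreJoinedFamilies Γ A B i j P Q) (hA : A ⊆ A') (hB : B ⊆ B') :
    AreJoinedFamilies Γ A' B' i j P Q :=
  { h with
    left := fun p hp => (h.left p hp).mono hA
    right := fun q hq => (h.right q hq).mono hB }

theorem IsIndepList.of_avoiding {X p : List ℕ} (hp : IsIndepList Γ (avoiding X P) i p) :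
    IsIndepList Γ X i p :=
  hp.mono (List.filter_subset_self _)

theorem pairwise_disjoint_cons_of_avoiding {X p : List ℕ}
    (hp : IsIndepList Γ (avoiding X P) i p) (hP : P.Pairwise List.Disjoint) :
    (p :: P).Pairwise List.Disjoint :=
  List.pairwise_cons.2 ⟨fun _ hp' _ hu hu' =>
    (mem_avoiding.1 (hp.subset hu)).2 (List.mem_flatten.2 ⟨_, hp', hu'⟩), hP⟩

theorem AreJoinedFamilies.cons (h : AreJoinedFamilies Γ A B i j P Q) {p q : List ℕ}
    (hp : IsIndepList Γ (avoiding A P) i p) (hq : IsIndepList Γ (avoiding B Q) j q)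
    (hedge : ∀ p' ∈ p :: P, ∀ q' ∈ q :: Q, ∃ u ∈ p', ∃ v ∈ q', Γ.Adj u v) :
    AreJoinedFamilies Γ A B i j (p :: P) (q :: Q) where
  left := List.forall_mem_cons.2 ⟨hp.of_avoiding, h.left⟩
  right := List.forall_mem_cons.2 ⟨hq.of_avoiding, h.right⟩
  disjoint_left := pairwise_disjoint_cons_of_avoiding hp h.disjoint_left
  disjoint_right := pairwise_disjoint_cons_of_avoiding hq h.disjoint_right
  length_eq := by rw [List.length_cons, List.length_cons, h.length_eq]
  edge := hedge

end JoinedFamilies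

namespace SearchState

variable {M : List (List Bool)} {Γ : SimpleGraph ℕ} {T : Parts} {t : ℕ} {s : SearchState}
  {I : List ℕ} {rA rB : Option (List ℕ)}

/-- The state `s` is consistent with the search for an independent set of size `t` in `T`. -/
structure Valid (Γ : SimpleGraph ℕ) (T : Parts) (t : ℕ) (s : SearchState) : Prop where
  refines : s.toParts.Refines T
  isIndepList : IsIndepList Γ T.vertices s.S.length s.S
  apart : Apart Γ s.S s.toParts.vertices
  size : s.S.length + (s.i + s.j) = t
  families : AreJoinedFamilies Γ s.A s.B s.i s.j s.P s.Q

/-- `I` completes the partial solution of `s`, and the search from `s` on has to find it or some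
other completion. A set that meets `R` is the responsibility of every state, whatever `i` is. -/
structure Covers (Γ : SimpleGraph ℕ) (s : SearchState) (I : List ℕ) : Prop where
  isIndepList : IsIndepList Γ s.toParts.vertices (s.i + s.j) I
  meets_R_or : (∃ u ∈ I, u ∈ s.R) ∨
    (I.filter (· ∈ s.A)).length = s.i ∧ (I.filter (· ∈ s.B)).length = s.j

theorem valid_of_mem_initialStates {T' : Parts} {S : List ℕ} {r : ℕ} (hT : T'.Refines T)
    (hS : IsIndepList Γ T.vertices S.length S) (hST : Apart Γ S T'.vertices)
    (hr : S.length + r = t) (hs : s ∈ initialStates T' S r) : s.Valid Γ T t := by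
  obtain ⟨i, hi, rfl⟩ := mem_initialStates.1 hs
  exact ⟨hT, hS, hST, by simpa only [Nat.add_sub_cancel' hi] using hr, .nil⟩

theorem exists_covers_initialStates {S : List ℕ} {r : ℕ} (hAB : List.Disjoint T.A T.B)
    (hI : IsIndepList Γ T.vertices r I) : ∃ s ∈ initialStates T S r, s.Covers Γ I := by
  by_cases hR : ∃ u ∈ I, u ∈ T.R
  · exact ⟨_, mem_initialStates.2 ⟨0, Nat.zero_le _, rfl⟩, by simpa using hI, Or.inl hR⟩
  have hle : (I.filter (· ∈ T.A)).length ≤ r := hI.length_eq ▸ List.length_filter_le _ _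
  have hB : I.filter (· ∈ T.B) = I.filter fun u => !decide (u ∈ T.A) := by
    refine List.filter_congr fun u hu => ?_
    have huT := Parts.mem_vertices.1 (hI.subset hu)
    have huR : u ∉ T.R := fun h => hR ⟨u, hu, h⟩
    have := @hAB u
    by_cases huA : u ∈ T.A <;> by_cases huB : u ∈ T.B <;> simp_all
  have hsplit := List.length_eq_length_filter_add (l := I) (fun u => decide (u ∈ T.A))
  refine ⟨_, mem_initialStates.2 ⟨_, hle, rfl⟩, by simpa only [Nat.add_sub_cancel' hle] using hI,
    Or.inr ⟨rfl, ?_⟩⟩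
  have := hI.length_eq
  simp only [hB]
  omega

theorem exists_mem_flatten_of_no_avoiding {X L : List ℕ} {P : List (List ℕ)} {i r : ℕ}
    (hI : IsIndepList Γ X r I) (hi : (I.filter (· ∈ L)).length = i)
    (hno : ∀ J, ¬ IsIndepList Γ (avoiding L P) i J) : ∃ u ∈ I, u ∈ P.flatten := by
  by_contra! hcon
  refine hno (I.filter (· ∈ L)) (hi ▸ hI.of_sublist List.filter_sublist fun v hv => ?_)
  rw [List.mem_filter, decide_eq_true_eq] at hv
  exact mem_avoiding.2 ⟨hv.2, hcon v hv.1⟩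

namespace Valid

theorem pool_subset_vertices (h : s.Valid Γ T t) :
    s.P.flatten ++ s.Q.flatten ++ s.R ⊆ s.toParts.vertices := by
  have hP : s.P.flatten ⊆ s.A := fun u hu =>
    let ⟨p, hp, hup⟩ := List.mem_flatten.1 hu
    (h.families.left p hp).subset hup
  have hQ : s.Q.flatten ⊆ s.B := fun u hu =>
    let ⟨q, hq, huq⟩ := List.mem_flatten.1 hu
    (h.families.right q hq).subset huq
  exact List.append_subset.2 ⟨List.append_subset.2 ⟨List.Subset.trans hP Parts.A_subset_vertices,
    List.Subset.trans hQ Parts.B_subset_vertices⟩, Parts.R_subset_vertices⟩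

theorem of_mem_children (h : s.Valid Γ T t) (hM : IsAdjMatrix M Γ) (hpos : 0 < s.i + s.j)
    {s' : SearchState} (hs' : s' ∈ s.children M) : s'.Valid Γ T t := by
  obtain ⟨u, hu, hs'⟩ := List.mem_flatMap.1 hs'
  have hus := h.pool_subset_vertices hu
  have hSu : Apart Γ [u] s.S := (h.apart.mono_right (by simpa using hus)).symm
  have hS : IsIndepList Γ T.vertices (1 + s.S.length) (u :: s.S) :=
    (IsIndepList.singleton (h.refines.subset hus)).append h.isIndepList hSu
  refine valid_of_mem_initialStates (Parts.awayFrom_refines.trans h.refines)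
    (by rwa [List.length_cons, Nat.add_comm]) ?_ ?_ hs'
  · have hu' : Apart Γ [u] (s.toParts.awayFrom M u).vertices := fun x hx v hv => by
      obtain rfl := List.mem_singleton.1 hx
      obtain ⟨-, hadj, hne⟩ := (Parts.mem_vertices_awayFrom hM).1 hv
      exact ⟨hne, hadj⟩
    exact hu'.append_left (h.apart.mono_right Parts.awayFrom_refines.subset)
  · have := h.size
    rw [List.length_cons]
    omega

theorem exists_covers_children (h : s.Valid Γ T t) (hM : IsAdjMatrix M Γ)
    (hAB : List.Disjoint T.A T.B)
    (hno : (∀ J, ¬ IsIndepList Γ (avoiding s.A s.P) s.i J) ∨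
      ∀ J, ¬ IsIndepList Γ (avoiding s.B s.Q) s.j J)
    (hI : s.Covers Γ I) : ∃ s' ∈ s.children M, ∃ I', s'.Covers Γ I' := by
  obtain ⟨u, huI, hu⟩ : ∃ u ∈ I, u ∈ s.P.flatten ++ s.Q.flatten ++ s.R := by
    simp only [List.mem_append]
    rcases hI.meets_R_or with ⟨u, hu, huR⟩ | ⟨hi, hj⟩
    · exact ⟨u, hu, Or.inr huR⟩
    · rcases hno with hno | hno
      · obtain ⟨u, hu, hu'⟩ := exists_mem_flatten_of_no_avoiding hI.isIndepList hi hno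
        exact ⟨u, hu, Or.inl (Or.inl hu')⟩
      · obtain ⟨u, hu, hu'⟩ := exists_mem_flatten_of_no_avoiding hI.isIndepList hj hno
        exact ⟨u, hu, Or.inl (Or.inr hu')⟩
  have herase : IsIndepList Γ (s.toParts.awayFrom M u).vertices (s.i + s.j - 1) (I.erase u) := by
    have hlen : (I.erase u).length = s.i + s.j - 1 := by
      rw [List.length_erase_of_mem huI, hI.isIndepList.length_eq]
    refine hlen ▸ hI.isIndepList.of_sublist List.erase_sublist fun v hv => ?_
    obtain ⟨hne, hvI⟩ := hI.isIndepList.nodup.mem_erase_iff.1 hv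
    exact (Parts.mem_vertices_awayFrom hM).2
      ⟨hI.isIndepList.subset hvI, hI.isIndepList.not_adj u huI v hvI, hne⟩
  have href := (Parts.awayFrom_refines (M := M) (u := u)).trans h.refines
  obtain ⟨s', hs', hc⟩ := exists_covers_initialStates (S := u :: s.S)
    (fun v hv hv' => hAB (href.A.subset hv) (href.B.subset hv')) herase
  exact ⟨s', List.mem_flatMap.2 ⟨u, hu, hs'⟩, _, hc⟩

theorem isIndepList_of_mem_joinedSets (h : s.Valid Γ T t) (hM : IsAdjMatrix M Γ)
    (hAB : List.Disjoint T.A T.B) {P Q : List (List ℕ)} (hP : ∀ p ∈ P, IsIndepList Γ s.A s.i p)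
    (hQ : ∀ q ∈ Q, IsIndepList Γ s.B s.j q) (hI : I ∈ joinedSets M s.S P Q) :
    IsIndepList Γ T.vertices t I := by
  obtain ⟨p, hp, q, hq, hpq, rfl⟩ := (mem_joinedSets hM).1 hI
  have hp' := (hP p hp).mono Parts.A_subset_vertices
  have hq' := (hQ q hq).mono Parts.B_subset_vertices
  have hpq' : Apart Γ p q := fun u hu v hv =>
    ⟨fun huv => hAB (h.refines.A.subset ((hP p hp).subset hu))
      (h.refines.B.subset ((hQ q hq).subset (huv ▸ hv))), hpq u hu v hv⟩
  have := (h.isIndepList.append (hp'.mono h.refines.subset) (h.apart.mono_right hp'.subset)).append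
    (hq'.mono h.refines.subset) ((h.apart.mono_right hq'.subset).append_left hpq')
  rwa [Nat.add_assoc, h.size] at this

theorem isIndepList_of_immediateAnswer (h : s.Valid Γ T t) (hM : IsAdjMatrix M Γ)
    (hAB : List.Disjoint T.A T.B) (hA : IsAnswer Γ (avoiding s.A s.P) s.i rA)
    (hB : IsAnswer Γ (avoiding s.B s.Q) s.j rB) (hI : s.immediateAnswer M rA rB = some I) :
    IsIndepList Γ T.vertices t I := by
  refine h.isIndepList_of_mem_joinedSets hM hAB (fun p hp => ?_) (fun q hq => ?_)
    (List.mem_of_mem_head? hI)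
  · exact (List.mem_append.1 hp).elim
      (fun hp => (hA.sound p (Option.mem_toList.1 hp)).of_avoiding) (h.families.left p)
  · exact (List.mem_append.1 hq).elim
      (fun hq => (hB.sound q (Option.mem_toList.1 hq)).of_avoiding) (h.families.right q)

theorem extend (h : s.Valid Γ T t) (hM : IsAdjMatrix M Γ) {p q : List ℕ}
    (hp : IsIndepList Γ (avoiding s.A s.P) s.i p) (hq : IsIndepList Γ (avoiding s.B s.Q) s.j q)
    (hnone : s.immediateAnswer M (some p) (some q) = none) : (s.extend p q).Valid Γ T t := by
  refine ⟨h.refines, h.isIndepList, h.apart, h.size, h.families.cons hp hq fun p' hp' q' hq' => ?_⟩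
  by_contra! hcon
  have hmem : s.S ++ p' ++ q' ∈ joinedSets M s.S (p :: s.P) (q :: s.Q) :=
    (mem_joinedSets hM).2 ⟨p', hp', q', hq', hcon, rfl⟩
  have hempty : joinedSets M s.S (p :: s.P) (q :: s.Q) = [] := List.head?_eq_none_iff.1 hnone
  simp [hempty] at hmem

end Valid

theorem next_some_some {p q : List ℕ} : s.next M (some p) (some q) = [s.extend p q] := rfl

theorem next_of_eq_none (h : rA = none ∨ rB = none) : s.next M rA rB = s.children M := by
  rcases h with rfl | rfl <;> simp [next]

theorem some_some_or_eq_none :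
    (∃ p q, rA = some p ∧ rB = some q) ∨ rA = none ∨ rB = none := by
  cases rA <;> cases rB <;> simp

theorem pos_of_eq_none (hA : IsAnswer Γ (avoiding s.A s.P) s.i rA)
    (hB : IsAnswer Γ (avoiding s.B s.Q) s.j rB) (h : rA = none ∨ rB = none) : 0 < s.i + s.j := by
  rcases h with rfl | rfl
  · exact Nat.add_pos_left hA.pos_of_none _
  · exact Nat.add_pos_right _ hB.pos_of_none

theorem Valid.of_mem_next (h : s.Valid Γ T t) (hM : IsAdjMatrix M Γ)
    (hA : IsAnswer Γ (avoiding s.A s.P) s.i rA) (hB : IsAnswer Γ (avoiding s.B s.Q) s.j rB)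
    (hnone : s.immediateAnswer M rA rB = none) {s' : SearchState} (hs' : s' ∈ s.next M rA rB) :
    s'.Valid Γ T t := by
  rcases some_some_or_eq_none (rA := rA) (rB := rB) with ⟨p, q, rfl, rfl⟩ | hr
  · rw [next_some_some, List.mem_singleton] at hs'
    exact hs' ▸ h.extend hM (hA.sound p rfl) (hB.sound q rfl) hnone
  · rw [next_of_eq_none hr] at hs'
    exact h.of_mem_children hM (pos_of_eq_none hA hB hr) hs'

theorem Valid.exists_covers_next (h : s.Valid Γ T t) (hM : IsAdjMatrix M Γ)
    (hAB : List.Disjoint T.A T.B) (hA : IsAnswer Γ (avoiding s.A s.P) s.i rA)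
    (hB : IsAnswer Γ (avoiding s.B s.Q) s.j rB) (hI : s.Covers Γ I) :
    ∃ s' ∈ s.next M rA rB, ∃ I', s'.Covers Γ I' := by
  rcases some_some_or_eq_none (rA := rA) (rB := rB) with ⟨p, q, rfl, rfl⟩ | hr
  · exact ⟨s.extend p q, List.mem_singleton_self _, I, hI.isIndepList, hI.meets_R_or⟩
  · rw [next_of_eq_none hr]
    exact h.exists_covers_children hM hAB (hr.imp hA.complete hB.complete) hI

end SearchState

/-- The data of a tripartition that bound the search in it, for targets up to `k`. -/
structure Parts.IsSearchable (Γ : SimpleGraph ℕ) (k m g : ℕ) (T : Parts) : Prop where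
  nodup_A : T.A.Nodup
  nodup_B : T.B.Nodup
  disjoint : List.Disjoint T.A T.B
  length_R_le : T.R.length ≤ g
  familyBound : JoinedFamilyBound Γ T.A T.B k m

/-- A number `K` such that the search branches at most `K / (m + 1)` times at once: there are at
most `2 * m * k + g` vertices to branch on, and at most `k` initial states for each of them. -/
def branchingBound (k m g : ℕ) : ℕ := (2 * m * k + g) * k * (m + 1) + 1

namespace SearchState

/-- An upper bound for the number of states explored from `s` on: either a further pair of sets is
recorded, or `i + j` drops. -/
def weight (k m g : ℕ) (s : SearchState) : ℕ :=
  (m - s.P.length) + branchingBound k m g ^ (s.i + s.j)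

variable {M : List (List Bool)} {Γ : SimpleGraph ℕ} {T : Parts} {t k m g : ℕ} {s : SearchState}
  {rA rB : Option (List ℕ)}

theorem one_le_branchingBound_pow (n : ℕ) : 1 ≤ branchingBound k m g ^ n :=
  Nat.one_le_pow _ _ (Nat.succ_pos _)

theorem length_flatten_le {l : List (List ℕ)} (h : ∀ p ∈ l, p.length ≤ k) :
    l.flatten.length ≤ l.length * k := by
  rw [List.length_flatten]
  simpa using List.sum_le_card_nsmul (l.map List.length) k (by simpa using h)

theorem Valid.length_P_le (h : s.Valid Γ T t) (hT : T.IsSearchable Γ k m g) (ht : t ≤ k) :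
    s.P.length ≤ m :=
  have hsize := h.size
  hT.familyBound s.i s.j s.P s.Q (by omega) (by omega)
    (h.families.mono h.refines.A.subset h.refines.B.subset)

theorem Valid.length_pool_le (h : s.Valid Γ T t) (hT : T.IsSearchable Γ k m g) (ht : t ≤ k) :
    (s.P.flatten ++ s.Q.flatten ++ s.R).length ≤ 2 * m * k + g := by
  have hsize := h.size
  have hP := length_flatten_le (k := k) fun p hp =>
    (h.families.left p hp).length_eq.trans_le (by omega)
  have hQ := length_flatten_le (k := k) fun q hq =>
    (h.families.right q hq).length_eq.trans_le (by omega)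
  have hm := Nat.mul_le_mul_right k (h.length_P_le hT ht)
  have hR := h.refines.R.length_le.trans hT.length_R_le
  rw [← h.families.length_eq] at hQ
  rw [List.length_append, List.length_append]
  linarith

theorem Valid.length_children_le (h : s.Valid Γ T t) (hT : T.IsSearchable Γ k m g) (ht : t ≤ k)
    (hpos : 0 < s.i + s.j) : (s.children M).length ≤ (2 * m * k + g) * k := by
  have hsize := h.size
  simp only [children, List.length_flatMap, length_initialStates, List.map_const',
    List.sum_replicate, smul_eq_mul]
  exact Nat.mul_le_mul (h.length_pool_le hT ht) (by omega)

theorem weight_initialStates {S : List ℕ} {r : ℕ} (hs : s ∈ initialStates T S r) :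
    s.weight k m g = m + branchingBound k m g ^ r := by
  obtain ⟨i, hi, rfl⟩ := mem_initialStates.1 hs
  simp [weight, Nat.add_sub_cancel' hi]

theorem Valid.sum_weight_children_lt (h : s.Valid Γ T t) (hT : T.IsSearchable Γ k m g)
    (ht : t ≤ k) (hpos : 0 < s.i + s.j) :
    ((s.children M).map (weight k m g)).sum < s.weight k m g := by
  obtain ⟨r, hr⟩ : ∃ r, s.i + s.j = r + 1 := Nat.exists_eq_succ_of_ne_zero hpos.ne'
  have hweight : ∀ w ∈ (s.children M).map (weight k m g), w ≤ m + branchingBound k m g ^ r := by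
    intro w hw
    obtain ⟨s', hs', rfl⟩ := List.mem_map.1 hw
    obtain ⟨u, -, hs'⟩ := List.mem_flatMap.1 hs'
    rw [weight_initialStates hs', hr, Nat.add_sub_cancel]
  have hsum := List.sum_le_card_nsmul _ _ hweight
  rw [List.length_map, smul_eq_mul] at hsum
  have hone := one_le_branchingBound_pow (k := k) (m := m) (g := g) r
  calc ((s.children M).map (weight k m g)).sum
      ≤ (2 * m * k + g) * k * (m + branchingBound k m g ^ r) :=
        hsum.trans (Nat.mul_le_mul_right _ (h.length_children_le hT ht hpos))
    _ ≤ (2 * m * k + g) * k * ((m + 1) * branchingBound k m g ^ r) := by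
        gcongr
        nlinarith
    _ < (2 * m * k + g) * k * ((m + 1) * branchingBound k m g ^ r) + branchingBound k m g ^ r :=
        Nat.lt_add_of_pos_right hone
    _ = branchingBound k m g ^ (s.i + s.j) := by
        rw [hr, pow_succ']
        nth_rw 3 [branchingBound]
        ring
    _ ≤ s.weight k m g := Nat.le_add_left _ _

theorem Valid.sum_weight_next_lt (h : s.Valid Γ T t) (hT : T.IsSearchable Γ k m g)
    (hM : IsAdjMatrix M Γ) (ht : t ≤ k) (hA : IsAnswer Γ (avoiding s.A s.P) s.i rA)
    (hB : IsAnswer Γ (avoiding s.B s.Q) s.j rB) (hnone : s.immediateAnswer M rA rB = none) :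
    ((s.next M rA rB).map (weight k m g)).sum < s.weight k m g := by
  rcases some_some_or_eq_none (rA := rA) (rB := rB) with ⟨p, q, rfl, rfl⟩ | hr
  · have hlen := (h.extend hM (hA.sound p rfl) (hB.sound q rfl) hnone).length_P_le hT ht
    simp only [next_some_some, List.map_singleton, List.sum_singleton, weight,
      SearchState.extend, List.length_cons] at hlen ⊢
    omega
  · rw [next_of_eq_none hr]
    exact h.sum_weight_children_lt hT ht (pos_of_eq_none hA hB hr)

end SearchState

section Search

variable {O : Oracle} {q : Prog} {inst : Instance} {Γ : SimpleGraph ℕ} {T : Parts}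
  {X : List ℕ} {t k m g τ c : ℕ} {s : SearchState} {l : List SearchState}
  {r rA rB rN rR : Option (List ℕ)}

/-- Within `τ` steps the solver correctly answers the problem of finding an independent set of
size `t` in `X`. -/
def Answers (O : Oracle) (q : Prog) (inst : Instance) (Γ : SimpleGraph ℕ) (X : List ℕ)
    (t τ : ℕ) : Prop :=
  ∃ r, Solves O q (.inl ⟨inst, X, t⟩) r τ ∧ IsAnswer Γ X t r

theorem Answers.mono (h : Answers O q inst Γ X t τ) {τ' : ℕ} (hτ : τ ≤ τ') :
    Answers O q inst Γ X t τ' :=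
  let ⟨r, hr, hans⟩ := h
  ⟨r, hr.mono hτ, hans⟩

/-- Within `τ` steps the solver answers every problem of the tripartition `T` that a search state
with target at most `t` poses. -/
def AnswersQueries (O : Oracle) (q : Prog) (inst : Instance) (Γ : SimpleGraph ℕ) (T : Parts)
    (t τ : ℕ) : Prop :=
  ∀ (Y : List ℕ) (t' : ℕ), Y.Nodup → (Y ⊆ T.A ∨ Y ⊆ T.B) → t' ≤ t → Answers O q inst Γ Y t' τ

theorem AnswersQueries.queryA (h : AnswersQueries O q inst Γ T t τ) (hA : T.A.Nodup)
    (hs : s.Valid Γ T t) : Answers O q inst Γ (avoiding s.A s.P) s.i τ :=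
  have hsize := hs.size
  h _ _ ((hs.refines.A.nodup hA).filter _)
    (Or.inl (List.Subset.trans (List.filter_subset_self _) hs.refines.A.subset)) (by omega)

theorem AnswersQueries.queryB (h : AnswersQueries O q inst Γ T t τ) (hB : T.B.Nodup)
    (hs : s.Valid Γ T t) : Answers O q inst Γ (avoiding s.B s.Q) s.j τ :=
  have hsize := hs.size
  h _ _ ((hs.refines.B.nodup hB).filter _)
    (Or.inr (List.Subset.trans (List.filter_subset_self _) hs.refines.B.subset)) (by omega)

/-- Within `τ` steps the search from the states `l` on returns `r`: an independent set of size `t`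
in `T`, or nothing if there is no such set for the states to find. -/
structure SearchReturns (O : Oracle) (q : Prog) (inst : Instance) (Γ : SimpleGraph ℕ) (T : Parts)
    (t : ℕ) (l : List SearchState) (r : Option (List ℕ)) (τ : ℕ) : Prop where
  solves : Solves O q (.inr (inst, l)) r τ
  sound : ∀ I, r = some I → IsIndepList Γ T.vertices t I
  complete : r = none → ∀ s ∈ l, ∀ I, ¬ s.Covers Γ I

theorem SearchReturns.cons (hM : IsAdjMatrix inst.1 Γ) (hT : List.Disjoint T.A T.B)
    (hs : s.Valid Γ T t) {τA τB τN τR : ℕ}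
    (hevA : Solves O q (.inl (s.queryA inst)) rA τA)
    (hA : IsAnswer Γ (avoiding s.A s.P) s.i rA)
    (hevB : Solves O q (.inl (s.queryB inst)) rB τB)
    (hB : IsAnswer Γ (avoiding s.B s.Q) s.j rB)
    (hN : s.immediateAnswer inst.1 rA rB = none →
      SearchReturns O q inst Γ T t (s.next inst.1 rA rB) rN τN)
    (hR : SearchReturns O q inst Γ T t l rR τR) :
    SearchReturns O q inst Γ T t (s :: l) ((s.immediateAnswer inst.1 rA rB).or (rN.or rR))
      (τA + τB + τN + τR + overhead (codeSize ((inst, s), rA, rB))) where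
  solves := Solves.search_cons hevA hevB (fun h => (hN h).solves) fun _ => hR.solves
  sound I hI := by
    rcases hi : s.immediateAnswer inst.1 rA rB with _ | J
    · rw [hi, Option.none_or, Option.or_eq_some_iff] at hI
      exact hI.elim ((hN hi).sound I) fun hI => hR.sound I hI.2
    · rw [hi, Option.some_or] at hI
      exact hs.isIndepList_of_immediateAnswer hM hT hA hB (hi.trans hI)
  complete hr := by
    rw [Option.or_eq_none_iff, Option.or_eq_none_iff] at hr
    refine List.forall_mem_cons.2 ⟨fun I hI => ?_, hR.complete hr.2.2⟩
    obtain ⟨s', hs', I', hI'⟩ := hs.exists_covers_next hM hT hA hB hI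
    exact (hN hr.1).complete hr.2.1 s' hs' I' hI'

theorem exists_searchReturns (hM : IsAdjMatrix inst.1 Γ) (hT : T.IsSearchable Γ k m g)
    (ht : t ≤ k) (hcall : AnswersQueries O q inst Γ T t τ)
    (hc : ∀ (s : SearchState) (rA rB : Option (List ℕ)), s.Valid Γ T t →
      IsAnswer Γ (avoiding s.A s.P) s.i rA → IsAnswer Γ (avoiding s.B s.Q) s.j rB →
      overhead (codeSize ((inst, s), rA, rB)) + 2 * τ + 20 ≤ c)
    (l : List SearchState) (hl : ∀ s ∈ l, s.Valid Γ T t) :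
    ∃ r, SearchReturns O q inst Γ T t l r ((l.map (SearchState.weight k m g)).sum * c + 20) := by
  induction hW : (l.map (SearchState.weight k m g)).sum using Nat.strong_induction_on
    generalizing l with
  | _ W ih =>
    rcases l with _ | ⟨s, rest⟩
    · exact ⟨none, Solves.search_nil.mono (Nat.le_add_left _ _), by simp, by simp⟩
    obtain ⟨hs, hrest⟩ := List.forall_mem_cons.1 hl
    rw [List.map_cons, List.sum_cons] at hW
    have hpos : 1 ≤ s.weight k m g :=
      (SearchState.one_le_branchingBound_pow _).trans (Nat.le_add_left _ _)
    obtain ⟨rA, hevA, hA⟩ := hcall.queryA hT.nodup_A hs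
    obtain ⟨rB, hevB, hB⟩ := hcall.queryB hT.nodup_B hs
    obtain ⟨rR, hR⟩ := ih _ (by omega) rest hrest rfl
    obtain ⟨rN, hN⟩ : ∃ rN, s.immediateAnswer inst.1 rA rB = none →
        SearchReturns O q inst Γ T t (s.next inst.1 rA rB) rN ((s.weight k m g - 1) * c + 20) := by
      by_cases hnone : s.immediateAnswer inst.1 rA rB = none
      · have hlt := hs.sum_weight_next_lt hT hM ht hA hB hnone
        obtain ⟨rN, hN⟩ := ih _ (by omega) (s.next inst.1 rA rB)
          (fun s' => hs.of_mem_next hM hA hB hnone) rfl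
        exact ⟨rN, fun _ => { hN with solves := hN.solves.mono (by gcongr; omega) }⟩
      · exact ⟨none, fun h => absurd h hnone⟩
    have hcons := SearchReturns.cons hM hT.disjoint hs hevA hA hevB hB hN hR
    refine ⟨_, { hcons with solves := hcons.solves.mono ?_ }⟩
    obtain ⟨w, hw⟩ : ∃ w, s.weight k m g = w + 1 := Nat.exists_eq_succ_of_ne_zero (by omega)
    rw [← hW, hw, Nat.add_sub_cancel]
    linarith [hc s rA rB hs hA hB]

end Search

section Tripartitions

variable {M : List (List Bool)} {Γ : SimpleGraph ℕ} {T : Parts} {X L I : List ℕ} {v w : ℕ}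

namespace Parts

/-- `T` is a non-trivial tripartition of the set of vertices listed by `X`. -/
structure IsTripartition (T : Parts) (X : List ℕ) : Prop where
  perm : T.vertices.Perm X
  length_R_lt_A : T.R.length < T.A.length
  length_R_lt_B : T.R.length < T.B.length

/-- Between `A` and `B` at most `d` edges are missing at every vertex, and `R` has at most `g`
vertices. -/
structure IsAlmostBicomplete (M : List (List Bool)) (g d : ℕ) (T : Parts) : Prop where
  length_R_le : T.R.length ≤ g
  nonneighbors_B : ∀ v ∈ T.A, (nonneighbors M v T.B).length ≤ d
  nonneighbors_A : ∀ w ∈ T.B, (nonneighbors M w T.A).length ≤ d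

theorem crossRegion_sublist : (T.crossRegion M v w).Sublist T.vertices :=
  (List.filter_sublist.append List.filter_sublist).append_right _

theorem mem_crossRegion_of_not_adj (hM : IsAdjMatrix M Γ) {u : ℕ} (hu : u ∈ T.vertices)
    (hv : ¬ Γ.Adj v u) (hw : ¬ Γ.Adj w u) : u ∈ T.crossRegion M v w := by
  rw [mem_vertices] at hu
  simp only [crossRegion, List.mem_append, mem_nonneighbors hM]
  tauto

theorem IsAlmostBicomplete.length_crossRegion_le {g d : ℕ} (h : T.IsAlmostBicomplete M g d)
    (hv : v ∈ T.A) (hw : w ∈ T.B) : (T.crossRegion M v w).length ≤ 2 * d + g := by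
  have hB := h.nonneighbors_B v hv
  have hA := h.nonneighbors_A w hw
  have hR := h.length_R_le
  rw [crossRegion, List.length_append, List.length_append]
  omega

namespace IsTripartition

theorem mem_iff (h : T.IsTripartition X) : v ∈ X ↔ v ∈ T.A ∨ v ∈ T.B ∨ v ∈ T.R :=
  h.perm.mem_iff.symm.trans mem_vertices

theorem subset (h : T.IsTripartition X) : T.vertices ⊆ X := h.perm.subset

theorem A_subset (h : T.IsTripartition X) : T.A ⊆ X :=
  List.Subset.trans A_subset_vertices h.subset

theorem B_subset (h : T.IsTripartition X) : T.B ⊆ X :=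
  List.Subset.trans B_subset_vertices h.subset

theorem R_subset (h : T.IsTripartition X) : T.R ⊆ X :=
  List.Subset.trans R_subset_vertices h.subset

theorem length_eq (h : T.IsTripartition X) : X.length = T.A.length + T.B.length + T.R.length := by
  rw [← h.perm.length_eq, vertices, List.length_append, List.length_append]

theorem length_A_lt (h : T.IsTripartition X) : T.A.length < X.length := by
  have := h.length_eq; have := h.length_R_lt_B; omega

theorem length_B_lt (h : T.IsTripartition X) : T.B.length < X.length := by
  have := h.length_eq; have := h.length_R_lt_A; omega

theorem nodup_vertices (h : T.IsTripartition X) (hX : X.Nodup) : T.vertices.Nodup :=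
  h.perm.nodup_iff.2 hX

theorem nodup_A_append_R (h : T.IsTripartition X) (hX : X.Nodup) : (T.A ++ T.R).Nodup :=
  ((List.sublist_append_left _ _).append_right _).nodup (h.nodup_vertices hX)

theorem nodup_B_append_R (h : T.IsTripartition X) (hX : X.Nodup) : (T.B ++ T.R).Nodup :=
  ((List.sublist_append_right _ _).append_right _).nodup (h.nodup_vertices hX)

theorem disjoint (h : T.IsTripartition X) (hX : X.Nodup) : List.Disjoint T.A T.B :=
  (List.nodup_append'.1 (List.nodup_append'.1 (h.nodup_vertices hX)).1).2.2

end IsTripartition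

end Parts

end Tripartitions

section CrossAnswer

variable {M : List (List Bool)} {Γ : SimpleGraph ℕ} {Z I J L : List ℕ} {p : Problem} {n t : ℕ}

theorem length_cappedSublists_le_two_pow (Z : List ℕ) (n : ℕ) :
    (cappedSublists Z n).length ≤ 2 ^ Z.length := by
  induction Z with
  | nil => simp [cappedSublists]
  | cons z Z ih =>
    rw [cappedSublists_cons, List.rtake, List.length_drop, List.length_append, List.length_map,
      List.length_cons, pow_succ]
    omega

theorem mem_cappedSublists_of_length_lt (hn : (cappedSublists Z n).length < n)
    (hJ : J.Sublist Z) : J ∈ cappedSublists Z n := by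
  induction Z generalizing J with
  | nil => exact List.mem_singleton.2 (List.sublist_nil.1 hJ)
  | cons z Z ih =>
    rw [cappedSublists_cons, List.rtake] at hn ⊢
    set all := cappedSublists Z n ++ (cappedSublists Z n).map fun s => z :: s with hall
    have huncapped : all.length - n = 0 := by rw [List.length_drop] at hn; omega
    have hlen : (cappedSublists Z n).length < n := by
      rw [huncapped, List.drop_zero, hall, List.length_append] at hn; omega
    rw [huncapped, List.drop_zero, hall, List.mem_append, List.mem_map]
    cases hJ with
    | cons _ hJ => exact Or.inl (ih hlen hJ)
    | cons_cons _ hJ => exact Or.inr ⟨_, ih hlen hJ, rfl⟩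

theorem IsIndepList.perm {X : List ℕ} (h : IsIndepList Γ X t I) (hJ : J.Perm I) :
    IsIndepList Γ X t J where
  nodup := hJ.nodup_iff.2 h.nodup
  length_eq := hJ.length_eq.trans h.length_eq
  subset := List.Subset.trans hJ.subset h.subset
  not_adj u hu v hv := h.not_adj u (hJ.subset hu) v (hJ.subset hv)

theorem isIndepList_of_crossAnswer_eq_some (hM : IsAdjMatrix p.inst.1 Γ)
    (hp : p.vertices.Nodup) (hL : (p.parts L).IsTripartition p.vertices)
    (h : p.crossAnswer L = some I) : IsIndepList Γ p.vertices p.target I := by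
  have hmem := List.mem_of_mem_head? h
  simp only [List.mem_flatMap, List.mem_filter, decide_eq_true_eq, noEdgeBetween_iff hM] at hmem
  obtain ⟨v, -, w, -, hI, hlen, hind⟩ := hmem
  have hsub := (sublist_of_mem_cappedSublists hI).trans Parts.crossRegion_sublist
  exact ⟨hsub.nodup (hL.nodup_vertices hp), hlen, List.Subset.trans hsub.subset hL.subset, hind⟩

theorem crossAnswer_ne_none (hM : IsAdjMatrix p.inst.1 Γ)
    (hL : (p.parts L).IsTripartition p.vertices) (hsmall : p.HasSmallCrossRegions L)
    (hI : IsIndepList Γ p.vertices p.target I) {v w : ℕ} (hv : v ∈ I) (hw : w ∈ I)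
    (hvA : v ∈ (p.parts L).A) (hwB : w ∈ (p.parts L).B) : p.crossAnswer L ≠ none := by
  have hregion : I ⊆ (p.parts L).crossRegion p.inst.1 v w := fun u hu =>
    Parts.mem_crossRegion_of_not_adj hM (hL.perm.mem_iff.2 (hI.subset hu))
      (hI.not_adj v hv u hu) (hI.not_adj w hw u hu)
  obtain ⟨J, hJI, hJ⟩ := List.subperm_of_subset hI.nodup hregion
  have hJind := hI.perm hJI
  refine fun hnone => List.ne_nil_of_mem (a := J) ?_ (List.head?_eq_none_iff.1 hnone)
  simp only [List.mem_flatMap, List.mem_filter, decide_eq_true_eq, noEdgeBetween_iff hM]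
  exact ⟨v, hvA, w, hwB, mem_cappedSublists_of_length_lt (hsmall v hvA w hwB) hJ,
    hJind.length_eq, hJind.not_adj⟩

theorem isAnswer_or_crossAnswer (hM : IsAdjMatrix p.inst.1 Γ) (hp : p.vertices.Nodup)
    (hL : (p.parts L).IsTripartition p.vertices) (hsmall : p.HasSmallCrossRegions L)
    {rA rB : Option (List ℕ)}
    (hA : IsAnswer Γ ((p.parts L).A ++ (p.parts L).R) p.target rA)
    (hB : IsAnswer Γ ((p.parts L).B ++ (p.parts L).R) p.target rB) :
    IsAnswer Γ p.vertices p.target (rA.or (rB.or (p.crossAnswer L))) where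
  sound I hI := by
    rcases rA with _ | J
    · rcases rB with _ | J
      · exact isIndepList_of_crossAnswer_eq_some hM hp hL hI
      · exact (hB.sound I hI).mono (List.append_subset.2 ⟨hL.B_subset, hL.R_subset⟩)
    · exact (hA.sound I hI).mono (List.append_subset.2 ⟨hL.A_subset, hL.R_subset⟩)
  complete hr I hI := by
    rw [Option.or_eq_none_iff, Option.or_eq_none_iff] at hr
    obtain ⟨rfl, rfl, hcross⟩ := hr
    have hmem : ∀ v ∈ I, v ∈ (p.parts L).A ∨ v ∈ (p.parts L).B ∨ v ∈ (p.parts L).R :=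
      fun v hv => hL.mem_iff.1 (hI.subset hv)
    obtain ⟨v, hv, hvA⟩ : ∃ v ∈ I, v ∈ (p.parts L).A := by
      by_contra! hno
      exact hB.complete rfl I ⟨hI.nodup, hI.length_eq,
        fun v hv => List.mem_append.2 ((hmem v hv).resolve_left (hno v hv)), hI.not_adj⟩
    obtain ⟨w, hw, hwB⟩ : ∃ w ∈ I, w ∈ (p.parts L).B := by
      by_contra! hno
      exact hA.complete rfl I ⟨hI.nodup, hI.length_eq, fun v hv => List.mem_append.2
        ((hmem v hv).imp_right (Or.resolve_left · (hno v hv))), hI.not_adj⟩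
    exact crossAnswer_ne_none hM hL hsmall hI hv hw hvA hwB hcross

theorem Parts.IsAlmostBicomplete.hasSmallCrossRegions {g d : ℕ}
    (h : (p.parts L).IsAlmostBicomplete p.inst.1 g d)
    (hp : 2 ^ (2 * d + g) < p.vertices.length) : p.HasSmallCrossRegions L := fun _ hv _ hw =>
  ((length_cappedSublists_le_two_pow _ _).trans
    (Nat.pow_le_pow_right two_pos (h.length_crossRegion_le hv hw))).trans_lt hp

theorem Problem.isAnswer_trivialAnswer (h : p.IsTrivial) :
    IsAnswer Γ p.vertices p.target p.trivialAnswer := by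
  rw [trivialAnswer]
  split_ifs with h0 hlen
  · exact ⟨fun I hI => by rw [← Option.some.inj hI, h0]; exact .nil, by simp⟩
  · obtain ⟨w, hw⟩ : ∃ w, p.vertices = [w] :=
      List.length_eq_one_iff.1 (by have := h.resolve_left h0; omega)
    refine ⟨fun I hI => ?_, by simp⟩
    rw [← Option.some.inj hI, hlen, hw]
    exact .singleton (List.mem_singleton_self w)
  · refine ⟨by simp, fun _ I hI => ?_⟩
    have hle := (List.subperm_of_subset hI.nodup hI.subset).length_le
    have := h.resolve_left h0
    have := hI.length_eq
    omega

end CrossAnswer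

section FamilyBounds

variable {Γ : SimpleGraph ℕ} {A B : List ℕ} {k d m : ℕ} {P Q : List (List ℕ)}

theorem JoinedFamilyBound.of_length_le (hA : A.length ≤ m) : JoinedFamilyBound Γ A B k m := by
  intro i j P Q _ _ h
  rcases Nat.eq_zero_or_pos P.length with h0 | h0
  · omega
  obtain ⟨q, hq⟩ := List.exists_mem_of_length_pos (h.length_eq ▸ h0)
  have hpos : ∀ p ∈ P.map List.length, 1 ≤ p := by
    intro _ hl
    obtain ⟨p, hp, rfl⟩ := List.mem_map.1 hl
    obtain ⟨u, hu, -⟩ := h.edge p hp q hq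
    exact List.length_pos_of_mem hu
  have hnodup : P.flatten.Nodup :=
    List.nodup_flatten.2 ⟨fun p hp => (h.left p hp).nodup, h.disjoint_left⟩
  have hsub : P.flatten ⊆ A := fun v hv =>
    let ⟨p, hp, hvp⟩ := List.mem_flatten.1 hv
    (h.left p hp).subset hvp
  calc P.length ≤ (P.map List.length).sum := by
        simpa using List.card_nsmul_le_sum (P.map List.length) 1 hpos
    _ = P.flatten.length := List.length_flatten.symm
    _ ≤ A.length := (List.subperm_of_subset hnodup hsub).length_le
    _ ≤ m := hA

theorem pairwise_disjoint_toFinset (h : P.Pairwise List.Disjoint) :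
    Pairwise fun x y : Fin P.length => Disjoint (P[x.1]).toFinset (P[y.1]).toFinset := by
  intro x y hxy
  rw [List.disjoint_toFinset_iff_disjoint]
  rw [List.pairwise_iff_getElem] at h
  rcases Nat.lt_or_gt_of_ne (Fin.val_ne_of_ne hxy) with hlt | hlt
  · exact h _ _ x.2 y.2 hlt
  · exact (h _ _ y.2 x.2 hlt).symm

theorem IsIndepList.card_toFinset_le {i : ℕ} {p : List ℕ} (h : IsIndepList Γ A i p) (hi : i ≤ k) :
    p.toFinset.card ≤ k :=
  (List.toFinset_card_le p).trans (h.length_eq.trans_le hi)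

theorem toFinset_subset_toFinset (h : A ⊆ B) : A.toFinset ⊆ B.toFinset :=
  Multiset.toFinset_subset.2 (Multiset.coe_subset.2 h)

theorem JoinedFamilyBound.of_bicliqueFree (hk : 1 ≤ k)
    (hfree : BicliqueFree Γ d A.toFinset B.toFinset) (hm : d * k + d * 2 ^ (d * k * k) ≤ m) :
    JoinedFamilyBound Γ A B k m := by
  intro i j P Q hi hj h
  rcases Nat.lt_or_ge P.length (d * k) with hlt | hge
  · omega
  have hlen : (P.take (d * k)).length = d * k := by rw [List.length_take, min_eq_left hge]
  have hP : ∀ x : Fin (P.take (d * k)).length, (P.take (d * k))[x.1] ∈ P := fun x =>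
    List.mem_of_mem_take (List.getElem_mem _)
  have hQ : ∀ y : Fin Q.length, Q[y.1] ∈ Q := fun y => List.getElem_mem _
  have hcard := hfree.card_le_of_pairwise_joined hk
    (fun x => toFinset_subset_toFinset (h.left _ (hP x)).subset)
    (fun y => toFinset_subset_toFinset (h.right _ (hQ y)).subset)
    (fun x => (h.left _ (hP x)).card_toFinset_le hi)
    (fun y => (h.right _ (hQ y)).card_toFinset_le hj)
    (pairwise_disjoint_toFinset (h.disjoint_left.sublist (List.take_sublist _ _)))
    (pairwise_disjoint_toFinset h.disjoint_right)
    (fun x y => by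
      obtain ⟨u, hu, v, hv, huv⟩ := h.edge _ (hP x) _ (hQ y)
      exact ⟨u, List.mem_toFinset.2 hu, v, List.mem_toFinset.2 hv, huv⟩)
    (by rw [Fintype.card_fin, hlen])
  rw [Fintype.card_fin, ← h.length_eq] at hcard
  omega

end FamilyBounds

section Sizes

variable {inst : Instance} {Γ : SimpleGraph ℕ} {T : Parts} {X Y L l : List ℕ} {k m g n t i : ℕ}
  {s : SearchState} {r rA rB : Option (List ℕ)}

theorem length_le_of_nodup_of_lt (hl : l.Nodup) (hn : ∀ v ∈ l, v < n) : l.length ≤ n := by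
  simpa using (List.subperm_of_subset hl fun v hv => List.mem_range.2 (hn v hv)).length_le

theorem codeSize_vertices_le (hl : l.Nodup) (hn : ∀ v ∈ l, v < n) : codeSize l ≤ n * (n + 1) :=
  (codeSize_list_le fun v hv => (codeSize_nat v).trans_le (hn v hv).le).trans
    (Nat.mul_le_mul_right _ (length_le_of_nodup_of_lt hl hn))

/-- A bound for the size of the arguments of all function calls, where `e` is the size of the
instance, families of at most `m` sets are recorded, and there are `n` vertices. -/
def sizeBound (e k m n : ℕ) : ℕ := e + 2 * k + (2 * m + 6) * (n * (n + 1) + 1) + 3 * n + 20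

theorem codeSize_problem_le {p : Problem} (hp : p.vertices.Nodup) (hn : ∀ v ∈ p.vertices, v < n)
    (ht : p.target ≤ k) (hL : codeSize L ≤ 3 * n) :
    codeSize (p, L) ≤ sizeBound (codeSize p.inst) k m n := by
  have hsize : codeSize (p, L) = codeSize p.inst + (codeSize p.vertices + codeSize p.target + 1) +
    1 + codeSize L + 1 := rfl
  have hX := codeSize_vertices_le hp hn
  have hmul : 1 * (n * (n + 1)) ≤ (2 * m + 6) * (n * (n + 1) + 1) :=
    Nat.mul_le_mul (by omega) (Nat.le_succ _)
  rw [codeSize_nat] at hsize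
  rw [sizeBound]
  omega

theorem IsIndepList.codeSize_le {I : List ℕ} (h : IsIndepList Γ X t I) (hn : ∀ v ∈ X, v < n) :
    codeSize I ≤ n * (n + 1) :=
  codeSize_vertices_le h.nodup fun _ hv => hn _ (h.subset hv)

theorem IsAnswer.codeSize_le (h : IsAnswer Γ X t r) (hn : ∀ v ∈ X, v < n) :
    codeSize r ≤ n * (n + 1) + 1 := by
  rcases r with _ | I
  · exact Nat.zero_le _
  · rw [codeSize_some, zero_add]
    exact Nat.succ_le_succ ((h.sound I rfl).codeSize_le hn)

theorem codeSize_family_le {P : List (List ℕ)} (hP : ∀ p ∈ P, IsIndepList Γ X t p)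
    (hm : P.length ≤ m) (hn : ∀ v ∈ X, v < n) : codeSize P ≤ m * (n * (n + 1) + 1) :=
  (codeSize_list_le fun p hp => (hP p hp).codeSize_le hn).trans (Nat.mul_le_mul_right _ hm)

theorem SearchState.Valid.codeSize_le (h : s.Valid Γ T t) (hT : T.IsSearchable Γ k m g)
    (hnodup : T.vertices.Nodup) (hn : ∀ v ∈ T.vertices, v < n) (ht : t ≤ k)
    (hA : IsAnswer Γ (avoiding s.A s.P) s.i rA) (hB : IsAnswer Γ (avoiding s.B s.Q) s.j rB) :
    codeSize ((inst, s), rA, rB) ≤ sizeBound (codeSize inst) k m n := by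
  have hnA : ∀ v ∈ s.A, v < n := fun v hv => hn v (Parts.A_subset_vertices (h.refines.A.subset hv))
  have hnB : ∀ v ∈ s.B, v < n := fun v hv => hn v (Parts.B_subset_vertices (h.refines.B.subset hv))
  have hnR : ∀ v ∈ s.R, v < n := fun v hv => hn v (Parts.R_subset_vertices (h.refines.R.subset hv))
  have hlenP := h.length_P_le hT ht
  have hsA := codeSize_vertices_le (h.refines.A.nodup hT.nodup_A) hnA
  have hsB := codeSize_vertices_le (h.refines.B.nodup hT.nodup_B) hnB
  have hsR := codeSize_vertices_le
    ((h.refines.R.trans (List.sublist_append_right _ _)).nodup hnodup) hnR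
  have hsS := h.isIndepList.codeSize_le hn
  have hsP := codeSize_family_le h.families.left hlenP hnA
  have hsQ := codeSize_family_le h.families.right (h.families.length_eq ▸ hlenP) hnB
  have hrA := hA.codeSize_le fun v hv => hnA v (List.mem_of_mem_filter hv)
  have hrB := hB.codeSize_le fun v hv => hnB v (List.mem_of_mem_filter hv)
  have hsize : codeSize ((inst, s), rA, rB) = codeSize inst + (codeSize s.A + (codeSize s.B +
      codeSize s.R + 1) + 1 + (codeSize s.S + (codeSize s.i + (codeSize s.j + (codeSize s.P +
      codeSize s.Q + 1) + 1) + 1) + 1) + 1) + 1 + (codeSize rA + codeSize rB + 1) + 1 := by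
    change _ + ((_ + (_ + _ + 1) + 1) + _ + 1) + 1 + _ + 1 = _
    rfl
  rw [codeSize_nat, codeSize_nat] at hsize
  have hij := h.size
  have hsum : (2 * m + 6) * (n * (n + 1) + 1) =
    2 * (m * (n * (n + 1) + 1)) + 6 * (n * (n + 1)) + 6 := by ring
  rw [sizeBound]
  omega

end Sizes

/-! ### The recursion -/

/-- The parameter `k` and the values at `k` of the functions that bound the noise. -/
structure NoiseBounds where
  k : ℕ
  g₁ : ℕ
  d₁ : ℕ
  g₂ : ℕ
  d₂ : ℕ

namespace NoiseBounds

variable (b : NoiseBounds)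

/-- In an almost bicomplete tripartition of at least this many vertices the cross regions have few
subsets; with fewer vertices, nothing is known about the tripartition. -/
def smallSize : ℕ := 2 ^ (2 * b.d₁ + b.g₁) + 1

/-- A bound for the number of sets that a search records in either family: there are fewer vertices
than `smallSize`, or joined families are bounded by biclique-freeness. -/
def familySize : ℕ :=
  b.smallSize + ((b.d₂ + 1) * b.k + (b.d₂ + 1) * 2 ^ ((b.d₂ + 1) * b.k * b.k))

/-- A bound for the size of the part `R` in a search. -/
def remainderSize : ℕ := b.smallSize + b.g₂

/-- A bound for the number of states of a search. -/
def searchSize : ℕ :=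
  (b.k + 1) * (b.familySize + branchingBound b.k b.familySize b.remainderSize ^ b.k)

/-- The time for a search, as a multiple of the time for the longest query in it. -/
def searchFactor : ℕ := 3 * b.searchSize + 1

/-- The bound for the number of exceptional vertices of the links of a `SparseChain`. -/
def chainDegree : ℕ := b.d₂ * 2 ^ (b.k * b.d₂)

/-- A bound for the nesting of searches in a set of `x` vertices without a `SparseChain` of length
`l + 1`. Once there are fewer than `smallSize` vertices, every search loses a vertex. -/
def searchDepth (l x : ℕ) : ℕ := l + min x b.smallSize

/-- The time for a set of `x` vertices without a `SparseChain` of length `l + 1`, where `U` is the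
time spent in a call outside the recursive calls. -/
def cost (U l x : ℕ) : ℕ := U * b.searchFactor ^ b.searchDepth l x * (x + 1) ^ 2

/-- The part of `cost` that is available to every query of a search. -/
def queryCost (U l x : ℕ) : ℕ := U * b.searchFactor ^ (b.searchDepth l x - 1) * (x + 1) ^ 2

variable {b} {U l l' x y : ℕ}

theorem searchFactor_pow_le_pow {i j : ℕ} (h : i ≤ j) : b.searchFactor ^ i ≤ b.searchFactor ^ j :=
  Nat.pow_le_pow_right (Nat.succ_pos _) h

theorem le_mul_searchFactor_pow (i : ℕ) : U ≤ U * b.searchFactor ^ i :=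
  Nat.le_mul_of_pos_right _ (Nat.pow_pos (Nat.succ_pos _))

theorem le_cost : U ≤ b.cost U l x :=
  (le_mul_searchFactor_pow _).trans (Nat.le_mul_of_pos_right _ (by positivity))

theorem le_queryCost : U ≤ b.queryCost U l x :=
  (le_mul_searchFactor_pow _).trans (Nat.le_mul_of_pos_right _ (by positivity))

theorem cost_le_queryCost (hyx : y ≤ x) (h : b.searchDepth l' y < b.searchDepth l x) :
    b.cost U l' y ≤ b.queryCost U l x :=
  Nat.mul_le_mul (Nat.mul_le_mul_left _ (searchFactor_pow_le_pow (Nat.le_sub_one_of_lt h)))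
    (Nat.pow_le_pow_left (Nat.succ_le_succ hyx) 2)

theorem searchFactor_mul_queryCost (hx : 0 < x) :
    b.searchFactor * b.queryCost U l x = b.cost U l x := by
  obtain ⟨i, hi⟩ : ∃ i, b.searchDepth l x = i + 1 := Nat.exists_eq_succ_of_ne_zero (by
    have : 0 < min x b.smallSize := lt_min hx (Nat.succ_pos _)
    rw [searchDepth]
    omega)
  rw [cost, queryCost, hi, Nat.add_sub_cancel, pow_succ]
  ring

/-- Splitting into `A ∪ R` and `B ∪ R`, both smaller because `|R| < |A|, |B|`, yields at most
quadratically many sets. -/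
theorem sq_add_sq_add_one_le {a b r x : ℕ} (ha : r < a) (hb : r < b) (hx : x = a + b + r) :
    (a + r + 1) ^ 2 + (b + r + 1) ^ 2 + 1 ≤ (x + 1) ^ 2 := by
  subst hx
  obtain ⟨a, rfl⟩ := Nat.exists_eq_add_of_lt ha
  obtain ⟨b, rfl⟩ := Nat.exists_eq_add_of_lt hb
  ring_nf
  nlinarith [Nat.zero_le (r * a), Nat.zero_le (r * b), Nat.zero_le (a * b)]

theorem cost_add_cost_add_le {a c r : ℕ} (ha : r < a) (hc : r < c) (hx : x = a + c + r) :
    b.cost U l (a + r) + b.cost U l (c + r) + U ≤ b.cost U l x := by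
  have hdepth : ∀ y ≤ x, b.cost U l y ≤ U * b.searchFactor ^ b.searchDepth l x * (y + 1) ^ 2 :=
    fun y hy => Nat.mul_le_mul_right _ (Nat.mul_le_mul_left _ (searchFactor_pow_le_pow
      (Nat.add_le_add_left (min_le_min_right _ hy) l)))
  have hsq := Nat.mul_le_mul_left (U * b.searchFactor ^ b.searchDepth l x)
    (sq_add_sq_add_one_le ha hc hx)
  have hU : U ≤ U * b.searchFactor ^ b.searchDepth l x := le_mul_searchFactor_pow _
  have hda := hdepth (a + r) (by omega)
  have hdc := hdepth (c + r) (by omega)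
  rw [cost.eq_1 b U l x]
  linarith

end NoiseBounds

/-- `X` lists vertices below `n` without repetition, and its independent sets have size at most
`k`. -/
structure IsAdmissible (Γ : SimpleGraph ℕ) (k n : ℕ) (X : List ℕ) : Prop where
  nodup : X.Nodup
  lt : ∀ v ∈ X, v < n
  indep_le : ∀ t I, IsIndepList Γ X t I → t ≤ k

theorem IsAdmissible.of_subset {Γ : SimpleGraph ℕ} {k n : ℕ} {X Y : List ℕ}
    (h : IsAdmissible Γ k n X) (hY : Y.Nodup) (hYX : Y ⊆ X) : IsAdmissible Γ k n Y :=
  ⟨hY, fun v hv => h.lt v (hYX hv), fun t I hI => h.indep_le t I (hI.mono hYX)⟩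

theorem IsAdmissible.one_le {Γ : SimpleGraph ℕ} {k n : ℕ} {X : List ℕ}
    (h : IsAdmissible Γ k n X) (hX : 0 < X.length) : 1 ≤ k :=
  let ⟨_, hv⟩ := List.exists_mem_of_length_pos hX
  h.indep_le 1 _ (.singleton hv)

/-- The pair `(A, B)` is sparse, and `R` has at most `g` vertices. -/
structure Parts.IsSparse (Γ : SimpleGraph ℕ) [DecidableRel Γ.Adj] (k g d : ℕ) (S : Sparsity)
    (T : Parts) : Prop where
  length_R_le : T.R.length ≤ g
  isSparsePair : IsSparsePair Γ k d T.A.toFinset T.B.toFinset S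

/-- Within `τ` steps the program `q` finds tripartitions as in a class of co-graphs with
parameterized noise, for all admissible sets of vertices. -/
def FindsTripartitions (O : Oracle) (q : Prog) (inst : Instance) (Γ : SimpleGraph ℕ)
    [DecidableRel Γ.Adj] (S : Sparsity) (b : NoiseBounds) (n τ : ℕ) : Prop :=
  ∀ X, IsAdmissible Γ b.k n X → 2 ≤ X.length → ∃ L : List ℕ,
    (∀ t, EvalWithin O q q (toData (Problem.mk inst X t).inducedInstance) (toData L) τ) ∧
    codeSize L ≤ 3 * n ∧ (Parts.ofLabels X L).IsTripartition X ∧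
    ((Parts.ofLabels X L).IsAlmostBicomplete inst.1 b.g₁ b.d₁ ∨
      (Parts.ofLabels X L).IsSparse Γ b.k b.g₂ b.d₂ S)

section Sparse

variable {Γ : SimpleGraph ℕ} [DecidableRel Γ.Adj] {S : Sparsity} {b : NoiseBounds} {T : Parts}
  {X Y : List ℕ} {l : ℕ}

theorem Parts.IsTripartition.isSearchable (hT : T.IsTripartition X) (hX : X.Nodup)
    (hk : 1 ≤ b.k) (h : X.length < b.smallSize ∨ T.IsSparse Γ b.k b.g₂ b.d₂ S) :
    T.IsSearchable Γ b.k b.familySize b.remainderSize where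
  nodup_A := (List.sublist_append_left _ _).nodup (hT.nodup_A_append_R hX)
  nodup_B := (List.sublist_append_left _ _).nodup (hT.nodup_B_append_R hX)
  disjoint := hT.disjoint hX
  length_R_le := h.elim
    (fun hlt => by have := hT.length_eq; rw [NoiseBounds.remainderSize]; omega)
    fun hsparse => hsparse.length_R_le.trans (Nat.le_add_left _ _)
  familyBound := h.elim
    (fun hlt => .of_length_le (hT.length_A_lt.le.trans (hlt.le.trans (Nat.le_add_right _ _))))
    fun hsparse => .of_bicliqueFree hk hsparse.isSparsePair.bicliqueFree (Nat.le_add_left _ _)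

theorem Parts.IsTripartition.sparseChain_succ (hT : T.IsTripartition X) (hX : X.Nodup)
    (hk : 1 ≤ b.k) (h : T.IsSparse Γ b.k b.g₂ b.d₂ S) (hY : Y ⊆ T.A ∨ Y ⊆ T.B)
    (hchain : SparseChain Γ b.k b.chainDegree l Y.toFinset) :
    SparseChain Γ b.k b.chainDegree (l + 1) X.toFinset := by
  have hnonempty : ∀ {l : List ℕ}, T.R.length < l.length → l.toFinset.Nonempty := fun h =>
    let ⟨v, hv⟩ := List.exists_mem_of_length_pos (Nat.zero_lt_of_lt h)
    ⟨v, List.mem_toFinset.2 hv⟩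
  exact h.isSparsePair.sparseChain_succ hk (hnonempty hT.length_R_lt_A)
    (hnonempty hT.length_R_lt_B) (List.disjoint_toFinset_iff_disjoint.2 (hT.disjoint hX))
    (toFinset_subset_toFinset hT.A_subset) (toFinset_subset_toFinset hT.B_subset)
    (hY.imp toFinset_subset_toFinset toFinset_subset_toFinset) hchain

/-- A query of a search loses a vertex of a small set, or a link of the longest `SparseChain`. -/
theorem exists_searchDepth_lt (hT : T.IsTripartition X) (hX : X.Nodup) (hk : 1 ≤ b.k)
    (h : X.length < b.smallSize ∨ T.IsSparse Γ b.k b.g₂ b.d₂ S) (hY : Y ⊆ T.A ∨ Y ⊆ T.B)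
    (hlen : Y.length < X.length)
    (hchain : ¬ SparseChain Γ b.k b.chainDegree (l + 1) X.toFinset) :
    ∃ l', ¬ SparseChain Γ b.k b.chainDegree (l' + 1) Y.toFinset ∧
      b.searchDepth l' Y.length < b.searchDepth l X.length := by
  have hYX : Y ⊆ X := hY.elim (List.Subset.trans · hT.A_subset) (List.Subset.trans · hT.B_subset)
  rcases Nat.lt_or_ge X.length b.smallSize with hlt | hge
  · refine ⟨l, fun h => hchain (h.mono (toFinset_subset_toFinset hYX)), ?_⟩
    rw [NoiseBounds.searchDepth, NoiseBounds.searchDepth, min_eq_left hlt.le,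
      min_eq_left (hlen.trans hlt).le]
    omega
  · have hstep : ¬ SparseChain Γ b.k b.chainDegree l Y.toFinset := fun hY' =>
      hchain (hT.sparseChain_succ hX hk (h.resolve_left hge.not_gt) hY hY')
    rcases l with _ | l
    · exact absurd trivial hstep
    · refine ⟨l, hstep, ?_⟩
      have := min_le_right Y.length b.smallSize
      rw [NoiseBounds.searchDepth, NoiseBounds.searchDepth, min_eq_right hge]
      omega

theorem sum_weight_initialStates_le {m g t k : ℕ} (ht : t ≤ k) :
    ((initialStates T [] t).map (SearchState.weight k m g)).sum ≤
      (k + 1) * (m + branchingBound k m g ^ k) := by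
  have hweight : ∀ w ∈ (initialStates T [] t).map (SearchState.weight k m g),
      w ≤ m + branchingBound k m g ^ k := by
    intro w hw
    obtain ⟨s, hs, rfl⟩ := List.mem_map.1 hw
    rw [SearchState.weight_initialStates hs]
    exact Nat.add_le_add_left (Nat.pow_le_pow_right (Nat.succ_pos _) ht) _
  have hsum := List.sum_le_card_nsmul _ _ hweight
  rw [List.length_map, length_initialStates, smul_eq_mul] at hsum
  exact hsum.trans (Nat.mul_le_mul_right _ (Nat.succ_le_succ ht))

end Sparse

section Recursion

variable {O : Oracle} {q : Prog} {inst : Instance} {Γ : SimpleGraph ℕ}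
  {b : NoiseBounds} {X L : List ℕ} {n t τ U l : ℕ}

theorem answers_of_hasSmallCrossRegions (hM : IsAdjMatrix inst.1 Γ) (hX : IsAdmissible Γ b.k n X)
    (htriv : ¬ (Problem.mk inst X t).IsTrivial)
    (hq : EvalWithin O q q (toData (Problem.mk inst X t).inducedInstance) (toData L) τ)
    (hT : (Parts.ofLabels X L).IsTripartition X)
    (hsmall : (Problem.mk inst X t).HasSmallCrossRegions L)
    (hU : τ + overhead (codeSize (Problem.mk inst X t, L)) ≤ U)
    (ih : ∀ Y, Y.length < X.length → IsAdmissible Γ b.k n Y → Y ⊆ X →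
      Answers O q inst Γ Y t (b.cost U l Y.length)) :
    Answers O q inst Γ X t (b.cost U l X.length) := by
  have hlen := hT.length_eq
  have hltA := hT.length_R_lt_A
  have hltB := hT.length_R_lt_B
  have hsubA := List.append_subset.2 ⟨hT.A_subset, hT.R_subset⟩
  have hsubB := List.append_subset.2 ⟨hT.B_subset, hT.R_subset⟩
  obtain ⟨rA, hevA, hA⟩ := ih _ (by rw [List.length_append]; omega)
    (hX.of_subset (hT.nodup_A_append_R hX.nodup) hsubA) hsubA
  obtain ⟨rB, hevB, hB⟩ := ih _ (by rw [List.length_append]; omega)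
    (hX.of_subset (hT.nodup_B_append_R hX.nodup) hsubB) hsubB
  refine ⟨_, (Solves.of_hasSmallCrossRegions htriv hq hsmall hevA hevB).mono ?_,
    isAnswer_or_crossAnswer (p := ⟨inst, X, t⟩) (L := L) hM hX.nodup hT hsmall hA hB⟩
  have hcost := NoiseBounds.cost_add_cost_add_le (b := b) (U := U) (l := l) hltA hltB hlen
  rw [List.length_append, List.length_append]
  omega

theorem answers_of_isSearchable (hM : IsAdjMatrix inst.1 Γ) (hX : IsAdmissible Γ b.k n X)
    (htriv : ¬ (Problem.mk inst X t).IsTrivial) (ht : t ≤ b.k)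
    (hq : EvalWithin O q q (toData (Problem.mk inst X t).inducedInstance) (toData L) τ)
    (hL : codeSize L ≤ 3 * n) (hT : (Parts.ofLabels X L).IsTripartition X)
    (hsmall : ¬ (Problem.mk inst X t).HasSmallCrossRegions L)
    (hsearch : (Parts.ofLabels X L).IsSearchable Γ b.k b.familySize b.remainderSize)
    (hU : τ + overhead (sizeBound (codeSize inst) b.k b.familySize n) + 40 ≤ U)
    (hcall : AnswersQueries O q inst Γ (Parts.ofLabels X L) t (b.queryCost U l X.length)) :
    Answers O q inst Γ X t (b.cost U l X.length) := by
  have hnodup := hT.nodup_vertices hX.nodup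
  have hlt : ∀ v ∈ (Parts.ofLabels X L).vertices, v < n := fun v hv => hX.lt v (hT.subset hv)
  have hstate : ∀ (s : SearchState) (rA rB : Option (List ℕ)),
      s.Valid Γ (Parts.ofLabels X L) t → IsAnswer Γ (avoiding s.A s.P) s.i rA →
      IsAnswer Γ (avoiding s.B s.Q) s.j rB → overhead (codeSize ((inst, s), rA, rB)) +
        2 * b.queryCost U l X.length + 20 ≤ 3 * b.queryCost U l X.length := by
    intro s rA rB hs hA hB
    have hov := overhead_mono (hs.codeSize_le (inst := inst) hsearch hnodup hlt ht hA hB)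
    have hle := NoiseBounds.le_queryCost (b := b) (U := U) (l := l) (x := X.length)
    omega
  obtain ⟨r, hr⟩ := exists_searchReturns hM hsearch ht hcall hstate
    (initialStates (Parts.ofLabels X L) [] t) fun s => SearchState.valid_of_mem_initialStates
      (.refl _) .nil (by simp [Apart]) (Nat.zero_add t)
  refine ⟨r, (Solves.of_search htriv hq hsmall hr.solves).mono ?_,
    fun I hI => (hr.sound I hI).mono hT.subset, fun hnone I hI => ?_⟩
  · have hov := overhead_mono (codeSize_problem_le (p := ⟨inst, X, t⟩) (m := b.familySize)
      hX.nodup hX.lt ht hL)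
    have hle := NoiseBounds.le_queryCost (b := b) (U := U) (l := l) (x := X.length)
    have hweight := Nat.mul_le_mul_right (3 * b.queryCost U l X.length)
      (sum_weight_initialStates_le (T := Parts.ofLabels X L) (m := b.familySize)
        (g := b.remainderSize) ht)
    rw [← NoiseBounds.searchFactor_mul_queryCost (by have := hT.length_A_lt; omega),
      NoiseBounds.searchFactor]
    change _ ≤ b.searchSize * _ at hweight
    dsimp only at hov
    linarith
  · obtain ⟨s, hs, hcov⟩ := SearchState.exists_covers_initialStates (S := []) hsearch.disjoint
      (hI.mono fun v hv => hT.perm.mem_iff.2 hv)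
    exact hr.complete hnone s hs I hcov

theorem answers_of_findsTripartitions [DecidableRel Γ.Adj] {S : Sparsity}
    (hM : IsAdjMatrix inst.1 Γ) (hq : FindsTripartitions O q inst Γ S b n τ)
    (hU : τ + overhead (sizeBound (codeSize inst) b.k b.familySize n) + 40 ≤ U)
    (hX : IsAdmissible Γ b.k n X) (ht : t ≤ b.k)
    (hchain : ¬ SparseChain Γ b.k b.chainDegree (l + 1) X.toFinset) :
    Answers O q inst Γ X t (b.cost U l X.length) := by
  induction hx : X.length using Nat.strong_induction_on generalizing X l t with
  | _ x ih =>
    subst hx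
    by_cases htriv : (Problem.mk inst X t).IsTrivial
    · have hov := overhead_mono (codeSize_problem_le (p := ⟨inst, X, t⟩) (L := [])
        (m := b.familySize) hX.nodup hX.lt ht (Nat.zero_le _))
      have hpos : overhead (codeSize (Problem.mk inst X t)) ≤
          overhead (codeSize (Problem.mk inst X t, ([] : List ℕ))) :=
        overhead_mono (by rw [codeSize_pair]; omega)
      exact ⟨_, (Solves.of_isTrivial htriv).mono ((by dsimp only at *; omega : _ ≤ U).trans
        NoiseBounds.le_cost), Problem.isAnswer_trivialAnswer htriv⟩
    have hlen : 2 ≤ X.length := not_lt.1 fun h => htriv (Or.inr h)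
    have hk := hX.one_le (by omega)
    obtain ⟨L, hL, hsizeL, hT, hcase⟩ := hq X hX hlen
    by_cases hsmall : (Problem.mk inst X t).HasSmallCrossRegions L
    · have hov := overhead_mono (codeSize_problem_le (p := ⟨inst, X, t⟩) (m := b.familySize)
        hX.nodup hX.lt ht hsizeL)
      exact answers_of_hasSmallCrossRegions hM hX htriv (hL t) hT hsmall
        (by dsimp only at hov; omega) fun Y hY hYX hsub => ih _ hY hYX ht
          (fun h => hchain (h.mono (toFinset_subset_toFinset hsub))) rfl
    have hsparse : X.length < b.smallSize ∨
        (Parts.ofLabels X L).IsSparse Γ b.k b.g₂ b.d₂ S :=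
      (Nat.lt_or_ge _ _).imp_right fun hge => hcase.resolve_left fun hbic =>
        hsmall (Parts.IsAlmostBicomplete.hasSmallCrossRegions hbic hge)
    refine answers_of_isSearchable hM hX htriv ht (hL t) hsizeL hT hsmall
      (hT.isSearchable hX.nodup hk hsparse) hU fun Y t' hY hYT ht' => ?_
    have hYX : Y ⊆ X := hYT.elim (List.Subset.trans · hT.A_subset)
      (List.Subset.trans · hT.B_subset)
    have hYlen : Y.length < X.length := hYT.elim
      (fun h => (List.subperm_of_subset hY h).length_le.trans_lt hT.length_A_lt)
      fun h => (List.subperm_of_subset hY h).length_le.trans_lt hT.length_B_lt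
    obtain ⟨l', hl', hdepth⟩ := exists_searchDepth_lt hT hX.nodup hk hsparse hYT hYlen hchain
    exact (ih _ hYlen (hX.of_subset hY hYX) (ht'.trans ht) hl' rfl).mono
      (NoiseBounds.cost_le_queryCost hYlen.le hdepth)

end Recursion

/-! ### Graphs as subgraphs of graphs on the natural numbers -/

section Encodings

variable {n : ℕ}

open Classical in
/-- The adjacency matrix of a graph, as the list of its rows. -/
noncomputable def matrixOf (G : SimpleGraph (Fin n)) : List (List Bool) :=
  List.ofFn fun i => List.ofFn fun j => decide (G.Adj i j)

theorem toData_ofFn {α : Type} [TreeEncoding α] (f : Fin n → α) :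
    toData (List.ofFn f) = Data.ofList (List.ofFn fun i => toData (f i)) := by
  change Data.ofList ((List.ofFn f).map toData) = _
  rw [List.map_ofFn]
  rfl

open Classical in
theorem toData_decide (P : Prop) : toData (decide P) = Data.ofProp P := by
  rw [Data.ofProp]
  by_cases h : P
  · rw [if_pos h, decide_eq_true h, toData_true]
  · rw [if_neg h, decide_eq_false h, toData_false]

theorem toData_matrixOf (G : SimpleGraph (Fin n)) : toData (matrixOf G) = encodeGraph G := by
  rw [matrixOf, toData_ofFn]
  simp only [toData_ofFn, toData_decide]
  rfl

theorem toData_matrixOf_pair (G : SimpleGraph (Fin n)) (k : ℕ) :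
    toData (matrixOf G, k) = encodeInstance G k :=
  congrArg (Data.cons · _) (toData_matrixOf G)

theorem codeSize_matrixOf_le (G : SimpleGraph (Fin n)) :
    codeSize (matrixOf G) ≤ n * (n * 2 + 1) := by
  refine (codeSize_list_le (m := n * 2) fun row hrow => ?_).trans_eq (by
    rw [matrixOf, List.length_ofFn])
  obtain ⟨i, rfl⟩ := List.mem_ofFn.1 hrow
  exact (codeSize_list_le fun b _ => codeSize_bool_le b).trans_eq (by rw [List.length_ofFn])

theorem isAdjMatrix_matrixOf (G : SimpleGraph (Fin n)) :
    IsAdjMatrix (matrixOf G) (G.map Fin.valEmbedding) := by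
  intro u v
  rw [entry, matrixOf, List.getD_eq_getElem?_getD, List.getD_eq_getElem?_getD,
    List.getElem?_ofFn, SimpleGraph.map_adj]
  constructor
  · intro h
    by_cases hu : u < n <;> by_cases hv : v < n <;>
      simp only [hu, hv, dite_true, dite_false, Option.getD_some, Option.getD_none,
        List.length_ofFn, List.length_nil, not_lt_zero, not_false_eq_true, getElem?_pos,
        getElem?_neg, List.getElem_ofFn, decide_eq_true_eq, Bool.false_eq_true] at h
    exact ⟨⟨u, hu⟩, ⟨v, hv⟩, h, rfl, rfl⟩
  · rintro ⟨i, j, h, rfl, rfl⟩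
    simpa using h

/-- The label of a vertex in the encoding of a tripartition. -/
def Tripartition.label (T : Tripartition (Fin n)) (v : Fin n) : ℕ :=
  if v ∈ T.A then 0 else if v ∈ T.B then 1 else 2

namespace Tripartition

variable (T : Tripartition (Fin n)) {v : Fin n}

theorem toData_labels : toData (List.ofFn T.label) = T.encode := toData_ofFn _

theorem label_eq_zero : T.label v = 0 ↔ v ∈ T.A := by
  unfold label
  split_ifs <;> simp_all

theorem label_eq_one : T.label v = 1 ↔ v ∈ T.B := by
  have := fun h : v ∈ T.A => Finset.disjoint_left.1 T.disjoint_AB h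
  unfold label
  split_ifs <;> simp_all

theorem label_eq_two : T.label v = 2 ↔ v ∈ T.R := by
  have hA := fun h : v ∈ T.A => Finset.disjoint_left.1 T.disjoint_AR h
  have hB := fun h : v ∈ T.B => Finset.disjoint_left.1 T.disjoint_BR h
  have hcover : v ∈ T.A ∪ T.B ∪ T.R := T.cover ▸ Finset.mem_univ v
  simp only [Finset.mem_union] at hcover
  unfold label
  split_ifs <;> simp_all

theorem label_le_two : T.label v ≤ 2 := by
  unfold label
  split_ifs <;> omega

end Tripartition

theorem codeSize_labels_le (T : Tripartition (Fin n)) : codeSize (List.ofFn T.label) ≤ 3 * n := by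
  refine (codeSize_list_le (m := 2) fun a ha => ?_).trans_eq (by rw [List.length_ofFn, mul_comm])
  obtain ⟨i, rfl⟩ := List.mem_ofFn.1 ha
  exact (codeSize_nat _).trans_le T.label_le_two

end Encodings

section Embeddings

variable {V W : Type} {H : SimpleGraph V} {Γ : SimpleGraph W}

theorem BicliqueFree.map {d : ℕ} {A B : Finset V} (h : BicliqueFree H d A B) (f : H ↪g Γ) :
    BicliqueFree Γ d (A.map f.toEmbedding) (B.map f.toEmbedding) := by
  rintro ⟨X, Y, hX, hY, hXd, hYd, hadj⟩
  obtain ⟨X, hX', rfl⟩ := Finset.subset_map_iff.1 hX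
  obtain ⟨Y, hY', rfl⟩ := Finset.subset_map_iff.1 hY
  rw [Finset.card_map] at hXd hYd
  exact h ⟨X, Y, hX', hY', hXd, hYd, fun x hx y hy => f.map_adj_iff.1
    (hadj _ (Finset.mem_map_of_mem _ hx) _ (Finset.mem_map_of_mem _ hy))⟩

theorem filter_adj_map [DecidableRel H.Adj] [DecidableRel Γ.Adj] (f : H ↪g Γ) (v : V)
    (B : Finset V) :
    (B.map f.toEmbedding).filter (Γ.Adj (f v)) = (B.filter (H.Adj v)).map f.toEmbedding := by
  rw [Finset.filter_map]
  congr 1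
  exact Finset.filter_congr fun u _ => f.map_adj_iff

theorem IsSparsePair.map [DecidableRel H.Adj] [DecidableRel Γ.Adj] {k d : ℕ} {A B : Finset V}
    {S : Sparsity} (h : IsSparsePair H k d A B S) (f : H ↪g Γ) :
    IsSparsePair Γ k d (A.map f.toEmbedding) (B.map f.toEmbedding) S := by
  have card_neighbors_le : ∀ {A B : Finset V}, (∀ v ∈ A, (B.filter (H.Adj v)).card ≤ d) →
      ∀ v ∈ A.map f.toEmbedding, ((B.map f.toEmbedding).filter (Γ.Adj v)).card ≤ d := by
    intro A B hAB v hv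
    obtain ⟨w, hw, rfl⟩ := Finset.mem_map.1 hv
    exact (congrArg Finset.card (filter_adj_map f w B)).trans_le
      ((Finset.card_map _).trans_le (hAB w hw))
  cases S with
  | almostDisconnected => exact ⟨card_neighbors_le h.1, card_neighbors_le h.2⟩
  | oneSidedAlmostDisconnected =>
    exact ⟨by rw [Finset.card_map]; exact h.1, card_neighbors_le h.2⟩
  | weaklyConnected =>
    exact ⟨by rw [Finset.card_map]; exact h.1, by rw [Finset.card_map]; exact h.2.1, h.2.2.map f⟩

theorem IsSparseWitness.isSparsePair {S : Sparsity} {m k g d : ℕ} {H : SimpleGraph (Fin m)}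
    [DecidableRel H.Adj] {T : Tripartition (Fin m)} (h : IsSparseWitness S H T k g d) :
    IsSparsePair H k d T.A T.B S := by
  cases S with
  | almostDisconnected =>
    exact ⟨fun v hv => by convert h.2.2.1 v hv, fun v hv => by convert h.2.2.2 v hv⟩
  | oneSidedAlmostDisconnected => exact ⟨h.2.2.1, fun v hv => by convert h.2.2.2 v hv⟩
  | weaklyConnected => exact ⟨h.2.2.1, h.2.2.2.1, h.2.2.2.2⟩

theorem IsSparseWitness.card_R_le {S : Sparsity} {m k g d : ℕ} {H : SimpleGraph (Fin m)}
    {T : Tripartition (Fin m)} (h : IsSparseWitness S H T k g d) : T.R.card ≤ g := by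
  cases S <;> exact h.2.1

theorem IsWitness.nontrivial {S : Sparsity} {N : Noise} {m k : ℕ} {H : SimpleGraph (Fin m)}
    {T : Tripartition (Fin m)} (h : IsWitness S N H k T) : T.Nontrivial :=
  h.elim (fun h => h.1) fun h => by cases S <;> exact h.1

end Embeddings

section IndependentSets

variable {Γ : SimpleGraph ℕ} {X I : List ℕ} {k t n : ℕ}

theorem IsIndepList.of_isNIndepSet {I : Finset ℕ} (h : Γ.IsNIndepSet t I) (hI : ∀ v ∈ I, v ∈ X) :
    IsIndepList Γ X t I.toList where
  nodup := Finset.nodup_toList _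
  length_eq := (Finset.length_toList _).trans h.card_eq
  subset v hv := hI v (Finset.mem_toList.1 hv)
  not_adj _ hu _ hv huv :=
    h.isIndepSet (Finset.mem_toList.1 hu) (Finset.mem_toList.1 hv) huv.ne huv

theorem isNIndepSet_map {V W : Type} {H : SimpleGraph V} {Γ : SimpleGraph W} {I : Finset V}
    (h : H.IsNIndepSet t I) (f : H ↪g Γ) : Γ.IsNIndepSet t (I.map f.toEmbedding) := by
  refine ⟨fun _ hu _ hv _ huv => ?_, (Finset.card_map _).trans h.card_eq⟩
  obtain ⟨i, hi, rfl⟩ := Finset.mem_map.1 (Finset.mem_coe.1 hu)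
  obtain ⟨j, hj, rfl⟩ := Finset.mem_map.1 (Finset.mem_coe.1 hv)
  have hij := f.map_adj_iff.1 huv
  exact h.isIndepSet hi hj hij.ne hij

theorem exists_isIndepList_iff (G : SimpleGraph (Fin n)) :
    (∃ I, IsIndepList (G.map Fin.valEmbedding) (List.range n) k I) ↔
      ∃ I : Finset (Fin n), G.IsNIndepSet k I := by
  constructor
  · rintro ⟨I, hI⟩
    have hlt : ∀ v ∈ I.toFinset, v < n := fun v hv =>
      List.mem_range.1 (hI.subset (List.mem_toFinset.1 hv))
    refine ⟨I.toFinset.attachFin hlt, fun u hu v hv _ huv => ?_, ?_⟩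
    · rw [Finset.mem_coe, Finset.mem_attachFin, List.mem_toFinset] at hu hv
      exact hI.not_adj _ hu _ hv (SimpleGraph.map_adj_apply.2 huv)
    · rw [Finset.card_attachFin, List.toFinset_card_of_nodup hI.nodup, hI.length_eq]
  · rintro ⟨I, hI⟩
    refine ⟨_, .of_isNIndepSet (isNIndepSet_map hI (.map Fin.valEmbedding G)) fun v hv => ?_⟩
    obtain ⟨i, -, rfl⟩ := Finset.mem_map.1 hv
    exact List.mem_range.2 i.2

theorem indepNum_le_of_embedding {m : ℕ} {H : SimpleGraph (Fin m)} (f : H ↪g Γ)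
    (hf : ∀ i, f i ∈ X) (h : ∀ t I, IsIndepList Γ X t I → t ≤ k) : H.indepNum ≤ k := by
  obtain ⟨I, hI⟩ := H.exists_isNIndepSet_indepNum
  refine h _ _ (.of_isNIndepSet (isNIndepSet_map hI f) fun v hv => ?_)
  obtain ⟨i, -, rfl⟩ := Finset.mem_map.1 hv
  exact hf i

theorem not_sparseChain_of_indep_le [DecidableRel Γ.Adj] {e : ℕ}
    (h : ∀ t I, IsIndepList Γ X t I → t ≤ k) :
    ¬ SparseChain Γ k e ((k + 1) * (e + 1)) X.toFinset := by
  intro hchain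
  obtain ⟨I, hIX, -, hI⟩ := hchain.exists_isNIndepSet (W := ∅) (j := k + 1) (by simp) le_rfl
  exact (h _ _ (.of_isNIndepSet hI fun v hv => List.mem_toFinset.1 (hIX hv))).not_gt k.lt_succ_self

end IndependentSets

/-! ### Tripartitions of induced subgraphs -/

section Labels

variable {X L l : List ℕ} {M : List (List Bool)} {V : Type} {H : SimpleGraph V} {Γ : SimpleGraph ℕ}

theorem Parts.vertices_ofLabels_perm (h : ∀ v ∈ X, L.getD (X.idxOf v) 3 ≤ 2) :
    (ofLabels X L).vertices.Perm X := by
  refine List.perm_iff_count.2 fun v => ?_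
  have count_labelClass : ∀ a, (labelClass X L a).count v =
      if L.getD (X.idxOf v) 3 = a then X.count v else 0 := by
    intro a
    rw [labelClass]
    split_ifs with hv
    · exact List.count_filter (by simpa using hv)
    · exact List.count_eq_zero.2 fun hmem => hv (by simpa using List.of_mem_filter hmem)
  rw [vertices, List.count_append, List.count_append]
  simp only [ofLabels, count_labelClass]
  by_cases hv : v ∈ X
  · have := h v hv
    split_ifs <;> omega
  · simp [List.count_eq_zero.2 hv]

theorem getD_ofFn_idxOf (hX : X.Nodup) (label : Fin X.length → ℕ) (i : Fin X.length) :
    (List.ofFn label).getD (X.idxOf X[i]) 3 = label i := by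
  rw [Fin.getElem_fin, hX.idxOf_getElem, List.getD_eq_getElem?_getD, List.getElem?_ofFn]
  simp

theorem mem_labelClass_ofFn (hX : X.Nodup) {label : Fin X.length → ℕ} {v a : ℕ} :
    v ∈ labelClass X (List.ofFn label) a ↔ ∃ i : Fin X.length, label i = a ∧ X[i] = v := by
  rw [labelClass, List.mem_filter, decide_eq_true_eq]
  constructor
  · rintro ⟨hv, ha⟩
    obtain ⟨i, hi, rfl⟩ := List.getElem_of_mem hv
    exact ⟨⟨i, hi⟩, (getD_ofFn_idxOf hX label ⟨i, hi⟩).symm.trans ha, rfl⟩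
  · rintro ⟨i, rfl, rfl⟩
    exact ⟨List.getElem_mem _, getD_ofFn_idxOf hX label i⟩

theorem toFinset_labelClass_ofFn (hX : X.Nodup) {label : Fin X.length → ℕ} {a : ℕ}
    {A : Finset (Fin X.length)} (hA : ∀ i, label i = a ↔ i ∈ A) {f : Fin X.length ↪ ℕ}
    (hf : ∀ i, f i = X[i]) : (labelClass X (List.ofFn label) a).toFinset = A.map f := by
  ext v
  rw [List.mem_toFinset, mem_labelClass_ofFn hX, Finset.mem_map]
  exact exists_congr fun i => and_congr (hA i) (by rw [hf])

theorem length_labelClass_ofFn (hX : X.Nodup) {label : Fin X.length → ℕ} {a : ℕ}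
    {A : Finset (Fin X.length)} (hA : ∀ i, label i = a ↔ i ∈ A) {f : Fin X.length ↪ ℕ}
    (hf : ∀ i, f i = X[i]) : (labelClass X (List.ofFn label) a).length = A.card := by
  have hnodup : (labelClass X (List.ofFn label) a).Nodup := hX.filter _
  rw [← List.toFinset_card_of_nodup hnodup, toFinset_labelClass_ofFn hX hA hf, Finset.card_map]

theorem length_nonneighbors_embedding (hM : IsAdjMatrix M Γ) (f : H ↪g Γ) [DecidableRel H.Adj]
    {B : Finset V} (hl : l.Nodup) (hB : l.toFinset = B.map f.toEmbedding) (v : V) :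
    (nonneighbors M (f v) l).length = (B.filter fun w => ¬ H.Adj v w).card := by
  have hnodup : (nonneighbors M (f v) l).Nodup := hl.filter _
  rw [← List.toFinset_card_of_nodup hnodup, ← Finset.card_map f.toEmbedding]
  congr 1
  ext w
  rw [List.mem_toFinset, mem_nonneighbors hM, ← List.mem_toFinset, hB]
  simp only [Finset.mem_map, Finset.mem_filter]
  constructor
  · rintro ⟨⟨u, hu, rfl⟩, hvu⟩
    exact ⟨u, ⟨hu, fun h => hvu (f.map_adj_iff.2 h)⟩, rfl⟩
  · rintro ⟨u, ⟨hu, hvu⟩, rfl⟩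
    exact ⟨⟨u, hu, rfl⟩, fun h => hvu (f.map_adj_iff.1 h)⟩

end Labels

section Witnesses

variable {X : List ℕ} {H : SimpleGraph (Fin X.length)} {Γ : SimpleGraph ℕ}
  {T : Tripartition (Fin X.length)}

theorem Tripartition.isTripartition_ofLabels (hT : T.Nontrivial) (hX : X.Nodup)
    {f : Fin X.length ↪ ℕ} (hf : ∀ i, f i = X[i]) :
    (Parts.ofLabels X (List.ofFn T.label)).IsTripartition X := by
  have hA := length_labelClass_ofFn hX (fun _ => T.label_eq_zero) hf
  have hB := length_labelClass_ofFn hX (fun _ => T.label_eq_one) hf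
  have hR := length_labelClass_ofFn hX (fun _ => T.label_eq_two) hf
  obtain ⟨hRA, hRB⟩ := lt_min_iff.1 hT.2.2
  refine ⟨Parts.vertices_ofLabels_perm fun v hv => ?_, (hR.trans_lt hRA).trans_eq hA.symm,
    (hR.trans_lt hRB).trans_eq hB.symm⟩
  obtain ⟨i, hi, rfl⟩ := List.getElem_of_mem hv
  exact (getD_ofFn_idxOf hX T.label ⟨i, hi⟩).trans_le T.label_le_two

theorem Tripartition.AlmostBicomplete.isAlmostBicomplete {M : List (List Bool)} {g d : ℕ}
    (hT : T.AlmostBicomplete H g d) (hM : IsAdjMatrix M Γ) (hX : X.Nodup) (f : H ↪g Γ)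
    (hf : ∀ i, f i = X[i]) :
    (Parts.ofLabels X (List.ofFn T.label)).IsAlmostBicomplete M g d := by
  classical
  have nonneighbors_le : ∀ {a c : ℕ} {A B : Finset (Fin X.length)},
      (∀ i, T.label i = a ↔ i ∈ A) → (∀ i, T.label i = c ↔ i ∈ B) →
      (∀ i ∈ A, (B.filter fun w => ¬ H.Adj i w).card ≤ d) →
      ∀ v ∈ labelClass X (List.ofFn T.label) a,
        (nonneighbors M v (labelClass X (List.ofFn T.label) c)).length ≤ d := by
    intro a c A B hA hB hAB v hv
    obtain ⟨i, hi, rfl⟩ := (mem_labelClass_ofFn hX).1 hv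
    rw [← hf i]
    exact (length_nonneighbors_embedding hM f (hX.filter _)
      (toFinset_labelClass_ofFn hX hB hf) i).trans_le (hAB i ((hA i).1 hi))
  refine ⟨(length_labelClass_ofFn hX (fun _ => T.label_eq_two) (f := f.toEmbedding) hf).trans_le
    hT.2.1, nonneighbors_le (fun _ => T.label_eq_zero) (fun _ => T.label_eq_one) fun v hv => ?_,
    nonneighbors_le (fun _ => T.label_eq_one) (fun _ => T.label_eq_zero) fun v hv => ?_⟩
  · convert hT.2.2.1 v hv
  · convert hT.2.2.2 v hv

theorem IsSparseWitness.isSparse [DecidableRel Γ.Adj] {S : Sparsity} {k g d : ℕ}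
    (hT : IsSparseWitness S H T k g d) (hX : X.Nodup) (f : H ↪g Γ) (hf : ∀ i, f i = X[i]) :
    (Parts.ofLabels X (List.ofFn T.label)).IsSparse Γ k g d S where
  length_R_le :=
    (length_labelClass_ofFn hX (fun _ => T.label_eq_two) (f := f.toEmbedding) hf).trans_le
      hT.card_R_le
  isSparsePair := by
    classical
    rw [Parts.ofLabels, toFinset_labelClass_ofFn hX (fun _ => T.label_eq_zero) hf,
      toFinset_labelClass_ofFn hX (fun _ => T.label_eq_one) hf]
    exact hT.isSparsePair.map f

theorem inducedInstance_eq_matrixOf {M : List (List Bool)} {k t : ℕ} (hM : IsAdjMatrix M Γ)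
    (f : H ↪g Γ) (hf : ∀ i, f i = X[i]) :
    (Problem.mk (M, k) X t).inducedInstance = (matrixOf H, k) := by
  have map_eq_ofFn : ∀ {β : Type} (g : ℕ → β), X.map g = List.ofFn fun i => g (f i) := by
    intro β g
    simp only [hf]
    exact (List.ofFn_getElem_eq_map X g).symm
  classical
  rw [Problem.inducedInstance, matrixOf]
  simp only [map_eq_ofFn]
  congr! 5 with i j
  exact Bool.eq_iff_iff.2 ((hM _ _).trans (f.map_adj_iff.trans (decide_eq_true_iff).symm))

end Witnesses

/-- The values of the noise functions at the parameter `k`. -/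
def Noise.bounds (N : Noise) (k : ℕ) : NoiseBounds := ⟨k, N.g₁ k, N.d₁ k, N.g₂ k, N.d₂ k⟩

/-- The program `q` finds the tripartitions of the graphs in `C` within `h k * n ^ γ` steps, where
`n` is the number of vertices. -/
def FindsTripartitionsWithin (O : Oracle) (S : Sparsity) (N : Noise) (C : GraphClass) (q : Prog)
    (h : ℕ → ℕ) (γ : ℕ) : Prop :=
  ∀ (n : ℕ) (G : SimpleGraph (Fin n)) (k : ℕ), 2 ≤ n → G ∈ C n → G.indepNum ≤ k →
    ∃ T : Tripartition (Fin n), IsWitness S N G k T ∧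
      ∃ t : ℕ, t ≤ h k * n ^ γ ∧ Runs O q (encodeInstance G k) T.encode t

theorem FindsTripartitionsWithin.findsTripartitions {O : Oracle} {S : Sparsity} {N : Noise}
    {C : GraphClass} {q : Prog} {h : ℕ → ℕ} {γ : ℕ} (hq : FindsTripartitionsWithin O S N C q h γ)
    (hC : C.Hereditary) {n k : ℕ} {G : SimpleGraph (Fin n)}
    [DecidableRel (G.map Fin.valEmbedding).Adj] (hG : G ∈ C n) :
    FindsTripartitions O q (matrixOf G, k) (G.map Fin.valEmbedding) S (N.bounds k) n
      (h k * n ^ γ) := by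
  intro X hX hlen
  let g : Fin X.length ↪ Fin n :=
    ⟨fun i => ⟨X[i], hX.lt _ (List.getElem_mem _)⟩, fun i j hij =>
      Fin.ext (hX.nodup.getElem_inj_iff.1 (Fin.ext_iff.1 hij))⟩
  let f : G.comap g ↪g G.map Fin.valEmbedding :=
    (SimpleGraph.Embedding.map Fin.valEmbedding G).comp (SimpleGraph.Embedding.comap g G)
  have hf : ∀ i, f i = X[i] := fun _ => rfl
  have hXn : X.length ≤ n := length_le_of_nodup_of_lt hX.nodup hX.lt
  obtain ⟨T, hT, s, hs, hrun⟩ := hq X.length (G.comap g) k hlen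
    (hC _ _ _ G hG ⟨.comap g G⟩)
    (indepNum_le_of_embedding f (fun i => List.getElem_mem _) hX.indep_le)
  refine ⟨List.ofFn T.label, fun t => ⟨s, hs.trans ?_, ?_⟩,
    (codeSize_labels_le T).trans (Nat.mul_le_mul_left 3 hXn),
    T.isTripartition_ofLabels hT.nontrivial hX.nodup (f := f.toEmbedding) hf,
    hT.imp (fun h => h.isAlmostBicomplete (isAdjMatrix_matrixOf G) hX.nodup f hf)
      fun h => h.isSparse hX.nodup f hf⟩
  · exact Nat.mul_le_mul_left _ (Nat.pow_le_pow_left hXn γ)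
  · rw [inducedInstance_eq_matrixOf (isAdjMatrix_matrixOf G) f hf, toData_matrixOf_pair,
      T.toData_labels]
    exact hrun

/-! ### The decision program -/

section DecisionProgram

theorem polyTime_callAll : PolyTime fun x : Instance × List ℕ =>
    (Sum.inl ⟨x.1, x.2, x.1.2⟩ : Call) :=
  PolyTime.inl (by fun_prop)

theorem polyTime_vertexList : PolyTime fun inst : Instance => List.range inst.1.length := by
  fun_prop

theorem polyTime_isSome : PolyTime fun r : Option (List ℕ) => r.isSome := by
  fun_prop

/-- On a pair of an instance and a list of vertices: call the solver for all listed vertices. -/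
noncomputable def callSolver (q : Prog) : Prog :=
  Prog.comp (Prog.fn (solverBody q)) polyTime_callAll.prog

/-- The body of a function on pairs of an instance and a list of vertices. It calls the solver only
if the tail of the list has no solution; the independence number of the list is then at most the
target, so that the solver may ask for tripartitions. -/
noncomputable def tailFirstBody (q : Prog) : Prog :=
  Prog.cond Prog.tl
    (Prog.orElse (Prog.comp Prog.self (Prog.cons Prog.hd (Prog.comp Prog.tl Prog.tl)))
      (callSolver q))
    (callSolver q)

/-- The program that decides whether a graph has an independent set of the given size. -/
noncomputable def decisionProgram (q : Prog) : Prog :=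
  Prog.comp polyTime_isSome.prog (Prog.comp (Prog.fn (tailFirstBody q))
    (Prog.cons Prog.id polyTime_vertexList.prog))

/-- An exponent that is large enough for all polynomial time steps of the decision program. -/
noncomputable def decisionExponent : ℕ :=
  stepExponent + 8 + polyTime_callAll.exponent + polyTime_vertexList.exponent +
    polyTime_isSome.exponent

variable {O : Oracle} {q : Prog} {inst : Instance} {Γ : SimpleGraph ℕ} {X l : List ℕ}
  {v n k t τ P : ℕ}

theorem IsIndepList.le_of_cons (h : ∀ I, ¬ IsIndepList Γ l k I) :
    ∀ t I, IsIndepList Γ (v :: l) t I → t ≤ k := by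
  intro t I hI
  by_contra! hkt
  have hlen : k ≤ (I.erase v).length := by
    have := hI.length_eq
    rw [List.length_erase]
    split_ifs <;> omega
  have hsub : (I.erase v).take k ⊆ l := fun u hu => by
    have hu' := hI.nodup.mem_erase_iff.1 (List.mem_of_mem_take hu)
    exact (List.mem_cons.1 (hI.subset hu'.2)).resolve_left hu'.1
  have hsol := hI.of_sublist ((List.take_sublist k _).trans List.erase_sublist) hsub
  rw [List.length_take_of_le hlen] at hsol
  exact h _ hsol

theorem IsIndepList.le_of_nil {I : List ℕ} (h : IsIndepList Γ [] t I) : t ≤ k := by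
  rw [← h.length_eq, List.subset_nil.1 h.subset]
  exact Nat.zero_le k

theorem IsAnswer.mono_of_some {Y I : List ℕ} (h : IsAnswer Γ X t (some I)) (hXY : X ⊆ Y) :
    IsAnswer Γ Y t (some I) :=
  ⟨fun J hJ => (h.sound J hJ).mono hXY, fun hnone => nomatch hnone⟩

theorem evalWithin_callSolver (F : Prog) (h : Answers O q inst Γ X inst.2 τ)
    (hP : (codeSize (inst, X) + 2) ^ decisionExponent ≤ P) :
    ∃ r, EvalWithin O F (callSolver q) (toData (inst, X)) (toData r) (τ + P + 2) ∧
      IsAnswer Γ X inst.2 r := by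
  obtain ⟨r, hr, hans⟩ := h
  have hcall := polyTime_callAll.evalWithin_prog (c := decisionExponent)
    (by unfold decisionExponent; omega) O F (inst, X)
  exact ⟨r, (hcall.comp (EvalWithin.fn hr)).mono (by omega), hans⟩

theorem evalWithin_tailFirstBody
    (h : ∀ Y, IsAdmissible Γ inst.2 n Y → Answers O q inst Γ Y inst.2 τ)
    (hX : X.Nodup) (hn : ∀ v ∈ X, v < n)
    (hP : (codeSize (inst, X) + 2) ^ decisionExponent ≤ P) :
    ∃ r, EvalWithin O (tailFirstBody q) (tailFirstBody q) (toData (inst, X)) (toData r)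
      ((X.length + 1) * (τ + P + 40)) ∧ IsAnswer Γ X inst.2 r := by
  induction X with
  | nil =>
    obtain ⟨r, hr, hans⟩ := evalWithin_callSolver (tailFirstBody q)
      (h [] ⟨hX, hn, fun _ _ hI => hI.le_of_nil⟩) hP
    exact ⟨r, (EvalWithin.cond_false EvalWithin.tl hr).mono (by rw [List.length_nil]; omega), hans⟩
  | cons v l ih =>
    obtain ⟨r₁, hr₁, hans₁⟩ := ih hX.of_cons (fun u hu => hn u (List.mem_cons_of_mem v hu))
      (le_trans (Nat.pow_le_pow_left (by simp only [codeSize_pair, codeSize_cons]; omega) _) hP)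
    have htail : EvalWithin O (tailFirstBody q) (Prog.cons Prog.hd (Prog.comp Prog.tl Prog.tl))
        (toData (inst, v :: l)) (toData (inst, l)) 5 :=
      EvalWithin.cons EvalWithin.hd (EvalWithin.comp EvalWithin.tl EvalWithin.tl)
    suffices ∃ r₂, (r₁ = none → EvalWithin O (tailFirstBody q) (callSolver q)
        (toData (inst, v :: l)) (toData r₂) (τ + P + 2)) ∧
          IsAnswer Γ (v :: l) inst.2 (r₁.or r₂) by
      obtain ⟨r₂, hr₂, hans₂⟩ := this
      refine ⟨r₁.or r₂, (EvalWithin.cond_true EvalWithin.tl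
        (EvalWithin.orElse (htail.comp hr₁.self) hr₂)).mono ?_, hans₂⟩
      rw [List.length_cons, add_mul (l.length + 1)]
      omega
    cases r₁ with
    | none =>
      obtain ⟨r₂, hr₂, hans₂⟩ := evalWithin_callSolver (tailFirstBody q)
        (h (v :: l) ⟨hX, hn, IsIndepList.le_of_cons (hans₁.complete rfl)⟩) hP
      exact ⟨r₂, fun _ => hr₂, hans₂⟩
    | some I => exact ⟨none, nofun, hans₁.mono_of_some (List.subset_cons_self v l)⟩

theorem evalWithin_decisionProgram
    (h : ∀ Y, IsAdmissible Γ inst.2 n Y → Answers O q inst Γ Y inst.2 τ)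
    (hlen : inst.1.length = n)
    (hP : (codeSize inst + n * (n + 1) + 3) ^ decisionExponent ≤ P) :
    ∃ r, EvalWithin O (decisionProgram q) (decisionProgram q) (toData inst) (toData r.isSome)
      ((n + 1) * (τ + P + 40) + 2 * P + 5) ∧ IsAnswer Γ (List.range n) inst.2 r := by
  subst hlen
  have hn : ∀ v ∈ List.range inst.1.length, v < inst.1.length := fun v hv => List.mem_range.1 hv
  have hsize := codeSize_vertices_le List.nodup_range hn
  have step_le : ∀ {s : ℕ}, s ≤ codeSize inst + inst.1.length * (inst.1.length + 1) + 1 →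
      (s + 2) ^ decisionExponent ≤ P := fun hs =>
    (Nat.pow_le_pow_left (Nat.add_le_add_right hs 2) _).trans hP
  obtain ⟨r, hr, hans⟩ := evalWithin_tailFirstBody h List.nodup_range hn
    (step_le (by rw [codeSize_pair]; omega))
  have hvertices := (polyTime_vertexList.evalWithin_prog (c := decisionExponent)
    (by unfold decisionExponent; omega) O (decisionProgram q) inst).mono (step_le (by omega))
  have hisSome := (polyTime_isSome.evalWithin_prog (c := decisionExponent)
    (by unfold decisionExponent; omega) O (decisionProgram q) r).mono
      (step_le ((hans.codeSize_le hn).trans (by omega)))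
  rw [List.length_range] at hr
  exact ⟨r, (((EvalWithin.id.cons hvertices).comp hr.fn).comp hisSome).mono (by omega), hans⟩

end DecisionProgram

/-! ### The running time -/

namespace NoiseBounds

variable (b : NoiseBounds)

/-- A `SparseChain` in a graph with independence number at most `k` has at most this length. -/
def chainBound : ℕ := b.k * (b.chainDegree + 1) + b.chainDegree

/-- The time for a graph, as a multiple of a polynomial in the number of its vertices and of the
time spent in a call outside the recursive calls. -/
def timeFactor : ℕ := b.searchFactor ^ (b.chainBound + b.smallSize)

/-- The size of the arguments of all function calls, as a multiple of the square of the number of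
vertices. -/
def sizeFactor : ℕ := 2 * b.familySize + 3 * b.k + 40

variable {b} {n x U : ℕ}

theorem cost_chainBound_le (hx : x ≤ n) :
    b.cost U b.chainBound x ≤ U * b.timeFactor * (n + 1) ^ 2 :=
  Nat.mul_le_mul (Nat.mul_le_mul_left _ (searchFactor_pow_le_pow
    (Nat.add_le_add_left (min_le_right _ _) _))) (Nat.pow_le_pow_left (Nat.succ_le_succ hx) 2)

theorem sizeBound_add_two_le (G : SimpleGraph (Fin n)) :
    sizeBound (codeSize (matrixOf G, b.k)) b.k b.familySize n + 2 ≤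
      b.sizeFactor * (n + 1) ^ 2 := by
  have hG := codeSize_matrixOf_le G
  rw [codeSize_pair, codeSize_nat, sizeBound, sizeFactor]
  nlinarith [Nat.zero_le (b.familySize * n), Nat.zero_le (b.k * n), Nat.zero_le (b.k * n * n)]

end NoiseBounds

section Computability

variable {f g : ℕ → ℕ}

theorem computable_add (hf : Computable f) (hg : Computable g) : Computable fun k => f k + g k :=
  Primrec.nat_add.to_comp.comp hf hg

theorem computable_mul (hf : Computable f) (hg : Computable g) : Computable fun k => f k * g k :=
  Primrec.nat_mul.to_comp.comp hf hg

theorem primrec₂_pow : Primrec₂ fun a b : ℕ => a ^ b :=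
  (Primrec.nat_iterate (f := fun x : ℕ × ℕ => x.2) (g := fun _ => 1) (h := fun x r => r * x.1)
    Primrec.snd (.const 1) (Primrec.nat_mul.comp .snd (Primrec.fst.comp .fst))).of_eq
      fun x => by rw [mul_right_iterate]; exact one_mul _

theorem computable_pow (hf : Computable f) (hg : Computable g) : Computable fun k => f k ^ g k :=
  primrec₂_pow.to_comp.comp hf hg

end Computability

namespace Noise

variable (N : Noise)

theorem computable_smallSize : Computable fun k => (N.bounds k).smallSize :=
  computable_add (computable_pow (.const 2) (computable_add
    (computable_mul (.const 2) N.computable_d₁) N.computable_g₁)) (.const 1)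

theorem computable_familySize : Computable fun k => (N.bounds k).familySize :=
  have hd := computable_add N.computable_d₂ (.const 1)
  computable_add N.computable_smallSize (computable_add (computable_mul hd .id)
    (computable_mul hd (computable_pow (.const 2) (computable_mul (computable_mul hd .id) .id))))

theorem computable_searchFactor : Computable fun k => (N.bounds k).searchFactor := by
  have hm := N.computable_familySize
  have hg := computable_add N.computable_smallSize N.computable_g₂
  have hbranch : Computable fun k => branchingBound k (N.bounds k).familySize
      (N.bounds k).remainderSize :=
    computable_add (computable_mul (computable_mul (computable_add
      (computable_mul (computable_mul (.const 2) hm) .id) hg) .id)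
      (computable_add hm (.const 1))) (.const 1)
  exact computable_add (computable_mul (.const 3) (computable_mul
    (computable_add .id (.const 1)) (computable_add hm (computable_pow hbranch .id)))) (.const 1)

theorem computable_timeFactor : Computable fun k => (N.bounds k).timeFactor := by
  have hdegree : Computable fun k => (N.bounds k).chainDegree :=
    computable_mul N.computable_d₂ (computable_pow (.const 2) (computable_mul .id N.computable_d₂))
  have hchain : Computable fun k => (N.bounds k).chainBound :=
    computable_add (computable_mul .id (computable_add hdegree (.const 1))) hdegree
  exact computable_pow N.computable_searchFactor (computable_add hchain N.computable_smallSize)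

theorem computable_sizeFactor : Computable fun k => (N.bounds k).sizeFactor :=
  computable_add (computable_add (computable_mul (.const 2) N.computable_familySize)
    (computable_mul (.const 3) .id)) (.const 40)

/-- The time for a call outside the recursive calls, as a multiple of a polynomial in the number of
vertices, if tripartitions are found in time at most `h k` times a polynomial. -/
noncomputable def callFactor (h : ℕ → ℕ) (k : ℕ) : ℕ :=
  h k + (N.bounds k).sizeFactor ^ decisionExponent + 40

/-- The running time of the decision program, as a multiple of a polynomial in the number of
vertices. -/
noncomputable def fptFactor (h : ℕ → ℕ) (k : ℕ) : ℕ :=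
  N.callFactor h k * ((N.bounds k).timeFactor + 5)

theorem computable_fptFactor {h : ℕ → ℕ} (hh : Computable h) : Computable (N.fptFactor h) :=
  computable_mul (computable_add (computable_add hh (computable_pow N.computable_sizeFactor
    (.const _))) (.const 40)) (computable_add N.computable_timeFactor (.const 5))

end Noise

section FixedParameterTractability

variable {O : Oracle} {S : Sparsity} {N : Noise} {C : GraphClass} {q : Prog} {h : ℕ → ℕ}
  {X : List ℕ} {k n γ : ℕ}

theorem overhead_sizeBound_le {b : NoiseBounds} (G : SimpleGraph (Fin n)) :
    overhead (sizeBound (codeSize (matrixOf G, b.k)) b.k b.familySize n) ≤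
      (b.sizeFactor * (n + 1) ^ 2) ^ decisionExponent :=
  (Nat.pow_le_pow_left (NoiseBounds.sizeBound_add_two_le G) _).trans
    (Nat.pow_le_pow_right ((Nat.le_add_left 1 _).trans (NoiseBounds.sizeBound_add_two_le G))
      (by unfold decisionExponent; omega))

theorem add_le_callFactor_mul : h k * n ^ γ +
    ((N.bounds k).sizeFactor * (n + 1) ^ 2) ^ decisionExponent + 40 ≤
      N.callFactor h k * (n + 1) ^ (2 * decisionExponent + γ) := by
  have hγ : n ^ γ ≤ (n + 1) ^ (2 * decisionExponent + γ) :=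
    (Nat.pow_le_pow_left n.le_succ γ).trans (Nat.pow_le_pow_right n.succ_pos (by omega))
  have hexp : ((n + 1) ^ 2) ^ decisionExponent ≤ (n + 1) ^ (2 * decisionExponent + γ) := by
    rw [← pow_mul]
    exact Nat.pow_le_pow_right n.succ_pos (by omega)
  rw [Noise.callFactor, add_mul, add_mul, mul_pow]
  exact Nat.add_le_add (Nat.add_le_add (Nat.mul_le_mul_left _ hγ) (Nat.mul_le_mul_left _ hexp))
    (Nat.le_mul_of_pos_right 40 (Nat.pow_pos n.succ_pos))

theorem FindsTripartitionsWithin.answers (hq : FindsTripartitionsWithin O S N C q h γ)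
    (hC : C.Hereditary) {G : SimpleGraph (Fin n)} (hG : G ∈ C n)
    (hX : IsAdmissible (G.map Fin.valEmbedding) k n X) :
    Answers O q (matrixOf G, k) (G.map Fin.valEmbedding) X k
      (N.callFactor h k * (n + 1) ^ (2 * decisionExponent + γ) * (N.bounds k).timeFactor *
        (n + 1) ^ 2) := by
  classical
  have hchain := not_sparseChain_of_indep_le (e := (N.bounds k).chainDegree) hX.indep_le
  rw [show (k + 1) * ((N.bounds k).chainDegree + 1) = (N.bounds k).chainBound + 1 by
    rw [NoiseBounds.chainBound, Noise.bounds]; ring] at hchain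
  have hov := overhead_sizeBound_le (b := N.bounds k) G
  exact (answers_of_findsTripartitions (b := N.bounds k) (isAdjMatrix_matrixOf G)
    (hq.findsTripartitions hC hG) (le_trans (by gcongr; exact hov) add_le_callFactor_mul) hX le_rfl
    hchain).mono (NoiseBounds.cost_chainBound_le (length_le_of_nodup_of_lt hX.nodup hX.lt))

theorem decisionTime_le {u κ w U P : ℕ} (hu : 40 ≤ u) (hU : U = u * (n + 1) ^ w)
    (hP : P ≤ U) :
    (n + 1) * (U * κ * (n + 1) ^ 2 + P + 40) + 2 * P + 5 ≤ u * (κ + 5) * (n + 1) ^ (w + 3) := by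
  have h40 : 40 ≤ U := hU ▸ hu.trans (Nat.le_mul_of_pos_right u (Nat.pow_pos n.succ_pos))
  have hn : n + 1 ≤ (n + 1) ^ 3 := Nat.le_self_pow three_ne_zero _
  have hU' : U ≤ U * (n + 1) ^ 3 := Nat.le_mul_of_pos_right U (Nat.pow_pos n.succ_pos)
  calc (n + 1) * (U * κ * (n + 1) ^ 2 + P + 40) + 2 * P + 5
      = U * κ * (n + 1) ^ 3 + P * (n + 1) + 40 * (n + 1) + 2 * P + 5 := by ring
    _ ≤ U * κ * (n + 1) ^ 3 + U * (n + 1) ^ 3 + U * (n + 1) ^ 3 + 2 * (U * (n + 1) ^ 3) +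
          U * (n + 1) ^ 3 := by
        gcongr <;> omega
    _ = u * (κ + 5) * (n + 1) ^ (w + 3) := by rw [hU, pow_add]; ring

theorem FindsTripartitionsWithin.runs_decisionProgram
    (hq : FindsTripartitionsWithin O S N C q h γ) (hC : C.Hereditary) (k : ℕ)
    {G : SimpleGraph (Fin n)} (hG : G ∈ C n) :
    ∃ t ≤ N.fptFactor h k * (n + 1) ^ (2 * decisionExponent + γ + 3),
      Runs O (decisionProgram q) (encodeInstance G k)
        (Data.ofProp (∃ I : Finset (Fin n), G.IsNIndepSet k I)) t := by
  have hsize : codeSize (matrixOf G, k) + n * (n + 1) + 3 ≤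
      (N.bounds k).sizeFactor * (n + 1) ^ 2 := by
    have hbound := NoiseBounds.sizeBound_add_two_le (b := N.bounds k) G
    have hmul := Nat.le_mul_of_pos_left (n * (n + 1) + 1)
      (show 0 < 2 * (N.bounds k).familySize + 6 by omega)
    rw [sizeBound] at hbound
    change codeSize (matrixOf G, k) + _ + _ + _ + _ + _ ≤ _ at hbound
    omega
  obtain ⟨r, ⟨t, ht, hrun⟩, hr⟩ := evalWithin_decisionProgram (fun X hX => hq.answers hC hG hX)
    List.length_ofFn (Nat.pow_le_pow_left hsize decisionExponent)
  have hsome : r.isSome = true ↔ ∃ I : Finset (Fin n), G.IsNIndepSet k I := by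
    rw [← exists_isIndepList_iff]
    cases r with
    | none => simpa using hr.complete rfl
    | some I => simpa using ⟨I, hr.sound I rfl⟩
  refine ⟨t, ht.trans (decisionTime_le (Nat.le_add_left _ _) rfl
    (le_trans (by omega) add_le_callFactor_mul)), ?_⟩
  rwa [← toData_matrixOf_pair, ← toData_decide,
    ← Bool.eq_iff_iff.2 (hsome.trans (@decide_eq_true_iff _ (Classical.propDecidable _)).symm)]

end FixedParameterTractability

end NoisyCographs

theorem mainTheorem8 (S : NoisyCographs.Sparsity) (N : NoisyCographs.Noise)
    (C : NoisyCographs.GraphClass) (hC : NoisyCographs.IsNoisyCographClass S N C)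
    (O : NoisyCographs.Oracle) (hO : NoisyCographs.FindsTripartitionsFPT O S N C) :
    NoisyCographs.MISIsFPT O C := by
  obtain ⟨q, h, γ, hh, hq⟩ := hO
  exact ⟨NoisyCographs.decisionProgram q, N.fptFactor h, _, N.computable_fptFactor hh,
    fun n G k hG => NoisyCographs.FindsTripartitionsWithin.runs_decisionProgram hq hC.1 k hG⟩
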